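/- All graphs are finite and simple. A \emph{path system} in a graph $G=(V,E)$ is a collection $\mathcal P$ of paths in $G$ containing exactly one $uv$-path for every $u,v\in V$. It is \emph{consistent} if any two paths in $\mathcal P$ are vertex disjoint, or have exactly one vertex in common, or intersect in a path belonging to $\mathcal P$. It is \emph{metric} if there is a weight function $w:E\to\mathbb R_{>0}$ such that every path in $\mathcal P$ is a $w$-shortest path between its ends. The graph $G$ is \emph{metrizable} if every consistent path system in $G$ is metric. A \emph{flat path} in $G$ is a path of length at least $2$ all of whose internal vertices have degree $2$ in $G$, and an edge $xy$ of $G$ is \emph{compliant} if $x$ and $y$ are also connected by a flat path. **Theorem.** Let $G$ be a graph with at least $11$ vertices which is $2$-connected, has no compliant edges, and contains two vertex-disjoint cycles. Then $G$ is not metrizable. -/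

import Mathlib

/-- A path system in `G`, with exactly one path for each pair of vertices. Paths are undirected, so
the path chosen for `(v, u)` is the path chosen for `(u, v)` traversed backwards. For `u = v`
the path is the trivial one. -/
structure PathSystem {V : Type*} (G : SimpleGraph V) where
  /-- the chosen path between `u` and `v` -/
  path : ∀ u v : V, G.Walk u v
  isPath : ∀ u v : V, (path u v).IsPath
  symm : ∀ u v : V, path v u = (path u v).reverse

/-- A path system is consistent if any two of its paths are vertex disjoint, or have exactly one
vertex in common, or intersect (as subgraphs) in a path of the system. -/
def PathSystem.Consistent {V : Type*} {G : SimpleGraph V} (P : PathSystem G) : Prop :=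
  ∀ u v x y : V,
    (P.path u v).toSubgraph.verts ∩ (P.path x y).toSubgraph.verts = ∅ ∨
    (∃ a : V, (P.path u v).toSubgraph.verts ∩ (P.path x y).toSubgraph.verts = {a}) ∨
    (∃ a b : V, (P.path u v).toSubgraph ⊓ (P.path x y).toSubgraph = (P.path a b).toSubgraph)

/-- The total weight of the edges of a walk. -/
def walkWeight {V : Type*} {G : SimpleGraph V} (w : Sym2 V → ℝ) {u v : V} (p : G.Walk u v) : ℝ :=
  (p.edges.map w).sum

/-- A path system is metric if, for some weight function that is positive on the edges of `G`,
each of its paths is a shortest path between its ends. The values of `w` outside the edge set of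
`G` play no role. -/
def PathSystem.IsMetric {V : Type*} {G : SimpleGraph V} (P : PathSystem G) : Prop :=
  ∃ w : Sym2 V → ℝ, (∀ e ∈ G.edgeSet, 0 < w e) ∧
    ∀ (u v : V) (q : G.Walk u v), q.IsPath → walkWeight w (P.path u v) ≤ walkWeight w q

/-- A graph is metrizable if each of its consistent path systems is metric. -/
def SimpleGraph.Metrizable {V : Type*} (G : SimpleGraph V) : Prop :=
  ∀ P : PathSystem G, P.Consistent → P.IsMetric

/-- A finite graph is 2-connected if it is connected, has at least three vertices, and remains
connected after the removal of any one vertex. -/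
def SimpleGraph.TwoConnected {V : Type*} [Fintype V] (G : SimpleGraph V) : Prop :=
  3 ≤ Fintype.card V ∧ G.Connected ∧ ∀ v : V, (G.induce {v}ᶜ).Connected

/-- A flat path is a path of length at least two all of whose internal vertices have degree two
in `G`. -/
def SimpleGraph.IsFlatPath {V : Type*} [Fintype V] (G : SimpleGraph V) [DecidableRel G.Adj]
    {u v : V} (p : G.Walk u v) : Prop :=
  p.IsPath ∧ 2 ≤ p.length ∧ ∀ z ∈ p.support, z ≠ u → z ≠ v → G.degree z = 2

/-- The edge `xy` of `G` is compliant if `x` and `y` are also connected by a flat path. -/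
def SimpleGraph.IsCompliantEdge {V : Type*} [Fintype V] (G : SimpleGraph V) [DecidableRel G.Adj]
    (x y : V) : Prop :=
  G.Adj x y ∧ ∃ p : G.Walk x y, G.IsFlatPath p

/-- `G` has two vertex-disjoint cycles. -/
def SimpleGraph.HasTwoDisjointCycles {V : Type*} (G : SimpleGraph V) : Prop :=
  ∃ (a b : V) (c : G.Walk a a) (d : G.Walk b b),
    c.IsCycle ∧ d.IsCycle ∧ ∀ z : V, z ∈ c.support → z ∉ d.support

/-!
A graph that contains a subdivision of a nonmetrizable graph, and is connected, is itself
nonmetrizable: a consistent path system that is not metric survives the subdivision of an edge and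
the attachment of a new vertex (`NonmetrizableOn.insert`), hence it can be carried from the small
graph to its subdivision (`IsModel.nonmetrizableOn`) and then to the whole graph
(`NonmetrizableOn.univ`). So it suffices to find in `G` a subdivision of one of a few small
nonmetrizable graphs, for which a path system is given by a table of next vertices and the
nonexistence of weights by a Farkas certificate (`nonmetrizableOn_of_table`).

Besides the nonmetrizable ones, the list `smallGraph` contains some metrizable graphs with at most
10 vertices, among them the triangular prism. If a 2-connected graph with at least 11 vertices
contains a subdivision of one of those, then it also contains a subdivision of a graph with one
more vertex, obtained by subdividing an edge or by joining two vertices by a path of length two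
(`ContainsSubdivision.exists_extension`); and all graphs obtained in this way contain subdivisions
of earlier graphs of the list (`forall₂_embeddings`). Hence a metrizable 2-connected graph with at
least 11 vertices contains no subdivision of any of the small graphs (`not_contains_smallGraph`).

It remains to derive a contradiction for a graph without such subdivisions. Two disjoint cycles in
a 2-connected graph are joined by two disjoint paths (`hasDisjointLinks`). If on both cycles both
arcs between the ends of these paths have interior vertices, one of the small graphs appears.
Otherwise one of the arcs is an edge, and as this edge is not compliant, an interior vertex of the
other arc has a third edge, where an ear of the whole configuration starts (`exists_ear`). If the
joining paths are as long as possible, the ear cannot end on the cycle where it starts; if it ends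
on the other cycle away from the joining paths, a prism appears; if it ends on a joining path, then
the arc that was an edge can be replaced by one with interior vertices; and if it ends at the far
end of a joining path, the result is a linked triangle (`hasImprovement_of_ear`). Linked triangles
are excluded by another ear, chosen in the same way on the second cycle (`not_isLinkedTriangle`).
-/

namespace DisjointCycles

variable {V : Type*}

/-! ### Inserting a vertex into a nonmetrizable graph -/

/-- The total weight of the edges between consecutive vertices of a list. -/
def listWeight (w : Sym2 V → ℝ) : List V → ℝ
  | a :: b :: l => w s(a, b) + listWeight w (b :: l)
  | _ => 0

/-- Insert `z` between any two consecutive vertices of a list that are the ends of the edge `xy`. -/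
def subdivideEdge [DecidableEq V] (x y z : V) : List V → List V
  | a :: b :: l =>
    if s(a, b) = s(x, y) then a :: z :: subdivideEdge x y z (b :: l)
    else a :: subdivideEdge x y z (b :: l)
  | [a] => [a]
  | [] => []

section Subdivide

variable [DecidableEq V] {x y z : V}

theorem subdivideEdge_cons_cons_of_eq {a b : V} {l : List V} (h : s(a, b) = s(x, y)) :
    subdivideEdge x y z (a :: b :: l) = a :: z :: subdivideEdge x y z (b :: l) := by
  simp [subdivideEdge, h]

theorem subdivideEdge_cons_cons_of_ne {a b : V} {l : List V} (h : s(a, b) ≠ s(x, y)) :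
    subdivideEdge x y z (a :: b :: l) = a :: subdivideEdge x y z (b :: l) := by
  simp only [subdivideEdge, if_neg h]

theorem subdivideEdge_cons (a : V) (l : List V) :
    ∃ t, subdivideEdge x y z (a :: l) = a :: t := by
  cases l with
  | nil => exact ⟨[], rfl⟩
  | cons b l => simp only [subdivideEdge]; split_ifs <;> simp

theorem subdivideEdge_append_pair (l : List V) (b a : V) :
    subdivideEdge x y z (l ++ [b, a]) =
      subdivideEdge x y z (l ++ [b]) ++ if s(b, a) = s(x, y) then [z, a] else [a] := by
  induction l with
  | nil => simp only [List.nil_append, subdivideEdge]; split_ifs <;> simp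
  | cons c l ih =>
    cases l with
    | nil =>
      simp only [List.nil_append, List.cons_append] at ih ⊢
      by_cases h : s(c, b) = s(x, y)
      · rw [subdivideEdge_cons_cons_of_eq h, subdivideEdge_cons_cons_of_eq h, ih]; simp
      · rw [subdivideEdge_cons_cons_of_ne h, subdivideEdge_cons_cons_of_ne h, ih]; simp
    | cons d l =>
      simp only [List.cons_append] at ih ⊢
      by_cases h : s(c, d) = s(x, y)
      · rw [subdivideEdge_cons_cons_of_eq h, subdivideEdge_cons_cons_of_eq h, ih]; simp
      · rw [subdivideEdge_cons_cons_of_ne h, subdivideEdge_cons_cons_of_ne h, ih]; simp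

theorem subdivideEdge_reverse (l : List V) :
    subdivideEdge x y z l.reverse = (subdivideEdge x y z l).reverse := by
  induction l with
  | nil => rfl
  | cons a l ih =>
    cases l with
    | nil => rfl
    | cons b l =>
      have : (a :: b :: l).reverse = l.reverse ++ [b, a] := by simp
      rw [this, subdivideEdge_append_pair]
      have h2 : l.reverse ++ [b] = (b :: l).reverse := by simp
      rw [h2, ih]
      by_cases h : s(a, b) = s(x, y)
      · rw [subdivideEdge_cons_cons_of_eq h, if_pos (by rwa [Sym2.eq_swap])]; simp
      · rw [subdivideEdge_cons_cons_of_ne h, if_neg (by rwa [Sym2.eq_swap])]; simp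

theorem mem_subdivideEdge {a : V} {l : List V} (h : a ∈ subdivideEdge x y z l) :
    a ∈ l ∨ a = z := by
  induction l with
  | nil => simp [subdivideEdge] at h
  | cons c l ih =>
    cases l with
    | nil => left; simpa [subdivideEdge] using h
    | cons d l =>
      simp only [subdivideEdge] at h
      split_ifs at h <;> simp only [List.mem_cons] at h ih ⊢ <;> tauto

/-- A list that misses `x` or `y` is left as it is. -/
theorem subdivideEdge_of_notMem {l : List V} (h : x ∉ l ∨ y ∉ l) :
    subdivideEdge x y z l = l := by
  induction l with
  | nil => rfl
  | cons c l ih =>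
    cases l with
    | nil => rfl
    | cons d l =>
      have hne : s(c, d) ≠ s(x, y) := by
        intro he
        rw [Sym2.eq_iff] at he
        rcases he with ⟨rfl, rfl⟩ | ⟨rfl, rfl⟩ <;> simp at h
      rw [subdivideEdge_cons_cons_of_ne hne, ih]
      rcases h with h | h
      · exact Or.inl fun h' => h (List.mem_cons_of_mem _ h')
      · exact Or.inr fun h' => h (List.mem_cons_of_mem _ h')

theorem nodup_subdivideEdge {l : List V} (hl : l.Nodup) (hz : z ∉ l) :
    (subdivideEdge x y z l).Nodup := by
  induction l with
  | nil => simp [subdivideEdge]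
  | cons c l ih =>
    cases l with
    | nil => simp [subdivideEdge]
    | cons d l =>
      have hz' : z ∉ d :: l := fun h => hz (List.mem_cons_of_mem _ h)
      have hcz : c ≠ z := fun h => hz (h ▸ List.mem_cons_self)
      have hc := (List.nodup_cons.1 hl).1
      by_cases h : s(c, d) = s(x, y)
      · rw [subdivideEdge_cons_cons_of_eq h]
        -- the edge `xy` cannot be met a second time, since `c` is one of its ends
        rw [subdivideEdge_of_notMem (by
          rw [Sym2.eq_iff] at h
          rcases h with ⟨rfl, rfl⟩ | ⟨rfl, rfl⟩
          · exact Or.inl hc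
          · exact Or.inr hc)]
        refine List.nodup_cons.2 ⟨?_, List.nodup_cons.2 ⟨hz', (List.nodup_cons.1 hl).2⟩⟩
        simp only [List.mem_cons] at hc ⊢; tauto
      · rw [subdivideEdge_cons_cons_of_ne h]
        refine List.nodup_cons.2 ⟨fun hm => ?_, ih (List.nodup_cons.1 hl).2 hz'⟩
        rcases mem_subdivideEdge hm with h1 | h1
        · exact hc h1
        · exact hcz h1

theorem isChain_subdivideEdge {G G' : SimpleGraph V} {S : Set V} (hxz : G'.Adj x z)
    (hadj : ∀ a ∈ S, ∀ b ∈ S, G.Adj a b → if s(a, b) = s(x, y) then G'.Adj z y else G'.Adj a b)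
    {l : List V} (hl : l.IsChain G.Adj) (hS : ∀ a ∈ l, a ∈ S) :
    (subdivideEdge x y z l).IsChain G'.Adj := by
  induction l with
  | nil => simp [subdivideEdge]
  | cons c l ih =>
    cases l with
    | nil => simp [subdivideEdge]
    | cons d l =>
      have ih' := ih (List.isChain_cons_cons.1 hl).2 fun a ha => hS a (List.mem_cons_of_mem _ ha)
      have hcd := hadj c (hS c (by simp)) d (hS d (by simp)) (List.isChain_cons_cons.1 hl).1
      obtain ⟨t, ht⟩ := subdivideEdge_cons (x := x) (y := y) (z := z) d l
      by_cases h : s(c, d) = s(x, y)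
      · rw [subdivideEdge_cons_cons_of_eq h, ht]
        rw [ht] at ih'
        rw [if_pos h] at hcd
        rw [Sym2.eq_iff] at h
        rcases h with ⟨rfl, rfl⟩ | ⟨rfl, rfl⟩
        · simp [ih', hxz, hcd]
        · simp [ih', hxz.symm, hcd.symm]
      · rw [subdivideEdge_cons_cons_of_ne h, ht]
        rw [ht] at ih'
        rw [if_neg h] at hcd
        simp [ih', hcd]

theorem listWeight_subdivideEdge (w : Sym2 V → ℝ) {l : List V} (hz : z ∉ l) :
    listWeight w (subdivideEdge x y z l) =
      listWeight (fun e => if e = s(x, y) then w s(x, z) + w s(z, y) else w e) l := by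
  induction l with
  | nil => rfl
  | cons c l ih =>
    cases l with
    | nil => rfl
    | cons d l =>
      have ih' := ih fun h => hz (List.mem_cons_of_mem _ h)
      have hcons : ∀ w' : Sym2 V → ℝ, listWeight w' (c :: d :: l) =
        w' s(c, d) + listWeight w' (d :: l) := fun _ => rfl
      obtain ⟨t, ht⟩ := subdivideEdge_cons (x := x) (y := y) (z := z) d l
      by_cases h : s(c, d) = s(x, y)
      · rw [subdivideEdge_cons_cons_of_eq h, hcons, ← ih', ht]
        simp only [listWeight, h, if_true]
        rw [Sym2.eq_iff] at h
        rcases h with ⟨rfl, rfl⟩ | ⟨rfl, rfl⟩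
        · ring
        · rw [Sym2.eq_swap (a := d) (b := z), Sym2.eq_swap (a := z) (b := c)]; ring
      · rw [subdivideEdge_cons_cons_of_ne h, hcons, ← ih', ht]
        simp only [listWeight, h, if_false]

theorem head?_subdivideEdge (l : List V) : (subdivideEdge x y z l).head? = l.head? := by
  cases l with
  | nil => rfl
  | cons a l => obtain ⟨t, ht⟩ := subdivideEdge_cons (x := x) (y := y) (z := z) a l; simp [ht]

theorem getLast?_subdivideEdge (l : List V) :
    (subdivideEdge x y z l).getLast? = l.getLast? := by
  rw [← List.head?_reverse, ← subdivideEdge_reverse, head?_subdivideEdge, List.head?_reverse]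

end Subdivide

/-- `p` is a consistent system of paths, given as lists of vertices, that chooses a path of `G`
inside `S` for any two vertices of `S`. Consistency is encoded by `next`: deleting the first vertex
of a chosen path leaves a chosen path; together with `symm` this says that all subpaths of chosen
paths are chosen. -/
structure IsListSystem (G : SimpleGraph V) (S : Set V) (p : V → V → List V) : Prop where
  self : ∀ u ∈ S, p u u = [u]
  next : ∀ u ∈ S, ∀ v ∈ S, u ≠ v → ∃ t ∈ S, G.Adj u t ∧ p u v = u :: p t v
  symm : ∀ u ∈ S, ∀ v ∈ S, p v u = (p u v).reverse
  nodup : ∀ u ∈ S, ∀ v ∈ S, (p u v).Nodup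

/-- `q` lists the vertices of a path of `G` inside `S` from `u` to `v`. -/
structure IsListPath (G : SimpleGraph V) (S : Set V) (u v : V) (q : List V) : Prop where
  chain : q.IsChain G.Adj
  nodup : q.Nodup
  head : q.head? = some u
  last : q.getLast? = some v
  subset : ∀ a ∈ q, a ∈ S

/-- The subgraph of `G` on the vertex set `S` carries a consistent path system that is not metric:
for every weight function some chosen path can be replaced by a lighter one. -/
def NonmetrizableOn (G : SimpleGraph V) (S : Set V) : Prop :=
  ∃ p : V → V → List V, IsListSystem G S p ∧
    ∀ w : Sym2 V → ℝ, (∀ a ∈ S, ∀ b ∈ S, G.Adj a b → 0 < w s(a, b)) →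
      ∃ u ∈ S, ∃ v ∈ S, ∃ q, IsListPath G S u v q ∧ listWeight w q < listWeight w (p u v)

namespace IsListSystem

variable {G : SimpleGraph V} {S : Set V} {p : V → V → List V}

theorem exists_cons (hp : IsListSystem G S p) {u v : V} (hu : u ∈ S) (hv : v ∈ S) :
    ∃ t, p u v = u :: t := by
  by_cases h : u = v
  · subst h; exact ⟨[], hp.self u hu⟩
  · obtain ⟨t, -, -, ht⟩ := hp.next u hu v hv h
    exact ⟨_, ht⟩

theorem mem_left (hp : IsListSystem G S p) {u v : V} (hu : u ∈ S) (hv : v ∈ S) : u ∈ p u v := by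
  obtain ⟨t, ht⟩ := hp.exists_cons hu hv
  simp [ht]

/-- Induction along the chosen paths towards a fixed end. -/
theorem induction_path (hp : IsListSystem G S p) {v : V} (hv : v ∈ S) {P : V → Prop}
    (base : P v)
    (step : ∀ u ∈ S, ∀ t ∈ S, u ≠ v → G.Adj u t → p u v = u :: p t v → P t → P u) :
    ∀ u ∈ S, P u := by
  have key : ∀ n : ℕ, ∀ u ∈ S, (p u v).length ≤ n → P u := by
    intro n
    induction n with
    | zero =>
      intro u hu hl
      obtain ⟨t, ht⟩ := hp.exists_cons hu hv
      simp [ht] at hl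
    | succ n ih =>
      intro u hu hl
      by_cases h : u = v
      · exact h ▸ base
      · obtain ⟨t, ht, hut, hpt⟩ := hp.next u hu v hv h
        exact step u hu t ht h hut hpt (ih t ht (by simpa [hpt] using hl))
  exact fun u hu => key _ u hu le_rfl

theorem subset (hp : IsListSystem G S p) {u v : V} (hu : u ∈ S) (hv : v ∈ S) :
    ∀ a ∈ p u v, a ∈ S := by
  refine hp.induction_path hv (P := fun u => ∀ a ∈ p u v, a ∈ S) ?_ ?_ u hu
  · simp [hp.self v hv, hv]
  · intro u hu t ht _ _ he ih a ha
    rw [he, List.mem_cons] at ha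
    rcases ha with rfl | ha
    · exact hu
    · exact ih a ha

theorem isListPath (hp : IsListSystem G S p) {u v : V} (hu : u ∈ S) (hv : v ∈ S) :
    IsListPath G S u v (p u v) := by
  refine ⟨?_, hp.nodup u hu v hv, ?_, ?_, hp.subset hu hv⟩
  · refine hp.induction_path hv (P := fun u => (p u v).IsChain G.Adj) ?_ ?_ u hu
    · simp [hp.self v hv]
    · intro u hu t ht _ hut he ih
      obtain ⟨r, hr⟩ := hp.exists_cons ht hv
      rw [he, hr]
      rw [hr] at ih
      simp [hut, ih]
  · obtain ⟨t, ht⟩ := hp.exists_cons hu hv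
    simp [ht]
  · obtain ⟨t, ht⟩ := hp.exists_cons hv hu
    rw [hp.symm v hv u hu, List.getLast?_reverse, ht]; simp

end IsListSystem

section Extend

open Classical in
/-- The chosen path from the new vertex `z` to `v`, after `z` has been attached to `x` and inserted
into the edge `xy`: it leaves through `y` exactly when the path from `x` to `v` starts with that
edge. -/
noncomputable def pathFromNew (p : V → V → List V) (x y z v : V) : List V :=
  z :: subdivideEdge x y z (if p x v = x :: p y v then p y v else p x v)

open Classical in
/-- The path system obtained from `p` by attaching a new vertex `z` to `x` and inserting it into
the edge `xy`. -/
noncomputable def extendSystem (p : V → V → List V) (x y z : V) (u v : V) : List V :=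
  if u = z then if v = z then [z] else pathFromNew p x y z v
  else if v = z then (pathFromNew p x y z u).reverse else subdivideEdge x y z (p u v)

variable {G G' : SimpleGraph V} {S : Set V} {p : V → V → List V} {x y z : V}

open Classical in
/-- The extended system is consistent again. With `y = x` no edge is subdivided, and `z` is only
attached to `x`. -/
theorem isListSystem_extendSystem (hp : IsListSystem G S p) (hz : z ∉ S) (hx : x ∈ S) (hy : y ∈ S)
    (hxz : G'.Adj x z)
    (hadj : ∀ a ∈ S, ∀ b ∈ S, G.Adj a b → if s(a, b) = s(x, y) then G'.Adj z y else G'.Adj a b) :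
    IsListSystem G' (insert z S) (extendSystem p x y z) := by
  have hne : ∀ {a}, a ∈ S → a ≠ z := fun ha h => hz (h ▸ ha)
  have hnz : ∀ {u v}, u ∈ S → v ∈ S → z ∉ p u v := fun hu hv h => hz (hp.subset hu hv z h)
  -- values of the new system
  have eSS : ∀ {u v}, u ∈ S → v ∈ S → extendSystem p x y z u v = subdivideEdge x y z (p u v) :=
    fun hu hv => by simp [extendSystem, hne hu, hne hv]
  have eZS : ∀ {v}, v ∈ S → extendSystem p x y z z v = pathFromNew p x y z v :=
    fun hv => by simp [extendSystem, hne hv]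
  have eSZ : ∀ {v}, v ∈ S → extendSystem p x y z v z = (pathFromNew p x y z v).reverse :=
    fun hv => by simp [extendSystem, hne hv]
  have eZZ : extendSystem p x y z z z = [z] := by simp [extendSystem]
  have pos : ∀ {v}, p x v = x :: p y v →
      pathFromNew p x y z v = z :: subdivideEdge x y z (p y v) := fun h => by
    rw [pathFromNew, if_pos h]
  have neg : ∀ {v}, p x v ≠ x :: p y v →
      pathFromNew p x y z v = z :: subdivideEdge x y z (p x v) := fun h => by
    rw [pathFromNew, if_neg h]
  -- if the path from `x` starts with the edge `xy`, then `xy` is an edge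
  have adjxy : ∀ {v}, v ∈ S → p x v = x :: p y v → G.Adj x y := by
    intro v hv h
    have hxv : x ≠ v := by
      rintro rfl
      rw [hp.self x hx] at h
      obtain ⟨t, ht⟩ := hp.exists_cons hy hx
      simp [ht] at h
    obtain ⟨t, ht, hxt, he⟩ := hp.next x hx v hv hxv
    obtain ⟨r, hr⟩ := hp.exists_cons ht hv
    obtain ⟨r', hr'⟩ := hp.exists_cons hy hv
    rw [he, hr, hr'] at h
    have : t = y := by simpa using (List.cons.inj (List.cons.inj h).2).1
    exact this ▸ hxt
  have hzy : ∀ {v}, v ∈ S → p x v = x :: p y v → G'.Adj z y := fun hv h => by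
    simpa using hadj x hx y hy (adjxy hv h)
  refine ⟨?_, ?_, ?_, ?_⟩
  · rintro u (rfl | hu)
    · exact eZZ
    · rw [eSS hu hu, hp.self u hu]; rfl
  · rintro u (rfl | hu) v (rfl | hv) huv
    · exact absurd rfl huv
    · by_cases h : p x v = x :: p y v
      · exact ⟨y, Or.inr hy, hzy hv h, by rw [eZS hv, eSS hy hv, pos h]⟩
      · exact ⟨x, Or.inr hx, hxz.symm, by rw [eZS hv, eSS hx hv, neg h]⟩
    · -- from `u` in `S` to the new vertex `v`
      by_cases h : p x u = x :: p y u
      · by_cases huy : u = y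
        · subst huy
          refine ⟨v, Or.inl rfl, (hzy hu h).symm, ?_⟩
          rw [eSZ hu, eZZ, pos h, hp.self u hu]; rfl
        · obtain ⟨t, ht, hut, he⟩ := hp.next u hu y hy huy
          have h1 : p u x = u :: (p t y ++ [x]) := by
            rw [hp.symm x hx u hu, h, List.reverse_cons, ← hp.symm y hy u hu, he]; rfl
          have hux : u ≠ x := by
            rintro rfl
            rw [hp.self u hu] at h1; simp at h1
          obtain ⟨t', ht', -, he'⟩ := hp.next u hu x hx hux
          obtain ⟨r, hr⟩ := hp.exists_cons ht hy
          obtain ⟨r', hr'⟩ := hp.exists_cons ht' hx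
          have h2 : p t' x = p t y ++ [x] := by
            rw [he'] at h1; exact (List.cons.inj h1).2
          have htt : t' = t := by
            rw [hr', hr] at h2
            exact (List.cons.inj h2).1
          subst htt
          have hxu : x ∉ u :: p t' y := by
            have := hp.nodup u hu x hx
            rw [h1, ← List.cons_append] at this
            exact fun hm => (List.disjoint_of_nodup_append this) hm (by simp)
          have hc : p x t' = x :: p y t' := by
            rw [hp.symm t' ht' x hx, h2, List.reverse_append, ← hp.symm t' ht' y hy]; rfl
          have hsn : s(u, t') ≠ s(x, y) := by
            intro hs
            rw [Sym2.eq_iff] at hs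
            rcases hs with ⟨rfl, -⟩ | ⟨-, rfl⟩
            · exact hux rfl
            · exact hxu (List.mem_cons_of_mem _ (hp.mem_left ht' hy))
          refine ⟨t', Or.inr ht', ?_, ?_⟩
          · simpa [hsn] using hadj u hu t' ht' hut
          · rw [eSZ hu, eSZ ht', pos h, pos hc, List.reverse_cons, List.reverse_cons,
              ← subdivideEdge_reverse, ← subdivideEdge_reverse, ← hp.symm y hy u hu,
              ← hp.symm y hy t' ht', he, hr, subdivideEdge_cons_cons_of_ne hsn]
            rfl
      · by_cases hux : u = x
        · subst hux
          refine ⟨v, Or.inl rfl, hxz, ?_⟩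
          rw [eSZ hu, eZZ, neg h, hp.self u hu]; rfl
        · obtain ⟨t, ht, hut, he⟩ := hp.next u hu x hx hux
          obtain ⟨r, hr⟩ := hp.exists_cons ht hx
          have hsn : s(u, t) ≠ s(x, y) := by
            intro hs
            rw [Sym2.eq_iff] at hs
            rcases hs with ⟨rfl, -⟩ | ⟨rfl, rfl⟩
            · exact hux rfl
            · apply h
              rw [hp.symm u hu t ht, he, hp.self t ht, hp.self u hu]; rfl
          have hc : p x t ≠ x :: p y t := by
            intro hc
            apply h
            have h1 : p x u = x :: (p y t ++ [u]) := by
              rw [hp.symm u hu x hx, he, List.reverse_cons, ← hp.symm t ht x hx, hc]; rfl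
            obtain ⟨s, hs, -, he'⟩ := hp.next x hx u hu (Ne.symm hux)
            have h2 : p s u = p y t ++ [u] := by
              rw [he'] at h1; exact (List.cons.inj h1).2
            obtain ⟨r1, hr1⟩ := hp.exists_cons hs hu
            obtain ⟨r2, hr2⟩ := hp.exists_cons hy ht
            have : s = y := by
              rw [hr1, hr2] at h2
              exact (List.cons.inj h2).1
            rw [he', this]
          refine ⟨t, Or.inr ht, ?_, ?_⟩
          · simpa [hsn] using hadj u hu t ht hut
          · rw [eSZ hu, eSZ ht, neg h, neg hc, List.reverse_cons, List.reverse_cons,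
              ← subdivideEdge_reverse, ← subdivideEdge_reverse, ← hp.symm x hx u hu,
              ← hp.symm x hx t ht, he, hr, subdivideEdge_cons_cons_of_ne hsn]
            rfl
    · -- both ends in `S`
      obtain ⟨t, ht, hut, he⟩ := hp.next u hu v hv huv
      obtain ⟨r, hr⟩ := hp.exists_cons ht hv
      have had := hadj u hu t ht hut
      by_cases hs : s(u, t) = s(x, y)
      · rw [if_pos hs] at had
        rw [eSS hu hv, he, hr, subdivideEdge_cons_cons_of_eq hs, ← hr]
        rw [Sym2.eq_iff] at hs
        rcases hs with ⟨rfl, rfl⟩ | ⟨rfl, rfl⟩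
        · exact ⟨z, Or.inl rfl, hxz, by rw [eZS hv, pos he]⟩
        · refine ⟨z, Or.inl rfl, had.symm, ?_⟩
          rw [eZS hv, neg]
          intro hc
          have := congrArg List.length he
          rw [hc] at this
          simp at this
          omega
      · rw [if_neg hs] at had
        exact ⟨t, Or.inr ht, had, by
          rw [eSS hu hv, eSS ht hv, he, hr, subdivideEdge_cons_cons_of_ne hs]⟩
  · rintro u (rfl | hu) v (rfl | hv)
    · simp [eZZ]
    · rw [eSZ hv, eZS hv]
    · rw [eSZ hu, eZS hu, List.reverse_reverse]
    · rw [eSS hv hu, eSS hu hv, hp.symm u hu v hv, subdivideEdge_reverse]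
  · have hnew : ∀ {v}, v ∈ S → (pathFromNew p x y z v).Nodup := by
      intro v hv
      by_cases h : p x v = x :: p y v
      · -- the path leaves through `y`, and the rest avoids `x`
        rw [pos h, subdivideEdge_of_notMem (Or.inl (by
          have := hp.nodup x hx v hv
          rw [h] at this
          exact (List.nodup_cons.1 this).1))]
        exact List.nodup_cons.2 ⟨hnz hy hv, hp.nodup y hy v hv⟩
      · rw [neg h]
        have hxy : ∀ l : List V, p x v = l → l.Nodup → subdivideEdge x y z l = l := by
          intro l hl hnd
          match l, hl, hnd with
          | [], _, _ => rfl
          | [a], _, _ => rfl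
          | a :: b :: l, hl, hnd =>
            obtain ⟨t, ht⟩ := hp.exists_cons hx hv
            have hax : a = x := by rw [ht] at hl; exact (List.cons.inj hl).1.symm
            subst hax
            have hsn : s(a, b) ≠ s(a, y) := by
              intro hs
              have hab : a ≠ b := by
                rintro rfl
                simp at hnd
              have hby : b = y := by
                rcases Sym2.eq_iff.1 hs with h' | h'
                · exact h'.2
                · exact absurd h'.2.symm hab
              subst hby
              have hav : a ≠ v := by
                rintro rfl
                rw [hp.self a hx] at hl; simp at hl
              obtain ⟨t', ht', -, he⟩ := hp.next a hx v hv hav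
              obtain ⟨r, hr⟩ := hp.exists_cons ht' hv
              have : t' = b := by
                rw [he, hr] at hl
                exact (List.cons.inj (List.cons.inj hl).2).1
              exact h (this ▸ he)
            rw [subdivideEdge_cons_cons_of_ne hsn,
              subdivideEdge_of_notMem (Or.inl (List.nodup_cons.1 hnd).1)]
        rw [hxy _ rfl (hp.nodup x hx v hv)]
        exact List.nodup_cons.2 ⟨hnz hx hv, hp.nodup x hx v hv⟩
    rintro u (rfl | hu) v (rfl | hv)
    · simp [eZZ]
    · rw [eZS hv]; exact hnew hv
    · rw [eSZ hu]; exact List.nodup_reverse.2 (hnew hu)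
    · rw [eSS hu hv]; exact nodup_subdivideEdge (hp.nodup u hu v hv) (hnz hu hv)

open Classical in
/-- Nonmetrizability survives attaching a new vertex `z` to `x`, and, when `y ≠ x`, inserting `z`
into the edge `xy`. -/
theorem NonmetrizableOn.insert (h : NonmetrizableOn G S) (hz : z ∉ S) (hx : x ∈ S) (hy : y ∈ S)
    (hxz : G'.Adj x z)
    (hadj : ∀ a ∈ S, ∀ b ∈ S, G.Adj a b → if s(a, b) = s(x, y) then G'.Adj z y else G'.Adj a b) :
    NonmetrizableOn G' (insert z S) := by
  obtain ⟨p, hp, hw⟩ := h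
  refine ⟨extendSystem p x y z, isListSystem_extendSystem hp hz hx hy hxz hadj, ?_⟩
  · intro w hpos
    obtain ⟨u, hu, v, hv, q, hq, hlt⟩ := hw
      (fun e => if e = s(x, y) then w s(x, z) + w s(z, y) else w e) (by
        intro a ha b hb hab
        have had := hadj a ha b hb hab
        by_cases hs : s(a, b) = s(x, y)
        · simp only [hs, if_true] at had ⊢
          exact add_pos (hpos x (Or.inr hx) z (Or.inl rfl) hxz)
            (hpos z (Or.inl rfl) y (Or.inr hy) had)
        · simp only [hs, if_false] at had ⊢
          exact hpos a (Or.inr ha) b (Or.inr hb) had)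
    have hnz : ∀ {l : List V}, (∀ a ∈ l, a ∈ S) → z ∉ l := fun hl h => hz (hl z h)
    refine ⟨u, Or.inr hu, v, Or.inr hv, subdivideEdge x y z q, ⟨?_, ?_, ?_, ?_, ?_⟩, ?_⟩
    · refine isChain_subdivideEdge hxz hadj hq.chain hq.subset
    · exact nodup_subdivideEdge hq.nodup (hnz hq.subset)
    · rw [head?_subdivideEdge, hq.head]
    · rw [getLast?_subdivideEdge, hq.last]
    · intro a ha
      rcases mem_subdivideEdge ha with h | h
      · exact Or.inr (hq.subset a h)
      · exact Or.inl h
    · have hun : u ≠ z := fun h => hz (h ▸ hu)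
      have hvn : v ≠ z := fun h => hz (h ▸ hv)
      rw [listWeight_subdivideEdge w (hnz hq.subset)]
      simp only [extendSystem, hun, hvn, if_false]
      rw [listWeight_subdivideEdge w (hnz (hp.subset hu hv))]
      exact hlt

end Extend

/-! ### From lists to path systems -/

variable {G : SimpleGraph V}

theorem walkWeight_eq_listWeight (w : Sym2 V → ℝ) {u v : V} (q : G.Walk u v) :
    walkWeight w q = listWeight w q.support := by
  induction q with
  | nil => rfl
  | @cons u t v h q ih =>
    have hs : q.support = t :: q.support.tail := (SimpleGraph.Walk.cons_tail_support q).symm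
    rw [SimpleGraph.Walk.support_cons, hs]
    simp only [listWeight]
    rw [← hs, ← ih]
    simp [walkWeight]

theorem exists_walk_of_isChain {u v : V} {q : List V} (hc : q.IsChain G.Adj)
    (hh : q.head? = some u) (hl : q.getLast? = some v) : ∃ p : G.Walk u v, p.support = q := by
  induction q generalizing u with
  | nil => simp at hh
  | cons a l ih =>
    obtain rfl : a = u := by simpa using hh
    cases l with
    | nil =>
      obtain rfl : a = v := by simpa using hl
      exact ⟨.nil, rfl⟩
    | cons b l =>
      rw [List.isChain_cons_cons] at hc
      obtain ⟨p, hp⟩ := ih hc.2 (by rfl) (by simpa using hl)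
      exact ⟨.cons hc.1 p, by simp [hp]⟩

/-- The path system, in terms of walks, given by a system of lists on all vertices. -/
noncomputable def IsListSystem.toPathSystem {p : V → V → List V}
    (hp : IsListSystem G Set.univ p) : PathSystem G :=
  have h : ∀ u v, ∃ q : G.Walk u v, q.support = p u v := fun u v =>
    have hq := hp.isListPath (Set.mem_univ u) (Set.mem_univ v)
    exists_walk_of_isChain hq.chain hq.head hq.last
  { path := fun u v => (h u v).choose
    isPath := fun u v => by
      rw [SimpleGraph.Walk.isPath_def, (h u v).choose_spec]
      exact hp.nodup u trivial v trivial
    symm := fun u v => by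
      apply SimpleGraph.Walk.ext_support
      rw [SimpleGraph.Walk.support_reverse, (h u v).choose_spec, (h v u).choose_spec,
        hp.symm u trivial v trivial] }

section ToPathSystem

variable {p : V → V → List V} (hp : IsListSystem G Set.univ p)

theorem IsListSystem.support_path (u v : V) : (hp.toPathSystem.path u v).support = p u v :=
  Exists.choose_spec (p := fun q : G.Walk u v => q.support = p u v) _

theorem IsListSystem.path_eq_cons {u t v : V} (h : G.Adj u t) (he : p u v = u :: p t v) :
    hp.toPathSystem.path u v = .cons h (hp.toPathSystem.path t v) := by
  apply SimpleGraph.Walk.ext_support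
  rw [SimpleGraph.Walk.support_cons, hp.support_path, hp.support_path, he]

theorem IsListSystem.path_self (v : V) : hp.toPathSystem.path v v = .nil := by
  apply SimpleGraph.Walk.ext_support
  rw [hp.support_path, hp.self v trivial]; rfl

/-- A chosen path is cut at its first vertex in `Q`; its remainder is chosen too. -/
theorem IsListSystem.exists_first (Q : Set V) (u v : V)
    (h : ∃ a ∈ (hp.toPathSystem.path u v).support, a ∈ Q) :
    ∃ a ∈ Q, ∃ q : G.Walk u a, hp.toPathSystem.path u v = q.append (hp.toPathSystem.path a v) ∧
      ∀ c ∈ q.support, c ∈ Q → c = a := by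
  classical
  revert h
  refine hp.induction_path (v := v) trivial (P := fun u =>
    (∃ a ∈ (hp.toPathSystem.path u v).support, a ∈ Q) →
      ∃ a ∈ Q, ∃ q : G.Walk u a, hp.toPathSystem.path u v = q.append (hp.toPathSystem.path a v) ∧
        ∀ c ∈ q.support, c ∈ Q → c = a) ?_ ?_ u trivial
  · rintro ⟨a, ha, haQ⟩
    obtain rfl : a = v := by simpa [hp.path_self] using ha
    exact ⟨a, haQ, .nil, by simp, by simp⟩
  · rintro u - t - - hut he ih ⟨a, ha, haQ⟩
    by_cases hu : u ∈ Q
    · exact ⟨u, hu, .nil, by simp, by simp⟩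
    · rw [hp.path_eq_cons hut he, SimpleGraph.Walk.support_cons, List.mem_cons] at ha
      obtain ⟨b, hb, q, hq, hqb⟩ := ih ⟨a, ha.resolve_left fun h => hu (h ▸ haQ), haQ⟩
      refine ⟨b, hb, .cons hut q, by rw [hp.path_eq_cons hut he, hq]; simp, ?_⟩
      intro c hc hcQ
      rw [SimpleGraph.Walk.support_cons, List.mem_cons] at hc
      exact hqb c (hc.resolve_left fun h => hu (h ▸ hcQ)) hcQ

theorem IsListSystem.exists_last (Q : Set V) (u v : V)
    (h : ∃ a ∈ (hp.toPathSystem.path u v).support, a ∈ Q) :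
    ∃ a ∈ Q, ∃ q : G.Walk a v, hp.toPathSystem.path u v = (hp.toPathSystem.path u a).append q ∧
      ∀ c ∈ q.support, c ∈ Q → c = a := by
  obtain ⟨a, ha, q, hq, hqa⟩ := hp.exists_first Q v u (by
    simpa [hp.toPathSystem.symm u v] using h)
  refine ⟨a, ha, q.reverse, ?_, by simpa using hqa⟩
  rw [hp.toPathSystem.symm v u, hq, SimpleGraph.Walk.reverse_append,
    ← hp.toPathSystem.symm a u]

/-- The chosen path between two vertices of a chosen path is a part of that path. -/
theorem IsListSystem.path_toSubgraph_le (x y : V) : ∀ a b : V,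
    a ∈ (hp.toPathSystem.path x y).support → b ∈ (hp.toPathSystem.path x y).support →
    (hp.toPathSystem.path a b).toSubgraph ≤ (hp.toPathSystem.path x y).toSubgraph := by
  have pre : ∀ x b, b ∈ (hp.toPathSystem.path x y).support →
      (hp.toPathSystem.path x b).toSubgraph ≤ (hp.toPathSystem.path x y).toSubgraph := by
    intro x b hb
    obtain ⟨c, hc, q, hq, -⟩ := hp.exists_last {b} x y ⟨b, hb, rfl⟩
    obtain rfl : c = b := hc
    rw [hq, SimpleGraph.Walk.toSubgraph_append]
    exact le_sup_left
  refine hp.induction_path (v := y) trivial (P := fun x => ∀ a b : V,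
    a ∈ (hp.toPathSystem.path x y).support → b ∈ (hp.toPathSystem.path x y).support →
    (hp.toPathSystem.path a b).toSubgraph ≤ (hp.toPathSystem.path x y).toSubgraph) ?_ ?_ x trivial
  · intro a b ha hb
    obtain rfl : a = y := by simpa [hp.path_self] using ha
    obtain rfl : b = a := by simpa [hp.path_self] using hb
    exact le_rfl
  · intro x _ t _ _ hxt he ih a b ha hb
    have hcons := hp.path_eq_cons hxt he
    by_cases hax : a = x
    · subst hax; exact pre a b hb
    by_cases hbx : b = x
    · subst hbx
      rw [hp.toPathSystem.symm b a, SimpleGraph.Walk.toSubgraph_reverse]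
      exact pre b a ha
    · rw [hcons, SimpleGraph.Walk.support_cons, List.mem_cons] at ha hb
      rw [hcons]
      refine (ih a b (ha.resolve_left hax) (hb.resolve_left hbx)).trans ?_
      rw [SimpleGraph.Walk.toSubgraph]
      exact le_sup_right

/-- Cut one path at its first and last vertex on the other path: the piece in between is the chosen
path between two vertices of the other path, hence contained in it. -/
theorem IsListSystem.consistent_toPathSystem : hp.toPathSystem.Consistent := by
  intro u v x y
  set P := hp.toPathSystem
  by_cases hQ : ∃ a ∈ (P.path u v).support, a ∈ {a | a ∈ (P.path x y).support}
  swap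
  · left
    ext a
    simp only [Set.mem_inter_iff, SimpleGraph.Walk.mem_verts_toSubgraph, Set.mem_empty_iff_false,
      iff_false]
    exact fun h => hQ ⟨a, h⟩
  right
  obtain ⟨a, ha, q, hq, hqa⟩ := hp.exists_first _ u v hQ
  obtain ⟨b, hb, r, hr, hrb⟩ := hp.exists_last {a | a ∈ (P.path x y).support} a v
    ⟨a, SimpleGraph.Walk.start_mem_support _, ha⟩
  have huv : P.path u v = q.append ((P.path a b).append r) := by rw [hq, hr]
  by_cases hab : a = b
  · subst hab
    left
    refine ⟨a, ?_⟩
    ext c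
    simp only [Set.mem_inter_iff, SimpleGraph.Walk.mem_verts_toSubgraph, Set.mem_singleton_iff, huv,
      SimpleGraph.Walk.mem_support_append_iff]
    constructor
    · rintro ⟨hc | hc | hc, hcQ⟩
      · exact hqa c hc hcQ
      · have : P.path a a = .nil := hp.path_self a
        simpa [this] using hc
      · exact hrb c hc hcQ
    · rintro rfl
      exact ⟨Or.inl (SimpleGraph.Walk.end_mem_support _), ha⟩
  · right
    refine ⟨a, b, le_antisymm (And.intro ?_ ?_) (le_inf ?_ (hp.path_toSubgraph_le x y a b ha hb))⟩
    · rintro c ⟨hc, hcQ⟩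
      simp only [SimpleGraph.Walk.mem_verts_toSubgraph, huv,
        SimpleGraph.Walk.mem_support_append_iff] at hc hcQ ⊢
      rcases hc with hc | hc | hc
      · rw [hqa c hc hcQ]; exact SimpleGraph.Walk.start_mem_support _
      · exact hc
      · rw [hrb c hc hcQ]; exact SimpleGraph.Walk.end_mem_support _
    · rintro c d ⟨hcd, hcdQ⟩
      have hcQ : c ∈ (P.path x y).support :=
        (SimpleGraph.Walk.mem_verts_toSubgraph _).1 hcdQ.fst_mem
      have hdQ : d ∈ (P.path x y).support :=
        (SimpleGraph.Walk.mem_verts_toSubgraph _).1 hcdQ.snd_mem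
      have hne := hcd.ne
      simp only [huv, SimpleGraph.Walk.toSubgraph_append, SimpleGraph.Subgraph.sup_adj] at hcd
      rcases hcd with h | h | h
      · have h1 := (SimpleGraph.Walk.mem_verts_toSubgraph _).1 h.fst_mem
        have h2 := (SimpleGraph.Walk.mem_verts_toSubgraph _).1 h.snd_mem
        exact absurd ((hqa c h1 hcQ).trans (hqa d h2 hdQ).symm) hne
      · exact h
      · have h1 := (SimpleGraph.Walk.mem_verts_toSubgraph _).1 h.fst_mem
        have h2 := (SimpleGraph.Walk.mem_verts_toSubgraph _).1 h.snd_mem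
        exact absurd ((hrb c h1 hcQ).trans (hrb d h2 hdQ).symm) hne
    · rw [huv, SimpleGraph.Walk.toSubgraph_append, SimpleGraph.Walk.toSubgraph_append]
      exact le_sup_left.trans le_sup_right

end ToPathSystem

theorem NonmetrizableOn.not_metrizable (h : NonmetrizableOn G Set.univ) : ¬ G.Metrizable := by
  intro hG
  obtain ⟨p, hp, hw⟩ := h
  obtain ⟨w, hpos, hmin⟩ := hG _ hp.consistent_toPathSystem
  obtain ⟨u, -, v, -, q, hq, hlt⟩ := hw w fun a _ b _ hab => hpos _ hab
  obtain ⟨r, hr⟩ := exists_walk_of_isChain hq.chain hq.head hq.last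
  have := hmin u v r (by rw [SimpleGraph.Walk.isPath_def, hr]; exact hq.nodup)
  rw [walkWeight_eq_listWeight, walkWeight_eq_listWeight, hr, hp.support_path] at this
  exact absurd this (not_le.2 hlt)

/-- In a connected graph nonmetrizability spreads from a part to the whole, by attaching the
remaining vertices one at a time. -/
theorem NonmetrizableOn.univ [Finite V] (hG : G.Connected) {S : Set V} (hS : S.Nonempty)
    (h : NonmetrizableOn G S) : NonmetrizableOn G Set.univ := by
  obtain ⟨T, ⟨hST, hT⟩, hmax⟩ :=
    (Set.toFinite {T : Set V | S ⊆ T ∧ NonmetrizableOn G T}).exists_maximal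
    ⟨S, le_rfl, h⟩
  by_cases hTu : T = Set.univ
  · exact hTu ▸ hT
  obtain ⟨z, hz⟩ := (Set.ne_univ_iff_exists_notMem T).1 hTu
  obtain ⟨s, hs⟩ := hS
  obtain ⟨w⟩ := hG.preconnected s z
  obtain ⟨d, -, hd1, hd2⟩ := w.exists_boundary_dart T (hST hs) hz
  have hins := hT.insert (G' := G) (y := d.fst) hd2 hd1 hd1 d.adj (by
    intro a _ b _ hab
    rw [if_neg]
    · exact hab
    · intro he
      rw [Sym2.eq_iff] at he
      rcases he with ⟨rfl, rfl⟩ | ⟨rfl, rfl⟩ <;> exact hab.ne rfl)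
  exact absurd (hmax ⟨hST.trans (Set.subset_insert _ _), hins⟩ (Set.subset_insert _ _)
    (Set.mem_insert _ _)) hd2

/-! ### Subdivisions of nonmetrizable graphs -/

/-- `x, l, y` are the consecutive vertices of a walk of `G`; `l` lists the interior ones. -/
def Link (G : SimpleGraph V) : V → List V → V → Prop
  | x, [], y => G.Adj x y
  | x, z :: l, y => G.Adj x z ∧ Link G z l y

@[simp] theorem link_nil {x y : V} : Link G x [] y ↔ G.Adj x y := Iff.rfl

@[simp] theorem link_cons {x y z : V} {l : List V} :
    Link G x (z :: l) y ↔ G.Adj x z ∧ Link G z l y := Iff.rfl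

@[simp] theorem link_append_cons {x y z : V} {l l' : List V} :
    Link G x (l ++ z :: l') y ↔ Link G x l z ∧ Link G z l' y := by
  induction l generalizing x with
  | nil => simp
  | cons a l ih => simp [ih, and_assoc]

theorem link_reverse {x y : V} {l : List V} : Link G y l.reverse x ↔ Link G x l y := by
  induction l generalizing x with
  | nil => simp [G.adj_comm]
  | cons a l ih => simp [ih, G.adj_comm, and_comm]

theorem Link.symm {x y : V} {l : List V} (h : Link G x l y) : Link G y l.reverse x :=
  link_reverse.2 h

theorem Link.mono {G' : SimpleGraph V} (h : G ≤ G') {x y : V} {l : List V} (hl : Link G x l y) :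
    Link G' x l y := by
  induction l generalizing x with
  | nil => exact h hl
  | cons a l ih => exact ⟨h hl.1, ih hl.2⟩

/-- The graph on `ℕ` whose edges are the pairs listed in `E`. -/
def labelGraph (E : List (ℕ × ℕ)) : SimpleGraph ℕ where
  Adj i j := i ≠ j ∧ ((i, j) ∈ E ∨ (j, i) ∈ E)
  symm := ⟨fun _ _ h => ⟨h.1.symm, h.2.symm⟩⟩
  loopless := ⟨fun _ h => h.1 rfl⟩

instance (E : List (ℕ × ℕ)) : DecidableRel (labelGraph E).Adj := fun i j =>
  inferInstanceAs (Decidable (i ≠ j ∧ ((i, j) ∈ E ∨ (j, i) ∈ E)))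

/-- `E` lists, without repetition, edges `(i, j)` with `i < j` between the labels below `n`. -/
def IsLabelGraph (n : ℕ) (E : List (ℕ × ℕ)) : Prop :=
  E.Nodup ∧ ∀ e ∈ E, e.1 < e.2 ∧ e.2 < n

instance (n : ℕ) (E : List (ℕ × ℕ)) : Decidable (IsLabelGraph n E) :=
  inferInstanceAs (Decidable (_ ∧ _))

/-- A subdivision in `G` of the graph with labels below `n` and edges `E`: `f` gives the branch
vertices and `W e` lists the interior vertices of the path that replaces the edge `e`. -/
structure IsModel (G : SimpleGraph V) (n : ℕ) (E : List (ℕ × ℕ)) (f : ℕ → V)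
    (W : ℕ × ℕ → List V) : Prop where
  link : ∀ e ∈ E, Link G (f e.1) (W e) (f e.2)
  nodup : ((List.range n).map f ++ E.flatMap W).Nodup

/-- `G` contains a subdivision of the graph with labels below `n` and edges `E`. -/
def ContainsSubdivision (G : SimpleGraph V) (n : ℕ) (E : List (ℕ × ℕ)) : Prop :=
  ∃ f W, IsModel G n E f W

theorem flatMap_perm_of_mem {α β : Type*} [BEq α] [LawfulBEq α] {E : List α} {e : α} (he : e ∈ E)
    (W : α → List β) : (E.flatMap W).Perm (W e ++ (E.erase e).flatMap W) := by
  have := (List.perm_cons_erase he).flatMap_right W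
  simpa using this

theorem flatMap_erase_congr {α β : Type*} [BEq α] [LawfulBEq α] {E : List α} (hE : E.Nodup) {e : α}
    {W W' : α → List β} (h : ∀ a, a ≠ e → W a = W' a) :
    (E.erase e).flatMap W = (E.erase e).flatMap W' := by
  simp only [List.flatMap_def]
  congr 1
  refine List.map_congr_left fun a ha => h a ?_
  rintro rfl
  exact hE.not_mem_erase ha

theorem IsListPath.map {G : SimpleGraph ℕ} {G' : SimpleGraph V} {S : Set ℕ} {T : Set V} {f : ℕ → V}
    (hf : Set.InjOn f S) (hST : ∀ i ∈ S, f i ∈ T)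
    (hadj : ∀ i ∈ S, ∀ j ∈ S, G.Adj i j → G'.Adj (f i) (f j))
    {u v : ℕ} {q : List ℕ} (hq : IsListPath G S u v q) :
    IsListPath G' T (f u) (f v) (q.map f) where
  chain := by
    rw [List.isChain_map]
    have h := hq.chain
    have hs := hq.subset
    clear hq
    induction q with
    | nil => simp
    | cons a l ih =>
      cases l with
      | nil => simp
      | cons b l =>
        rw [List.isChain_cons_cons] at h ⊢
        exact ⟨hadj a (hs a (by simp)) b (hs b (by simp)) h.1,
          ih h.2 fun c hc => hs c (List.mem_cons_of_mem _ hc)⟩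
  nodup := hq.nodup.map_on fun a ha b hb h => hf (hq.subset a ha) (hq.subset b hb) h
  head := by simp [hq.head]
  last := by simp [hq.last]
  subset := by
    intro a ha
    obtain ⟨b, hb, rfl⟩ := List.mem_map.1 ha
    exact hST b (hq.subset b hb)

theorem listWeight_map (w : Sym2 V → ℝ) (f : ℕ → V) (l : List ℕ) :
    listWeight w (l.map f) = listWeight (fun e => w (e.map f)) l := by
  induction l with
  | nil => rfl
  | cons a l ih =>
    cases l with
    | nil => rfl
    | cons b l => simp only [List.map_cons, listWeight, Sym2.map_mk] at ih ⊢; rw [ih]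

/-- Nonmetrizability is carried over by an injective homomorphism. -/
theorem NonmetrizableOn.image {G : SimpleGraph ℕ} {G' : SimpleGraph V} {S : Set ℕ} {f : ℕ → V}
    (h : NonmetrizableOn G S) (hf : Set.InjOn f S)
    (hadj : ∀ i ∈ S, ∀ j ∈ S, G.Adj i j → G'.Adj (f i) (f j)) : NonmetrizableOn G' (f '' S) := by
  obtain ⟨p, hp, hw⟩ := h
  have hinv : ∀ i ∈ S, Function.invFunOn f S (f i) = i := fun i hi =>
    hf.leftInvOn_invFunOn hi
  refine ⟨fun u v => (p (Function.invFunOn f S u) (Function.invFunOn f S v)).map f,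
    ⟨?_, ?_, ?_, ?_⟩, ?_⟩
  · rintro _ ⟨i, hi, rfl⟩
    simp [hinv i hi, hp.self i hi]
  · rintro _ ⟨i, hi, rfl⟩ _ ⟨j, hj, rfl⟩ hij
    obtain ⟨t, ht, hit, he⟩ := hp.next i hi j hj fun h => hij (h ▸ rfl)
    exact ⟨f t, ⟨t, ht, rfl⟩, hadj i hi t ht hit, by
      simp [hinv i hi, hinv j hj, hinv t ht, he]⟩
  · rintro _ ⟨i, hi, rfl⟩ _ ⟨j, hj, rfl⟩
    simp [hinv i hi, hinv j hj, hp.symm i hi j hj]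
  · rintro _ ⟨i, hi, rfl⟩ _ ⟨j, hj, rfl⟩
    simp only [hinv i hi, hinv j hj]
    exact (hp.nodup i hi j hj).map_on fun a ha b hb h =>
      hf (hp.subset hi hj a ha) (hp.subset hi hj b hb) h
  · intro w hpos
    obtain ⟨u, hu, v, hv, q, hq, hlt⟩ := hw (fun e => w (e.map f)) fun a ha b hb hab =>
      hpos _ ⟨a, ha, rfl⟩ _ ⟨b, hb, rfl⟩ (hadj a ha b hb hab)
    refine ⟨f u, ⟨u, hu, rfl⟩, f v, ⟨v, hv, rfl⟩, q.map f,
      hq.map (T := f '' S) hf (fun i hi => ⟨i, hi, rfl⟩) hadj, ?_⟩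
    simpa [hinv u hu, hinv v hv, listWeight_map] using hlt

/-- A graph that contains a subdivision of a nonmetrizable graph is nonmetrizable on its vertices.
The subdividing vertices are removed one at a time, each being merged into its predecessor. -/
theorem IsModel.nonmetrizableOn {n : ℕ} {E : List (ℕ × ℕ)} (hE : IsLabelGraph n E)
    (h : NonmetrizableOn (labelGraph E) {i | i < n}) {f : ℕ → V} {W : ℕ × ℕ → List V}
    (hm : IsModel G n E f W) :
    NonmetrizableOn G {v | v ∈ (List.range n).map f ++ E.flatMap W} := by
  classical
  generalize hN : (E.flatMap W).length = N
  induction N generalizing G W with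
  | zero =>
    have hnil : E.flatMap W = [] := List.eq_nil_of_length_eq_zero hN
    have hS : {v | v ∈ (List.range n).map f ++ E.flatMap W} = f '' {i | i < n} := by
      ext v; simp [hnil]
    have hnd := hm.nodup
    rw [hnil, List.append_nil] at hnd
    have hf : Set.InjOn f {i | i < n} := fun i hi j hj hij =>
      List.inj_on_of_nodup_map hnd (List.mem_range.2 hi) (List.mem_range.2 hj) hij
    rw [hS]
    refine h.image hf fun i _ j _ hij => ?_
    have hW : ∀ e ∈ E, W e = [] := List.flatMap_eq_nil_iff.1 hnil
    rcases hij.2 with he | he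
    · simpa [hW _ he] using hm.link _ he
    · simpa [hW _ he, G.adj_comm] using hm.link _ he
  | succ N ih =>
    obtain ⟨e, he, z, l, hWe⟩ : ∃ e ∈ E, ∃ z l, W e = z :: l := by
      by_contra hcon
      push Not at hcon
      have : E.flatMap W = [] := List.flatMap_eq_nil_iff.2 fun e he => by
        cases hw : W e with
        | nil => rfl
        | cons z l => exact absurd hw (hcon e he z l)
      simp [this] at hN
    have hel := hE.2 e he
    obtain ⟨y, t, hyt⟩ : ∃ y t, l ++ [f e.2] = y :: t := by
      cases l <;> simp
    set W' := Function.update W e l with hW'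
    have hperm : (E.flatMap W).Perm (z :: E.flatMap W') := by
      refine (flatMap_perm_of_mem he W).trans ?_
      rw [hWe, List.cons_append, List.perm_cons]
      refine List.Perm.trans ?_ (flatMap_perm_of_mem he W').symm
      rw [show W' e = l by simp [hW'], flatMap_erase_congr hE.1 (W := W) (W' := W') fun a ha => by
        simp [hW', ha]]
    have hpermAll : ((List.range n).map f ++ E.flatMap W).Perm
        (z :: ((List.range n).map f ++ E.flatMap W')) :=
      (hperm.append_left _).trans List.perm_middle
    have hnd := hpermAll.nodup_iff.1 hm.nodup
    have hlink := hm.link e he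
    rw [hWe, link_cons] at hlink
    have hzy : G.Adj z y := by
      cases l with
      | nil =>
        obtain rfl : f e.2 = y := (List.cons.inj hyt).1
        exact hlink.2
      | cons a l =>
        obtain rfl : a = y := (List.cons.inj hyt).1
        exact hlink.2.1
    have hx : f e.1 ∈ (List.range n).map f ++ E.flatMap W' :=
      List.mem_append_left _ (List.mem_map.2 ⟨e.1, List.mem_range.2 (hel.1.trans hel.2), rfl⟩)
    have hy : y ∈ (List.range n).map f ++ E.flatMap W' := by
      have : y ∈ l ++ [f e.2] := by rw [hyt]; simp
      rw [List.mem_append, List.mem_singleton] at this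
      rcases this with h' | rfl
      · exact List.mem_append_right _ (List.mem_flatMap.2 ⟨e, he, by simpa [hW'] using h'⟩)
      · exact List.mem_append_left _ (List.mem_map.2 ⟨e.2, List.mem_range.2 hel.2, rfl⟩)
    have hxy : f e.1 ≠ y := by
      rintro rfl
      have h1 := hm.nodup
      have h2 : f e.1 ∈ l ++ [f e.2] := by rw [hyt]; simp
      rw [List.mem_append, List.mem_singleton] at h2
      rcases h2 with h2 | h2
      · refine List.disjoint_of_nodup_append h1 (List.mem_map.2
          ⟨e.1, List.mem_range.2 (hel.1.trans hel.2), rfl⟩) (List.mem_flatMap.2 ⟨e, he, ?_⟩)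
        rw [hWe]; exact List.mem_cons_of_mem _ h2
      · exact hel.1.ne (List.inj_on_of_nodup_map (List.Nodup.of_append_left h1)
          (List.mem_range.2 (hel.1.trans hel.2)) (List.mem_range.2 hel.2) h2)
    set G' := G ⊔ SimpleGraph.edge (f e.1) y with hG'
    have hm' : IsModel G' n E f W' := by
      refine ⟨fun d hd => ?_, (List.nodup_cons.1 hnd).2⟩
      by_cases hde : d = e
      · subst hde
        rw [show W' d = l by simp [hW']]
        have hadj : G'.Adj (f d.1) y := by
          rw [hG', SimpleGraph.sup_adj, SimpleGraph.edge_adj]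
          exact Or.inr ⟨Or.inl ⟨rfl, rfl⟩, hxy⟩
        cases l with
        | nil =>
          obtain rfl : f d.2 = y := (List.cons.inj hyt).1
          exact hadj
        | cons a l =>
          obtain rfl : a = y := (List.cons.inj hyt).1
          exact ⟨hadj, hlink.2.2.mono le_sup_left⟩
      · rw [show W' d = W d by simp [hW', hde]]
        exact (hm.link d hd).mono le_sup_left
    have hS : {v | v ∈ (List.range n).map f ++ E.flatMap W} =
        insert z {v | v ∈ (List.range n).map f ++ E.flatMap W'} := by
      ext v
      rw [Set.mem_ofPred_eq, hpermAll.mem_iff, List.mem_cons]; rfl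
    rw [hS]
    refine (ih hm' ?_).insert (List.nodup_cons.1 hnd).1 hx hy hlink.1 ?_
    · have := hperm.length_eq
      simp only [List.length_cons] at this
      omega
    · intro a _ b _ hab
      split_ifs with hs
      · exact hzy
      · rw [hG', SimpleGraph.sup_adj, SimpleGraph.edge_adj] at hab
        rcases hab with hab | ⟨hab, -⟩
        · exact hab
        · exact absurd (Sym2.eq_iff.2 (by tauto)) hs

theorem ContainsSubdivision.not_metrizable [Finite V] (hG : G.Connected) {n : ℕ}
    {E : List (ℕ × ℕ)} (hE : IsLabelGraph n E) (hn : 0 < n)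
    (h : NonmetrizableOn (labelGraph E) {i | i < n}) (hc : ContainsSubdivision G n E) :
    ¬ G.Metrizable := by
  obtain ⟨f, W, hm⟩ := hc
  refine ((hm.nonmetrizableOn hE h).univ hG ⟨f 0, ?_⟩).not_metrizable
  exact List.mem_append_left _ (List.mem_map.2 ⟨0, List.mem_range.2 hn, rfl⟩)

/-! ### Tables, certificates and nested subdivisions -/

theorem exists_perm_append_of_subperm {α : Type*} {l₁ l₂ : List α} (h : l₁.Subperm l₂) :
    ∃ R, l₂.Perm (l₁ ++ R) := by
  obtain ⟨l, hl, hs⟩ := h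
  obtain ⟨R, hR⟩ := hs.exists_perm_append
  exact ⟨R, hR.trans (hl.append_right R)⟩

/-- The path from `u` to `v` read off from a table of next vertices; the first argument bounds the
number of steps. -/
def tablePath (T : List (List ℕ)) : ℕ → ℕ → ℕ → List ℕ
  | 0, u, _ => [u]
  | k + 1, u, v => if u = v then [u] else u :: tablePath T k ((T.getD u []).getD v 0) v

/-- The table `T` of next vertices defines a consistent path system in a label graph. The equation
for `tablePath` ensures that `n` steps suffice. -/
def IsPathTable (n : ℕ) (E : List (ℕ × ℕ)) (T : List (List ℕ)) : Prop :=
  ∀ u < n, ∀ v < n,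
    (u = v ∨ (T.getD u []).getD v 0 < n ∧ (labelGraph E).Adj u ((T.getD u []).getD v 0) ∧
      tablePath T n u v = u :: tablePath T n ((T.getD u []).getD v 0) v) ∧
    tablePath T n v u = (tablePath T n u v).reverse ∧ (tablePath T n u v).Nodup

instance (n : ℕ) (E : List (ℕ × ℕ)) (T : List (List ℕ)) : Decidable (IsPathTable n E T) :=
  inferInstanceAs (Decidable (∀ u < n, ∀ v < n, _))

theorem IsPathTable.isListSystem {n : ℕ} {E : List (ℕ × ℕ)} {T : List (List ℕ)}
    (h : IsPathTable n E T) : IsListSystem (labelGraph E) {i | i < n} (tablePath T n) where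
  self u hu := by
    cases n with
    | zero => exact absurd hu (Nat.not_lt_zero u)
    | succ n => simp [tablePath]
  next u hu v hv huv := by
    obtain ⟨h1, h2, h3⟩ := (h u hu v hv).1.resolve_left huv
    exact ⟨_, h1, h2, h3⟩
  symm u hu v hv := (h u hu v hv).2.1
  nodup u hu v hv := (h u hu v hv).2.2

/-- The pairs of consecutive entries of a list, each pair with its smaller entry first. -/
def steps : List ℕ → List (ℕ × ℕ)
  | a :: b :: l => (min a b, max a b) :: steps (b :: l)
  | _ => []

theorem sym2_min_max (a b : ℕ) : s(min a b, max a b) = s(a, b) := by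
  rcases le_total a b with h | h
  · rw [min_eq_left h, max_eq_right h]
  · rw [min_eq_right h, max_eq_left h, Sym2.eq_swap]

theorem listWeight_eq_sum (w : Sym2 ℕ → ℝ) (l : List ℕ) :
    listWeight w l = ((steps l).map fun e => w s(e.1, e.2)).sum := by
  induction l with
  | nil => simp [listWeight, steps]
  | cons a l ih =>
    cases l with
    | nil => simp [listWeight, steps]
    | cons b l => simp only [listWeight, steps, List.map_cons, List.sum_cons, sym2_min_max, ih]

theorem adj_of_mem_steps {H : SimpleGraph ℕ} {l : List ℕ} (hl : l.IsChain H.Adj) {e : ℕ × ℕ}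
    (he : e ∈ steps l) : H.Adj e.1 e.2 ∧ e.1 ∈ l ∧ e.2 ∈ l := by
  induction l with
  | nil => simp [steps] at he
  | cons a l ih =>
    cases l with
    | nil => simp [steps] at he
    | cons b l =>
      rw [List.isChain_cons_cons] at hl
      rw [steps, List.mem_cons] at he
      rcases he with rfl | he
      · rcases le_total a b with h | h
        · simp [min_eq_left h, max_eq_right h, hl.1]
        · simp [min_eq_right h, max_eq_left h, hl.1.symm]
      · obtain ⟨h1, h2, h3⟩ := ih hl.2 he
        exact ⟨h1, List.mem_cons_of_mem _ h2, List.mem_cons_of_mem _ h3⟩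

/-- A Farkas certificate: the paths in `C`, taken together, use only edges of the chosen paths
with the same ends, and not all of them. Hence for no positive weights are all of the latter
shortest paths. -/
def IsInfeasible (n : ℕ) (E : List (ℕ × ℕ)) (T : List (List ℕ)) (C : List (List ℕ)) : Prop :=
  (∀ q ∈ C, q.IsChain (labelGraph E).Adj ∧ q.Nodup ∧ q ≠ [] ∧ ∀ a ∈ q, a < n) ∧
  (C.flatMap steps).length <
    (C.flatMap fun q => steps (tablePath T n (q.headD 0) (q.getLastD 0))).length ∧
  ∀ e ∈ C.flatMap steps, (C.flatMap steps).count e ≤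
    (C.flatMap fun q => steps (tablePath T n (q.headD 0) (q.getLastD 0))).count e

instance (n : ℕ) (E : List (ℕ × ℕ)) (T : List (List ℕ)) (C : List (List ℕ)) :
    Decidable (IsInfeasible n E T C) :=
  inferInstanceAs (Decidable (_ ∧ _ ∧ _))

theorem nonmetrizableOn_of_table {n : ℕ} {E : List (ℕ × ℕ)} {T : List (List ℕ)}
    {C : List (List ℕ)} (hT : IsPathTable n E T) (hC : IsInfeasible n E T C) :
    NonmetrizableOn (labelGraph E) {i | i < n} := by
  obtain ⟨hpath, hlen, hcount⟩ := hC
  have hp := hT.isListSystem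
  refine ⟨tablePath T n, hp, fun w hw => ?_⟩
  by_contra hcon
  push Not at hcon
  set P : List ℕ → List ℕ := fun q => tablePath T n (q.headD 0) (q.getLastD 0) with hP
  have hhead : ∀ q ∈ C, q.head? = some (q.headD 0) ∧ q.getLast? = some (q.getLastD 0) := by
    intro q hq
    have hne := (hpath q hq).2.2.1
    cases q with
    | nil => exact absurd rfl hne
    | cons a l => simp [List.getLast?_cons]
  have hmem : ∀ q ∈ C, q.headD 0 < n ∧ q.getLastD 0 < n := fun q hq =>
    ⟨(hpath q hq).2.2.2 _ (List.mem_of_head? (hhead q hq).1),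
      (hpath q hq).2.2.2 _ (List.mem_of_getLast? (hhead q hq).2)⟩
  have hle : ∀ q ∈ C, listWeight w (P q) ≤ listWeight w q := fun q hq =>
    hcon _ (hmem q hq).1 _ (hmem q hq).2 q
      ⟨(hpath q hq).1, (hpath q hq).2.1, (hhead q hq).1, (hhead q hq).2, (hpath q hq).2.2.2⟩
  have hsum : ∀ D : List (List ℕ), (∀ q ∈ D, listWeight w (P q) ≤ listWeight w q) →
      ((D.flatMap fun q => steps (P q)).map fun e => w s(e.1, e.2)).sum ≤
        ((D.flatMap steps).map fun e => w s(e.1, e.2)).sum := by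
    intro D hD
    induction D with
    | nil => simp
    | cons q D ih =>
      simp only [List.flatMap_cons, List.map_append, List.sum_append]
      have h1 := hD q (by simp)
      rw [listWeight_eq_sum, listWeight_eq_sum] at h1
      exact add_le_add h1 (ih fun q' hq' => hD q' (List.mem_cons_of_mem _ hq'))
  have hsub : (C.flatMap steps).Subperm (C.flatMap fun q => steps (P q)) :=
    List.subperm_ext_iff.2 hcount
  obtain ⟨R, hR⟩ := exists_perm_append_of_subperm hsub
  have hRne : R ≠ [] := by
    rintro rfl
    have := hR.length_eq
    rw [List.append_nil] at this
    exact absurd hlen (by simp only [hP] at this; omega)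
  have hpos : ∀ e ∈ R, 0 < w s(e.1, e.2) := by
    intro e he
    obtain ⟨q, hq, heq⟩ := List.mem_flatMap.1 (hR.mem_iff.2 (List.mem_append_right _ he))
    have hq' := hp.isListPath (hmem q hq).1 (hmem q hq).2
    obtain ⟨h1, h2, h3⟩ := adj_of_mem_steps hq'.chain heq
    exact hw _ (hq'.subset _ h2) _ (hq'.subset _ h3) h1
  have hRsum : 0 < (R.map fun e => w s(e.1, e.2)).sum :=
    List.sum_pos _ (fun x hx => by
      obtain ⟨e, he, rfl⟩ := List.mem_map.1 hx
      exact hpos e he) (by simpa using hRne)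
  have h1 := hsum C hle
  have h2 := (hR.map fun e => w s(e.1, e.2)).sum_eq
  rw [List.map_append, List.sum_append] at h2
  linarith

section Embedding

variable {f : ℕ → V} {W : ℕ × ℕ → List V}

/-- The interior vertices of the path of `G` that corresponds, in a model, to the walk
`x, l, y` of labels. -/
def expand (f : ℕ → V) (W : ℕ × ℕ → List V) : ℕ → List ℕ → ℕ → List V
  | x, [], y => if x ≤ y then W (x, y) else (W (y, x)).reverse
  | x, a :: l, y => (if x ≤ a then W (x, a) else (W (a, x)).reverse) ++ f a :: expand f W a l y

theorem perm_ite (x y : ℕ) :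
    (if x ≤ y then W (x, y) else (W (y, x)).reverse).Perm (W (min x y, max x y)) := by
  split_ifs with h
  · rw [min_eq_left h, max_eq_right h]
  · rw [min_eq_right (by omega), max_eq_left (by omega)]
    exact List.reverse_perm _

/-- The interior vertices of an expanded walk are the images of its interior labels and the interior
vertices of the paths that replace its edges. -/
theorem expand_perm (x : ℕ) (l : List ℕ) (y : ℕ) :
    (expand f W x l y).Perm (l.map f ++ (steps (x :: (l ++ [y]))).flatMap W) := by
  induction l generalizing x with
  | nil => simpa [expand, steps] using perm_ite x y
  | cons a l ih =>
    simp only [expand, List.cons_append, steps, List.map_cons, List.flatMap_cons]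
    have h1 := ((perm_ite (W := W) x a).append ((ih a).cons (f a)))
    refine h1.trans (List.perm_middle.trans (List.Perm.cons _ ?_))
    rw [← List.append_assoc, ← List.append_assoc]
    exact List.perm_append_comm.append_right _

theorem link_ite {x y : ℕ} (h : Link G (f (min x y)) (W (min x y, max x y)) (f (max x y))) :
    Link G (f x) (if x ≤ y then W (x, y) else (W (y, x)).reverse) (f y) := by
  split_ifs with hxy
  · rwa [min_eq_left hxy, max_eq_right hxy] at h
  · rw [min_eq_right (by omega), max_eq_left (by omega)] at h
    exact h.symm

theorem link_expand {E : List (ℕ × ℕ)} (hlink : ∀ e ∈ E, Link G (f e.1) (W e) (f e.2))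
    {x : ℕ} {l : List ℕ} {y : ℕ} (h : ∀ e ∈ steps (x :: (l ++ [y])), e ∈ E) :
    Link G (f x) (expand f W x l y) (f y) := by
  induction l generalizing x with
  | nil => exact link_ite (hlink _ (h (min x y, max x y) (by simp [steps])))
  | cons a l ih =>
    simp only [List.cons_append, steps] at h
    rw [expand, link_append_cons]
    exact ⟨link_ite (hlink _ (h (min x a, max x a) (by simp))),
      ih fun e he => h e (List.mem_cons_of_mem _ he)⟩

/-- The interior labels assigned to the edge `e` by the association list `D`. -/
def interior (D : List ((ℕ × ℕ) × List ℕ)) (e : ℕ × ℕ) : List ℕ := (D.lookup e).getD []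

/-- The label graph `(n, E)` contains a subdivision of the label graph `(m, F)`: its branch
vertices are listed by `B`, and `D` lists the interior vertices of the subdivided edges. -/
def IsSubdivisionIn (m : ℕ) (F : List (ℕ × ℕ)) (n : ℕ) (E : List (ℕ × ℕ)) (B : List ℕ)
    (D : List ((ℕ × ℕ) × List ℕ)) : Prop :=
  (F.flatMap fun e => steps (B.getD e.1 0 :: (interior D e ++ [B.getD e.2 0]))).Nodup ∧
  (∀ e ∈ F, ∀ s ∈ steps (B.getD e.1 0 :: (interior D e ++ [B.getD e.2 0])), s ∈ E) ∧
  (((List.range m).map fun i => B.getD i 0) ++ F.flatMap (interior D)).Nodup ∧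
  ∀ i ∈ ((List.range m).map fun i => B.getD i 0) ++ F.flatMap (interior D), i < n

instance (m : ℕ) (F : List (ℕ × ℕ)) (n : ℕ) (E : List (ℕ × ℕ)) (B : List ℕ)
    (D : List ((ℕ × ℕ) × List ℕ)) : Decidable (IsSubdivisionIn m F n E B D) :=
  inferInstanceAs (Decidable (_ ∧ _ ∧ _ ∧ _))

theorem ContainsSubdivision.trans {m n : ℕ} {F E : List (ℕ × ℕ)} {B : List ℕ}
    {D : List ((ℕ × ℕ) × List ℕ)} (h : ContainsSubdivision G n E)
    (hs : IsSubdivisionIn m F n E B D) : ContainsSubdivision G m F := by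
  obtain ⟨f, W, hm⟩ := h
  obtain ⟨h1, h2, h3, h4⟩ := hs
  set β : ℕ → ℕ := fun i => B.getD i 0 with hβ
  set Q : ℕ × ℕ → List (ℕ × ℕ) := fun e => steps (β e.1 :: (interior D e ++ [β e.2])) with hQ
  refine ⟨fun i => f (β i), fun e => expand f W (β e.1) (interior D e) (β e.2),
    fun e he => link_expand hm.link (h2 e he), ?_⟩
  obtain ⟨R, hR⟩ := exists_perm_append_of_subperm (List.subperm_of_subset h3
    (fun i hi => List.mem_range.2 (h4 i hi)))
  obtain ⟨R', hR'⟩ := exists_perm_append_of_subperm (List.subperm_of_subset h1 (fun s hs => by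
    obtain ⟨e, he, hse⟩ := List.mem_flatMap.1 hs
    exact h2 e he s hse))
  have hold := (((hR.map f).append (hR'.flatMap_right W)).nodup_iff.1 hm.nodup)
  rw [List.map_append, List.flatMap_append] at hold
  have hsub := hold.sublist ((List.sublist_append_left _ _).append (List.sublist_append_left _ _))
  refine (List.Perm.nodup_iff ?_).2 hsub
  have hexp : (F.flatMap fun e => expand f W (β e.1) (interior D e) (β e.2)).Perm
      ((F.flatMap (interior D)).map f ++ (F.flatMap Q).flatMap W) := by
    have e1 : (F.flatMap (interior D)).map f = F.flatMap fun e => (interior D e).map f := by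
      simp [List.map_flatMap]
    have e2 : (F.flatMap Q).flatMap W = F.flatMap fun e => (Q e).flatMap W := by
      simp [List.flatMap_assoc]
    rw [e1, e2]
    exact (List.Perm.flatMap_left F fun e _ => expand_perm _ _ _).trans
      (List.flatMap_append_perm F _ _).symm
  rw [List.map_append, List.map_map, List.append_assoc]
  exact hexp.append_left _

end Embedding

/-! ### Extending subdivisions in 2-connected graphs -/

/-- A walk from `A` to `B` contains a path from `A` to `B` whose interior avoids both. -/
theorem exists_link_of_walk {A B : Set V} (hAB : Disjoint A B) {a b : V} (p : G.Walk a b)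
    (ha : a ∈ A) (hb : b ∈ B) :
    ∃ x ∈ A, ∃ y ∈ B, ∃ l, Link G x l y ∧ l.Nodup ∧ (∀ z ∈ l, z ∉ A ∧ z ∉ B) ∧
      x ∈ p.support ∧ y ∈ p.support ∧ ∀ z ∈ l, z ∈ p.support := by
  have key : ∀ {u b : V} (p : G.Walk u b), b ∈ B → u ∈ B ∨
      (∃ x ∈ A, ∃ y ∈ B, ∃ l, Link G x l y ∧ l.Nodup ∧ (∀ z ∈ l, z ∉ A ∧ z ∉ B) ∧
        x ∈ p.support ∧ y ∈ p.support ∧ ∀ z ∈ l, z ∈ p.support) ∨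
      ∃ y ∈ B, ∃ l, Link G u l y ∧ (u :: l).Nodup ∧ (∀ z ∈ l, z ∉ A ∧ z ∉ B) ∧
        y ∈ p.support ∧ ∀ z ∈ l, z ∈ p.support := by
    intro u b p hb
    induction p with
    | nil => exact Or.inl hb
    | @cons u t b hut p ih =>
      right
      rcases ih hb with ht | ⟨x, hx, y, hy, l, h1, h2, h3, h4, h5, h6⟩ |
        ⟨y, hy, l, h1, h2, h3, h4, h5⟩
      · exact Or.inr ⟨t, ht, [], hut, by simp, by simp, by simp, by simp⟩
      · exact Or.inl ⟨x, hx, y, hy, l, h1, h2, h3, by simp [h4], by simp [h5], fun z hz => by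
          simp [h6 z hz]⟩
      · by_cases htA : t ∈ A
        · exact Or.inl ⟨t, htA, y, hy, l, h1, (List.nodup_cons.1 h2).2, h3, by simp, by simp [h4],
            fun z hz => by simp [h5 z hz]⟩
        by_cases htB : t ∈ B
        · exact Or.inr ⟨t, htB, [], hut, by simp, by simp, by simp, by simp⟩
        right
        by_cases hul : u ∈ l
        · obtain ⟨l1, l2, rfl⟩ := List.append_of_mem hul
          have hsub : (u :: l2).Sublist (t :: (l1 ++ u :: l2)) :=
            (List.sublist_append_right _ _).cons _
          exact ⟨y, hy, l2, (link_append_cons.1 h1).2, h2.sublist hsub,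
            fun z hz => h3 z (by simp [hz]), by simp [h4], fun z hz => by
              simp [h5 z (by simp [hz])]⟩
        · refine ⟨y, hy, t :: l, ⟨hut, h1⟩, List.nodup_cons.2 ⟨?_, h2⟩, ?_, by simp [h4], ?_⟩
          · simp only [List.mem_cons, not_or]; exact ⟨hut.ne, hul⟩
          · intro z hz
            rcases List.mem_cons.1 hz with rfl | hz
            · exact ⟨htA, htB⟩
            · exact h3 z hz
          · intro z hz
            rcases List.mem_cons.1 hz with rfl | hz
            · simp
            · simp [h5 z hz]
  rcases key p hb with h | ⟨x, hx, y, hy, l, h⟩ | ⟨y, hy, l, h1, h2, h3, h4, h5⟩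
  · exact absurd h (Set.disjoint_left.1 hAB ha)
  · exact ⟨x, hx, y, hy, l, h⟩
  · exact ⟨a, ha, y, hy, l, h1, (List.nodup_cons.1 h2).2, h3, by simp, h4, h5⟩

theorem exists_link (hG : G.Connected) {A B : Set V} (hAB : Disjoint A B) (hA : A.Nonempty)
    (hB : B.Nonempty) :
    ∃ x ∈ A, ∃ y ∈ B, ∃ l, Link G x l y ∧ l.Nodup ∧ ∀ z ∈ l, z ∉ A ∧ z ∉ B := by
  obtain ⟨a, ha⟩ := hA
  obtain ⟨b, hb⟩ := hB
  obtain ⟨p⟩ := hG.preconnected a b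
  obtain ⟨x, hx, y, hy, l, h1, h2, h3, -⟩ := exists_link_of_walk hAB p ha hb
  exact ⟨x, hx, y, hy, l, h1, h2, h3⟩

/-- The removal of `v` leaves a path from `A` to `B`. -/
theorem exists_link_avoiding {v : V} (hG : (G.induce {v}ᶜ).Connected) {A B : Set V}
    (hAB : Disjoint A B) {a b : V} (ha : a ∈ A) (hav : a ≠ v) (hb : b ∈ B) (hbv : b ≠ v) :
    ∃ x ∈ A, x ≠ v ∧ ∃ y ∈ B, y ≠ v ∧ ∃ l, Link G x l y ∧ l.Nodup ∧
      ∀ z ∈ l, z ∉ A ∧ z ∉ B ∧ z ≠ v := by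
  obtain ⟨p⟩ := hG.preconnected ⟨a, hav⟩ ⟨b, hbv⟩
  have hp : ∀ z ∈ (p.map (SimpleGraph.Embedding.induce {v}ᶜ).toHom).support, z ≠ v := by
    intro z hz
    rw [SimpleGraph.Walk.support_map, List.mem_map] at hz
    obtain ⟨c, -, rfl⟩ := hz
    exact c.2
  obtain ⟨x, hx, y, hy, l, h1, h2, h3, h4, h5, h6⟩ := exists_link_of_walk hAB
    (p.map (SimpleGraph.Embedding.induce {v}ᶜ).toHom) ha hb
  exact ⟨x, hx, hp x h4, y, hy, hp y h5, l, h1, h2, fun z hz =>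
    ⟨(h3 z hz).1, (h3 z hz).2, hp z (h6 z hz)⟩⟩

/-- A path can be entered at any of its vertices. -/
theorem Link.of_mem {x y z : V} {l : List V} (h : Link G x l y) (hz : z ∈ x :: l) :
    ∃ X Y, x :: l = X ++ z :: Y ∧ Link G z Y y := by
  obtain ⟨X, Y, hXY⟩ := List.append_of_mem hz
  refine ⟨X, Y, hXY, ?_⟩
  cases X with
  | nil =>
    obtain ⟨rfl, rfl⟩ := List.cons.inj hXY
    exact h
  | cons a X =>
    obtain ⟨rfl, rfl⟩ := List.cons.inj hXY
    exact (link_append_cons.1 h).2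

/-- The label graphs with one more label `n` that arise from `(n, E)` by subdividing an edge or by
joining two labels by a path of length two. -/
def extensions (n : ℕ) (E : List (ℕ × ℕ)) : List (List (ℕ × ℕ)) :=
  (E.map fun e => (e.1, n) :: (e.2, n) :: E.erase e) ++
    (List.range n).flatMap fun j => (List.range j).map fun i => (i, n) :: (j, n) :: E

/-- A new branch vertex `z` that is joined by two disjoint paths to the branch vertices `i` and `j`.
The list `E` need not contain all the edges of the original model. -/
theorem IsModel.add_vertex {n : ℕ} {E : List (ℕ × ℕ)} {f : ℕ → V} {W : ℕ × ℕ → List V}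
    (hE : ∀ e ∈ E, e.1 < n ∧ e.2 < n) (hlink : ∀ e ∈ E, Link G (f e.1) (W e) (f e.2))
    {i j : ℕ} (hij : i ≠ j) (hi : i < n) (hj : j < n) {z : V} {l l' : List V}
    (h1 : Link G (f i) l z) (h2 : Link G (f j) l' z)
    (hnd : ((List.range n).map f ++ E.flatMap W ++ z :: (l ++ l')).Nodup) :
    ContainsSubdivision G (n + 1) ((i, n) :: (j, n) :: E) := by
  classical
  set W' := Function.update (Function.update W (i, n) l) (j, n) l' with hW'
  have e1 : W' (i, n) = l := by simp [hW', hij]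
  have e2 : W' (j, n) = l' := by simp [hW']
  have e3 : ∀ e ∈ E, W' e = W e := by
    intro e he
    have hn : e.2 ≠ n := (hE e he).2.ne
    rw [hW', Function.update_of_ne, Function.update_of_ne] <;>
      (rintro rfl; exact hn rfl)
  have f1 : ∀ k < n, Function.update f n z k = f k := fun k hk => by
    rw [Function.update_of_ne hk.ne]
  refine ⟨Function.update f n z, W', ?_, ?_⟩
  · intro e he
    rw [List.mem_cons, List.mem_cons] at he
    rcases he with rfl | rfl | he
    · simpa [e1, f1 i hi] using h1
    · simpa [e2, f1 j hj] using h2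
    · rw [f1 _ (hE e he).1, f1 _ (hE e he).2, e3 e he]
      exact hlink e he
  · have hr : (List.range (n + 1)).map (Function.update f n z) = (List.range n).map f ++ [z] := by
      rw [List.range_succ, List.map_append]
      congr 1
      · exact List.map_congr_left fun k hk => f1 k (List.mem_range.1 hk)
      · simp
    have hf : E.flatMap W' = E.flatMap W := by
      simp only [List.flatMap_def]
      rw [List.map_congr_left e3]
    rw [List.flatMap_cons, List.flatMap_cons, e1, e2, hf, hr]
    refine (List.Perm.nodup_iff ?_).2 hnd
    rw [List.append_assoc, List.append_assoc]
    refine List.Perm.append_left _ ?_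
    rw [← List.append_assoc, List.singleton_append, ← List.cons_append, ← List.append_assoc]
    exact List.perm_append_comm

/-- A 2-connected graph that contains a subdivision of a label graph with fewer vertices contains
a subdivision of one of the extensions of that label graph. -/
theorem ContainsSubdivision.exists_extension [Fintype V] (hG : G.TwoConnected) {n : ℕ}
    {E : List (ℕ × ℕ)} (hE : IsLabelGraph n E) (hn : 2 ≤ n) (hcard : n < Fintype.card V)
    (h : ContainsSubdivision G n E) :
    ∃ E' ∈ extensions n E, ContainsSubdivision G (n + 1) E' := by
  classical
  obtain ⟨f, W, hm⟩ := h
  have hlt : ∀ e ∈ E, e.1 < n ∧ e.2 < n := fun e he => ⟨(hE.2 e he).1.trans (hE.2 e he).2,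
    (hE.2 e he).2⟩
  by_cases hW : ∃ e ∈ E, W e ≠ []
  · obtain ⟨e, he, hne⟩ := hW
    obtain ⟨z, l, hzl⟩ := List.exists_cons_of_ne_nil hne
    have hlink := hm.link e he
    rw [hzl, link_cons] at hlink
    refine ⟨_, List.mem_append_left _ (List.mem_map_of_mem he), IsModel.add_vertex (f := f) (W := W)
      (fun d hd => hlt d (List.mem_of_mem_erase hd))
      (fun d hd => hm.link d (List.mem_of_mem_erase hd))
      (hE.2 e he).1.ne (hlt e he).1 (hlt e he).2 (z := z) (l := []) (l' := l.reverse) hlink.1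
      hlink.2.symm ?_⟩
    refine (List.Perm.nodup_iff ?_).2 hm.nodup
    rw [List.append_assoc]
    refine List.Perm.append_left _ (List.Perm.trans ?_ (flatMap_perm_of_mem he W).symm)
    rw [hzl, List.nil_append]
    exact (((List.reverse_perm l).cons z).append_left _).trans List.perm_append_comm
  · push Not at hW
    have hnil : E.flatMap W = [] := List.flatMap_eq_nil_iff.2 hW
    have hnd := hm.nodup
    rw [hnil, List.append_nil] at hnd
    set S : Set V := {v | v ∈ (List.range n).map f} with hS
    have hSi : ∀ i < n, f i ∈ S := fun i hi => List.mem_map.2 ⟨i, List.mem_range.2 hi, rfl⟩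
    obtain ⟨z₀, hz₀⟩ : ∃ z, z ∉ S := by
      by_contra hcon
      push Not at hcon
      have h1 : Finset.univ ⊆ ((List.range n).map f).toFinset := fun v _ => by
        simpa using List.mem_map.1 (hcon v)
      have h2 := Finset.card_le_card h1
      have h3 := List.toFinset_card_le ((List.range n).map f)
      simp only [List.length_map, List.length_range, Finset.card_univ] at h2 h3
      omega
    obtain ⟨x, rfl, y, hy, l, h1, h2, h3⟩ := exists_link hG.2.1 (A := {z₀}) (B := S)
      (Set.disjoint_singleton_left.2 hz₀) ⟨z₀, rfl⟩ ⟨f 0, hSi 0 (by omega)⟩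
    obtain ⟨i, hi, rfl⟩ := List.mem_map.1 hy
    rw [List.mem_range] at hi
    have hinj : ∀ {i j}, i < n → j < n → f i = f j → i = j := fun hi hj hij =>
      List.inj_on_of_nodup_map hnd (List.mem_range.2 hi) (List.mem_range.2 hj) hij
    obtain ⟨k, hk, hki⟩ : ∃ k < n, k ≠ i := by
      by_cases h0 : i = 0
      · exact ⟨1, by omega, by omega⟩
      · exact ⟨0, by omega, Ne.symm h0⟩
    have hxl : ∀ c ∈ x :: l, c ∉ S := by
      intro c hc
      rcases List.mem_cons.1 hc with rfl | hc
      · exact hz₀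
      · exact (h3 c hc).2
    obtain ⟨a, ha, -, b, ⟨hb, -⟩, hbi, l', g1, g2, g3⟩ := exists_link_avoiding (hG.2.2 (f i))
      (A := {c | c ∈ x :: l}) (B := S ∩ {f i}ᶜ)
      (Set.disjoint_left.2 fun c hc hc' => hxl c hc hc'.1) (a := x) (b := f k) (by simp)
      (fun hx => hz₀ (hx ▸ hSi i hi)) ⟨hSi k hk, fun hc => hki (hinj hk hi hc)⟩
      fun hc => hki (hinj hk hi hc)
    obtain ⟨j, hj, rfl⟩ := List.mem_map.1 hb
    rw [List.mem_range] at hj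
    have hij : i ≠ j := fun h => hbi (h ▸ rfl)
    obtain ⟨X, Y, hXY, hY⟩ := h1.of_mem ha
    have hxlnd : (x :: l).Nodup := List.nodup_cons.2 ⟨fun hx => (h3 x hx).1 rfl, h2⟩
    have hsub : (a :: Y).Sublist (x :: l) := by rw [hXY]; exact List.sublist_append_right _ _
    have hall : ∀ L, L.Perm (Y ++ l') →
        ((List.range n).map f ++ E.flatMap W ++ a :: L).Nodup := by
      intro L hL
      rw [hnil, List.append_nil]
      refine List.Nodup.append hnd ?_ ?_
      · refine (hL.cons a).nodup_iff.2 ?_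
        rw [← List.cons_append]
        refine List.Nodup.append (hxlnd.sublist hsub) g2 fun c hc hc' => ?_
        exact (g3 c hc').1 (hsub.subset hc)
      · intro c hc hc'
        rw [(hL.cons a).mem_iff, ← List.cons_append, List.mem_append] at hc'
        rcases hc' with hc' | hc'
        · exact hxl c (hsub.subset hc') hc
        · exact (g3 c hc').2.1 ⟨hc, (g3 c hc').2.2⟩
    rcases lt_or_gt_of_ne hij with h | h
    · refine ⟨(i, n) :: (j, n) :: E, List.mem_append_right _ (List.mem_flatMap.2
        ⟨j, List.mem_range.2 hj, List.mem_map.2 ⟨i, List.mem_range.2 h, rfl⟩⟩),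
        IsModel.add_vertex hlt hm.link hij hi hj hY.symm g1.symm (hall _ ?_)⟩
      exact (List.reverse_perm _).append (List.reverse_perm _)
    · refine ⟨(j, n) :: (i, n) :: E, List.mem_append_right _ (List.mem_flatMap.2
        ⟨i, List.mem_range.2 hi, List.mem_map.2 ⟨j, List.mem_range.2 h, rfl⟩⟩),
        IsModel.add_vertex hlt hm.link hij.symm hj hi g1.symm hY.symm (hall _ ?_)⟩
      exact ((List.reverse_perm _).append (List.reverse_perm _)).trans List.perm_append_comm

/-! ### The small graphs -/

/-- The label graphs of the argument, each with its number of labels. Numbers 0 to 7 are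
nonmetrizable. The others force, in a sufficiently large 2-connected graph that contains a
subdivision of them, one of the former: number 8 is the triangular prism; number 11 consists of two
4-cycles joined by two disjoint edges at opposite vertices, and 10 and 9 add to it, on one or both
4-cycles, a path of length two between the other two opposite vertices; number 14 is the complete
bipartite graph with parts `{1, 2}` and `{0, 3, 4, 5}` and the extra edges `(0, 4)`, `(3, 5)`, of which
one is subdivided in number 13 and both in number 12. -/
def smallGraph : ℕ → ℕ × List (ℕ × ℕ)
  | 0 => (7,
    [(0, 2), (0, 4), (0, 6), (1, 3), (1, 4), (1, 6), (2, 3), (2, 5), (3, 5), (4, 5)])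
  | 1 => (7,
    [(0, 1), (0, 4), (0, 6), (1, 3), (1, 4), (2, 3), (2, 5), (2, 6), (3, 5), (4, 5)])
  | 2 => (7,
    [(0, 2), (0, 4), (1, 3), (1, 4), (1, 6), (2, 3), (2, 5), (2, 6), (4, 5)])
  | 3 => (9,
    [(0, 4), (0, 6), (0, 8), (1, 3), (1, 4), (1, 6), (2, 5), (2, 7), (2, 8), (3, 5), (3, 7)])
  | 4 => (9,
    [(0, 1), (0, 5), (0, 8), (1, 4), (1, 6), (2, 3), (2, 4), (2, 6), (3, 7), (3, 8), (5, 7)])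
  | 5 => (10,
    [(0, 2), (0, 4), (0, 6), (1, 3), (1, 4), (1, 6), (2, 5), (2, 7), (3, 5), (3, 7), (4, 9),
    (6, 8), (8, 9)])
  | 6 => (7,
    [(0, 2), (0, 4), (1, 3), (1, 4), (1, 5), (1, 6), (2, 3), (2, 5), (2, 6)])
  | 7 => (8,
    [(0, 1), (0, 2), (0, 7), (1, 3), (1, 4), (1, 5), (2, 3), (2, 4), (2, 5), (4, 6), (6, 7)])
  | 8 => (6,
    [(0, 1), (0, 2), (0, 4), (1, 3), (1, 4), (2, 3), (2, 5), (3, 5), (4, 5)])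
  | 9 => (10,
    [(0, 2), (0, 4), (0, 6), (1, 3), (1, 4), (1, 6), (2, 5), (2, 7), (3, 5), (3, 7), (4, 8),
    (5, 9), (6, 8), (7, 9)])
  | 10 => (9,
    [(0, 2), (0, 4), (0, 6), (1, 3), (1, 4), (1, 6), (2, 5), (2, 7), (3, 5), (3, 7), (4, 8),
    (6, 8)])
  | 11 => (8,
    [(0, 2), (0, 4), (0, 6), (1, 3), (1, 4), (1, 6), (2, 5), (2, 7), (3, 5), (3, 7)])
  | 12 => (8,
    [(0, 1), (0, 2), (0, 6), (1, 3), (1, 4), (1, 5), (2, 3), (2, 4), (2, 5), (3, 7), (4, 6),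
    (5, 7)])
  | 13 => (7,
    [(0, 1), (0, 2), (0, 6), (1, 3), (1, 4), (1, 5), (2, 3), (2, 4), (2, 5), (3, 5), (4, 6)])
  | _ => (6,
    [(0, 1), (0, 2), (0, 4), (1, 3), (1, 4), (1, 5), (2, 3), (2, 4), (2, 5), (3, 5)])

/-- Tables of next vertices of consistent path systems in the first eight small graphs. -/
def pathTable : ℕ → List (List ℕ)
  | 0 =>
    [[0, 6, 2, 2, 4, 4, 6], [6, 1, 6, 3, 4, 3, 6], [0, 0, 2, 3, 5, 5, 0], [2, 1, 2, 3, 1, 5,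
    2], [0, 1, 5, 1, 4, 5, 0], [4, 3, 2, 3, 4, 5, 4], [0, 1, 0, 0, 0, 0, 6]]
  | 1 =>
    [[0, 1, 6, 1, 4, 6, 6], [0, 1, 3, 3, 4, 4, 0], [6, 3, 2, 3, 6, 5, 6], [1, 1, 2, 3, 5, 5,
    1], [0, 1, 0, 5, 4, 5, 0], [2, 4, 2, 3, 4, 5, 2], [0, 0, 2, 0, 0, 2, 6]]
  | 2 =>
    [[0, 4, 2, 2, 4, 2, 4], [4, 1, 3, 3, 4, 4, 6], [0, 3, 2, 3, 0, 5, 6], [2, 1, 2, 3, 1, 1,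
    2], [0, 1, 0, 1, 4, 5, 1], [2, 4, 2, 4, 4, 5, 2], [1, 1, 2, 2, 1, 2, 6]]
  | 3 =>
    [[0, 4, 8, 4, 4, 8, 6, 8, 8], [4, 1, 3, 3, 4, 3, 6, 3, 3], [8, 5, 2, 5, 8, 5, 8, 7, 8],
    [1, 1, 5, 3, 1, 5, 1, 7, 5], [0, 1, 0, 1, 4, 0, 1, 0, 0], [2, 3, 2, 3, 2, 5, 2, 3, 2], [0,
    1, 0, 1, 1, 0, 6, 0, 0], [2, 3, 2, 3, 2, 3, 2, 7, 2], [0, 2, 2, 2, 0, 2, 0, 2, 8]]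
  | 4 =>
    [[0, 1, 1, 5, 1, 5, 1, 5, 8], [0, 1, 4, 0, 4, 0, 6, 0, 0], [4, 4, 2, 3, 4, 4, 6, 3, 3],
    [7, 7, 2, 3, 2, 7, 2, 7, 8], [1, 1, 2, 2, 4, 1, 1, 2, 1], [0, 0, 0, 7, 0, 5, 0, 7, 0], [1,
    1, 2, 2, 1, 1, 6, 1, 2], [5, 5, 3, 3, 3, 5, 5, 7, 5], [0, 0, 3, 3, 0, 0, 3, 0, 8]]
  | 5 =>
    [[0, 4, 2, 4, 4, 2, 6, 2, 4, 4], [4, 1, 3, 3, 4, 3, 6, 3, 6, 6], [0, 5, 2, 5, 0, 5, 0, 7,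
    0, 0], [1, 1, 5, 3, 1, 5, 1, 7, 1, 1], [0, 1, 0, 1, 4, 0, 1, 0, 9, 9], [2, 3, 2, 3, 2, 5,
    2, 3, 2, 2], [0, 1, 0, 1, 1, 0, 6, 0, 8, 8], [2, 3, 2, 3, 2, 3, 2, 7, 2, 2], [9, 6, 9, 6,
    9, 9, 6, 9, 8, 9], [4, 8, 4, 8, 4, 4, 8, 4, 8, 9]]
  | 6 =>
    [[0, 4, 2, 2, 4, 2, 4], [4, 1, 3, 3, 4, 5, 6], [0, 3, 2, 3, 0, 5, 6], [2, 1, 2, 3, 1, 1,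
    2], [0, 1, 0, 1, 4, 0, 1], [2, 1, 2, 1, 2, 5, 1], [1, 1, 2, 2, 1, 1, 6]]
  | _ =>
    [[0, 1, 2, 1, 2, 1, 7, 7], [0, 1, 0, 3, 4, 5, 0, 0], [0, 0, 2, 3, 4, 5, 4, 4], [1, 1, 2,
    3, 1, 2, 1, 1], [2, 1, 2, 1, 4, 1, 6, 6], [1, 1, 2, 2, 1, 5, 1, 1], [7, 7, 4, 7, 4, 7, 6,
    7], [0, 0, 6, 0, 6, 0, 6, 7]]

/-- For each of the first eight small graphs, paths that show that the system given by `pathTable`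
is not metric. -/
def shorterPaths : ℕ → List (List ℕ)
  | 0 =>
    [[1, 3, 2], [1, 4, 5], [3, 5, 4], [0, 2, 5], [3, 1, 6], [2, 0, 4]]
  | 1 =>
    [[3, 1, 4], [3, 2, 6], [1, 3, 5], [2, 5, 4], [0, 4, 5], [1, 0, 6, 2]]
  | 2 =>
    [[0, 2, 6], [3, 2, 5], [0, 4, 5], [3, 1, 6]]
  | 3 =>
    [[1, 4, 0, 8], [4, 0, 6], [5, 3, 1, 6], [4, 1, 3, 7], [0, 8, 2, 5, 3], [5, 2, 7]]
  | 4 =>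
    [[6, 1, 0, 8], [1, 4, 2, 3], [4, 2, 6], [4, 1, 0, 5, 7], [7, 3, 8], [2, 3, 7, 5]]
  | 5 =>
    [[0, 6, 8], [6, 1, 3, 7], [1, 4, 9], [1, 4, 0, 2], [5, 2, 7], [5, 3, 1, 6], [0, 2, 5, 3],
    [4, 0, 6]]
  | 6 =>
    [[0, 2, 6], [4, 1, 5], [3, 2, 5], [3, 1, 6]]
  | _ =>
    [[2, 0, 7], [1, 4, 6], [3, 1, 5], [3, 2, 4], [4, 2, 5], [0, 1, 4]]

/-- For each extension of the small graph `k`, a small graph of which it contains a subdivision,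
together with the branch vertices and the interiors of the subdivided edges. -/
def embeddings : ℕ → List (ℕ × List ℕ × List ((ℕ × ℕ) × List ℕ))
  | 8 =>
    [(0, [0, 1, 2, 3, 4, 5, 6], []), (1, [0, 1, 2, 3, 4, 5, 6], []), (0, [0, 4, 2, 5, 1, 3,
    6], []), (1, [1, 0, 3, 2, 4, 5, 6], []), (0, [1, 4, 3, 5, 0, 2, 6], []), (0, [2, 3, 0, 1,
    5, 4, 6], []), (0, [2, 5, 0, 4, 3, 1, 6], []), (0, [3, 5, 1, 4, 2, 0, 6], []), (1, [4, 0,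
    5, 2, 1, 3, 6], []), (0, [0, 1, 2, 3, 4, 5, 6], []), (1, [0, 1, 2, 3, 4, 5, 6], []), (2,
    [0, 1, 2, 3, 4, 5, 6], []), (2, [1, 0, 3, 2, 4, 5, 6], []), (1, [1, 0, 3, 2, 4, 5, 6],
    []), (0, [2, 3, 0, 1, 5, 4, 6], []), (0, [0, 4, 2, 5, 1, 3, 6], []), (0, [1, 4, 3, 5, 0,
    2, 6], []), (2, [0, 3, 4, 1, 2, 6, 5], []), (2, [0, 3, 4, 1, 2, 5, 6], []), (2, [2, 1, 5,
    3, 0, 6, 4], []), (2, [0, 5, 1, 4, 2, 3, 6], []), (0, [2, 5, 0, 4, 3, 1, 6], []), (0, [3,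
    5, 1, 4, 2, 0, 6], []), (1, [4, 0, 5, 2, 1, 3, 6], [])]
  | 9 =>
    [(3, [0, 1, 2, 3, 4, 5, 6, 7, 10], []), (3, [3, 2, 4, 0, 5, 8, 7, 10, 1], [((3, 5),
    [6])]), (3, [3, 2, 6, 0, 5, 8, 7, 10, 1], [((3, 5), [4])]), (3, [1, 0, 3, 2, 4, 5, 6, 7,
    10], []), (3, [2, 3, 4, 1, 5, 8, 7, 10, 0], [((3, 5), [6])]), (3, [2, 3, 6, 1, 5, 8, 7,
    10, 0], [((3, 5), [4])]), (3, [1, 0, 5, 2, 4, 9, 6, 10, 3], [((3, 5), [7])]), (3, [1, 0,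
    7, 2, 4, 9, 6, 10, 3], [((3, 5), [5])]), (3, [0, 1, 5, 3, 4, 9, 6, 10, 2], [((3, 5),
    [7])]), (3, [0, 1, 7, 3, 4, 9, 6, 10, 2], [((3, 5), [5])]), (5, [0, 1, 2, 3, 4, 5, 6, 7,
    8, 10], []), (5, [2, 3, 0, 1, 5, 4, 7, 6, 9, 10], []), (5, [0, 1, 2, 3, 4, 5, 6, 7, 10,
    8], []), (5, [2, 3, 0, 1, 5, 4, 7, 6, 10, 9], []), (6, [3, 0, 1, 4, 7, 6, 10], [((1, 4),
    [2])]), (3, [0, 1, 2, 3, 4, 5, 6, 7, 10], []), (2, [5, 1, 2, 6, 3, 7, 10], [((2, 3),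
    [0])]), (2, [5, 0, 3, 6, 2, 7, 10], [((2, 3), [1])]), (3, [1, 0, 3, 2, 4, 5, 6, 7, 10],
    []), (6, [1, 2, 3, 5, 6, 7, 10], [((1, 4), [0])]), (3, [3, 2, 4, 0, 5, 8, 7, 10, 1], [((3,
    5), [6])]), (3, [2, 3, 4, 1, 5, 8, 7, 10, 0], [((3, 5), [6])]), (3, [2, 3, 4, 6, 5, 0, 7,
    8, 10], [((1, 3), [1])]), (3, [3, 2, 4, 6, 5, 1, 7, 8, 10], [((1, 3), [0])]), (3, [0, 1,
    5, 7, 4, 2, 6, 9, 10], [((1, 3), [3])]), (3, [1, 0, 5, 7, 4, 3, 6, 9, 10], [((1, 3),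
    [2])]), (3, [1, 0, 5, 2, 4, 9, 6, 10, 3], [((3, 5), [7])]), (3, [0, 1, 5, 3, 4, 9, 6, 10,
    2], [((3, 5), [7])]), (3, [4, 6, 5, 7, 0, 2, 8, 9, 10], [((1, 3), [1, 3])]), (3, [3, 2, 6,
    0, 5, 8, 7, 10, 1], [((3, 5), [4])]), (3, [2, 3, 6, 1, 5, 8, 7, 10, 0], [((3, 5), [4])]),
    (2, [0, 3, 2, 5, 6, 10, 7], [((1, 4), [1])]), (2, [1, 2, 3, 5, 6, 10, 7], [((1, 4),
    [0])]), (7, [0, 4, 6, 8, 1, 10, 3, 7], [((0, 7), [2])]), (3, [5, 7, 6, 4, 2, 0, 9, 8, 10],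
    [((1, 3), [3, 1])]), (2, [2, 1, 0, 4, 7, 10, 6], [((1, 4), [3])]), (2, [3, 0, 1, 4, 7, 10,
    6], [((1, 4), [2])]), (3, [1, 0, 7, 2, 4, 9, 6, 10, 3], [((3, 5), [5])]), (3, [0, 1, 7, 3,
    4, 9, 6, 10, 2], [((3, 5), [5])]), (3, [4, 6, 7, 5, 0, 2, 8, 9, 10], [((1, 3), [1, 3])]),
    (7, [2, 5, 7, 9, 3, 10, 1, 6], [((0, 7), [0])]), (3, [6, 4, 7, 5, 0, 2, 8, 9, 10], [((1,
    3), [1, 3])]), (3, [2, 3, 8, 1, 5, 4, 7, 6, 10], [((0, 8), [0])]), (3, [2, 3, 8, 1, 5, 4,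
    7, 10, 6], [((0, 8), [0])]), (3, [2, 3, 8, 1, 5, 4, 7, 6, 10], []), (3, [3, 2, 8, 0, 5, 4,
    7, 6, 10], []), (5, [0, 1, 2, 3, 4, 5, 6, 7, 8, 10], []), (3, [5, 7, 8, 1, 2, 4, 9, 6,
    10], [((1, 3), [3])]), (5, [0, 1, 2, 3, 4, 5, 6, 7, 10, 8], []), (3, [7, 5, 8, 1, 2, 4, 9,
    6, 10], [((1, 3), [3])]), (3, [0, 1, 9, 3, 4, 5, 6, 7, 10], []), (3, [1, 0, 9, 2, 4, 5, 6,
    7, 10], []), (3, [0, 1, 9, 3, 4, 5, 6, 7, 10], [((0, 8), [2])]), (3, [0, 1, 9, 3, 4, 5, 6,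
    10, 7], [((0, 8), [2])]), (3, [4, 6, 9, 3, 0, 5, 8, 7, 10], [((1, 3), [1])]), (5, [2, 3,
    0, 1, 5, 4, 7, 6, 9, 10], []), (3, [6, 4, 9, 3, 0, 5, 8, 7, 10], [((1, 3), [1])]), (5, [2,
    3, 0, 1, 5, 4, 7, 6, 10, 9], []), (3, [8, 1, 9, 3, 4, 5, 6, 7, 10], [])]
  | 10 =>
    [(3, [0, 1, 2, 3, 4, 5, 6, 7, 9], []), (3, [3, 2, 4, 0, 5, 8, 7, 9, 1], [((3, 5), [6])]),
    (3, [3, 2, 6, 0, 5, 8, 7, 9, 1], [((3, 5), [4])]), (3, [1, 0, 3, 2, 4, 5, 6, 7, 9], []),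
    (3, [2, 3, 4, 1, 5, 8, 7, 9, 0], [((3, 5), [6])]), (3, [2, 3, 6, 1, 5, 8, 7, 9, 0], [((3,
    5), [4])]), (4, [2, 0, 1, 3, 4, 9, 6, 5, 7], []), (4, [2, 0, 1, 3, 4, 9, 6, 7, 5], []),
    (4, [2, 0, 1, 3, 4, 5, 6, 9, 7], []), (4, [2, 0, 1, 3, 4, 7, 6, 9, 5], []), (5, [0, 1, 2,
    3, 4, 5, 6, 7, 8, 9], []), (5, [0, 1, 2, 3, 4, 5, 6, 7, 9, 8], []), (6, [3, 0, 1, 4, 7, 6,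
    9], [((1, 4), [2])]), (3, [0, 1, 2, 3, 4, 5, 6, 7, 9], []), (2, [5, 1, 2, 6, 3, 7, 9],
    [((2, 3), [0])]), (2, [5, 0, 3, 6, 2, 7, 9], [((2, 3), [1])]), (3, [1, 0, 3, 2, 4, 5, 6,
    7, 9], []), (6, [1, 2, 3, 5, 6, 7, 9], [((1, 4), [0])]), (3, [3, 2, 4, 0, 5, 8, 7, 9, 1],
    [((3, 5), [6])]), (3, [2, 3, 4, 1, 5, 8, 7, 9, 0], [((3, 5), [6])]), (3, [2, 3, 4, 6, 5,
    0, 7, 8, 9], [((1, 3), [1])]), (3, [3, 2, 4, 6, 5, 1, 7, 8, 9], [((1, 3), [0])]), (2, [4,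
    3, 0, 7, 1, 6, 9], [((1, 6), [5]), ((2, 3), [2])]), (2, [3, 0, 1, 4, 5, 9, 6], [((1, 4),
    [2])]), (4, [2, 0, 1, 3, 4, 9, 6, 5, 7], []), (4, [2, 0, 1, 3, 4, 5, 6, 9, 7], []), (0,
    [4, 6, 5, 2, 1, 3, 8], [((0, 2), [9]), ((1, 3), [0]), ((3, 5), [7])]), (3, [3, 2, 6, 0, 5,
    8, 7, 9, 1], [((3, 5), [4])]), (3, [2, 3, 6, 1, 5, 8, 7, 9, 0], [((3, 5), [4])]), (2, [0,
    3, 2, 5, 6, 9, 7], [((1, 4), [1])]), (2, [1, 2, 3, 5, 6, 9, 7], [((1, 4), [0])]), (7, [0,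
    4, 6, 8, 1, 9, 3, 7], [((0, 7), [2])]), (0, [4, 6, 2, 5, 1, 3, 8], [((0, 2), [0]), ((1,
    3), [9]), ((2, 5), [7])]), (2, [2, 1, 0, 4, 7, 9, 6], [((1, 4), [3])]), (2, [3, 0, 1, 4,
    7, 9, 6], [((1, 4), [2])]), (4, [2, 0, 1, 3, 4, 9, 6, 7, 5], []), (4, [2, 0, 1, 3, 4, 7,
    6, 9, 5], []), (0, [4, 6, 7, 2, 1, 3, 8], [((0, 2), [9]), ((1, 3), [0]), ((3, 5), [5])]),
    (9, [0, 1, 2, 3, 4, 5, 6, 7, 8, 9], []), (0, [4, 6, 2, 7, 1, 3, 8], [((0, 2), [0]), ((1,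
    3), [9]), ((2, 5), [5])]), (3, [2, 3, 8, 1, 5, 4, 7, 6, 9], [((0, 8), [0])]), (3, [2, 3,
    8, 1, 5, 4, 7, 9, 6], [((0, 8), [0])]), (3, [2, 3, 8, 1, 5, 4, 7, 6, 9], []), (3, [3, 2,
    8, 0, 5, 4, 7, 6, 9], []), (5, [0, 1, 2, 3, 4, 5, 6, 7, 8, 9], []), (0, [2, 3, 6, 1, 5, 8,
    7], [((0, 2), [0]), ((3, 5), [4]), ((4, 5), [9])]), (5, [0, 1, 2, 3, 4, 5, 6, 7, 9, 8],
    []), (0, [2, 3, 6, 1, 7, 8, 5], [((0, 2), [0]), ((3, 5), [4]), ((4, 5), [9])])]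
  | 11 =>
    [(3, [0, 1, 2, 3, 4, 5, 6, 7, 8], []), (4, [0, 2, 3, 1, 5, 8, 7, 4, 6], []), (4, [0, 2, 3,
    1, 5, 8, 7, 6, 4], []), (3, [1, 0, 3, 2, 4, 5, 6, 7, 8], []), (4, [0, 2, 3, 1, 5, 4, 7, 8,
    6], []), (4, [0, 2, 3, 1, 5, 6, 7, 8, 4], []), (4, [2, 0, 1, 3, 4, 8, 6, 5, 7], []), (4,
    [2, 0, 1, 3, 4, 8, 6, 7, 5], []), (4, [2, 0, 1, 3, 4, 5, 6, 8, 7], []), (4, [2, 0, 1, 3,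
    4, 7, 6, 8, 5], []), (6, [3, 0, 1, 4, 7, 6, 8], [((1, 4), [2])]), (3, [0, 1, 2, 3, 4, 5,
    6, 7, 8], []), (2, [5, 1, 2, 6, 3, 7, 8], [((2, 3), [0])]), (2, [5, 0, 3, 6, 2, 7, 8],
    [((2, 3), [1])]), (3, [1, 0, 3, 2, 4, 5, 6, 7, 8], []), (6, [1, 2, 3, 5, 6, 7, 8], [((1,
    4), [0])]), (4, [0, 2, 3, 1, 5, 8, 7, 4, 6], []), (4, [0, 2, 3, 1, 5, 4, 7, 8, 6], []),
    (2, [5, 1, 2, 6, 3, 7, 8], [((1, 6), [4]), ((2, 3), [0])]), (2, [1, 2, 3, 5, 4, 8, 7],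
    [((1, 4), [0])]), (2, [4, 3, 0, 7, 1, 6, 8], [((1, 6), [5]), ((2, 3), [2])]), (2, [3, 0,
    1, 4, 5, 8, 6], [((1, 4), [2])]), (4, [2, 0, 1, 3, 4, 8, 6, 5, 7], []), (4, [2, 0, 1, 3,
    4, 5, 6, 8, 7], []), (0, [2, 3, 0, 1, 5, 4, 7], [((2, 3), [6]), ((4, 5), [8])]), (4, [0,
    2, 3, 1, 5, 8, 7, 6, 4], []), (4, [0, 2, 3, 1, 5, 6, 7, 8, 4], []), (2, [0, 3, 2, 5, 6, 8,
    7], [((1, 4), [1])]), (2, [1, 2, 3, 5, 6, 8, 7], [((1, 4), [0])]), (10, [0, 1, 2, 3, 4, 5,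
    6, 7, 8], []), (0, [2, 3, 0, 1, 5, 6, 7], [((2, 3), [4]), ((4, 5), [8])]), (2, [2, 1, 0,
    4, 7, 8, 6], [((1, 4), [3])]), (2, [3, 0, 1, 4, 7, 8, 6], [((1, 4), [2])]), (4, [2, 0, 1,
    3, 4, 8, 6, 7, 5], []), (4, [2, 0, 1, 3, 4, 7, 6, 8, 5], []), (0, [0, 1, 2, 3, 4, 7, 6],
    [((2, 3), [5]), ((4, 5), [8])]), (10, [2, 3, 0, 1, 5, 4, 7, 6, 8], []), (0, [2, 3, 0, 1,
    7, 6, 5], [((2, 3), [4]), ((4, 5), [8])])]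
  | 12 =>
    [(6, [0, 1, 2, 3, 8, 4, 5], []), (6, [0, 2, 1, 3, 8, 4, 5], []), (7, [0, 1, 2, 3, 4, 5, 6,
    8], []), (6, [3, 1, 2, 0, 8, 4, 5], []), (6, [4, 1, 2, 0, 8, 3, 5], []), (6, [5, 1, 2, 0,
    8, 3, 4], []), (6, [3, 2, 1, 0, 8, 4, 5], []), (6, [4, 2, 1, 0, 8, 3, 5], []), (6, [5, 2,
    1, 0, 8, 3, 4], []), (7, [3, 1, 2, 0, 5, 4, 7, 8], []), (7, [0, 1, 2, 3, 4, 5, 8, 6], []),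
    (7, [3, 1, 2, 0, 5, 4, 8, 7], []), (6, [0, 1, 2, 3, 8, 4, 5], []), (6, [0, 2, 1, 3, 8, 4,
    5], []), (6, [4, 2, 1, 3, 6, 5, 8], [((1, 4), [0])]), (0, [3, 5, 0, 2, 1, 4, 7], [((0, 2),
    [8]), ((2, 5), [6])]), (6, [3, 1, 2, 0, 8, 4, 5], []), (6, [3, 2, 1, 0, 8, 4, 5], []),
    (11, [0, 4, 2, 1, 6, 3, 8, 5], []), (6, [4, 1, 2, 0, 8, 3, 5], []), (6, [4, 2, 1, 0, 8, 3,
    5], []), (0, [3, 5, 4, 1, 2, 0, 7], [((0, 2), [8]), ((2, 5), [6])]), (0, [3, 5, 2, 0, 1,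
    4, 7], [((1, 3), [8]), ((3, 5), [6])]), (6, [5, 1, 2, 0, 8, 3, 4], []), (6, [5, 2, 1, 0,
    8, 3, 4], []), (11, [1, 2, 5, 3, 0, 7, 4, 8], []), (0, [3, 5, 2, 4, 1, 0, 7], [((1, 3),
    [8]), ((3, 5), [6])]), (7, [0, 1, 2, 3, 4, 5, 6, 8], []), (2, [0, 1, 2, 3, 6, 4, 5], [((1,
    4), [8])]), (2, [0, 1, 2, 3, 6, 8, 5], [((1, 4), [4])]), (7, [3, 1, 2, 0, 4, 5, 6, 8],
    []), (7, [0, 1, 2, 3, 4, 5, 8, 6], []), (7, [4, 1, 2, 0, 5, 3, 8, 6], []), (7, [0, 1, 2,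
    3, 5, 4, 7, 8], []), (2, [0, 7, 2, 3, 1, 4, 5], [((1, 4), [8])]), (2, [0, 7, 2, 3, 1, 4,
    8], [((1, 4), [5])]), (7, [3, 1, 2, 0, 5, 4, 7, 8], []), (7, [4, 1, 2, 0, 5, 3, 7, 8],
    []), (7, [3, 1, 2, 0, 5, 4, 8, 7], []), (2, [0, 7, 2, 3, 6, 4, 5], [((1, 4), [8])])]
  | 13 =>
    [(6, [0, 1, 2, 3, 7, 4, 5], []), (6, [0, 2, 1, 3, 7, 4, 5], []), (7, [0, 1, 2, 3, 4, 5, 6,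
    7], []), (2, [0, 3, 1, 5, 2, 4, 7], []), (6, [4, 1, 2, 0, 7, 3, 5], []), (2, [0, 5, 1, 3,
    2, 4, 7], []), (2, [0, 3, 2, 5, 1, 4, 7], []), (6, [4, 2, 1, 0, 7, 3, 5], []), (2, [0, 5,
    2, 3, 1, 4, 7], []), (12, [0, 1, 2, 3, 4, 5, 6, 7], []), (7, [0, 1, 2, 3, 4, 5, 7, 6],
    []), (6, [0, 1, 2, 3, 7, 4, 5], []), (6, [0, 2, 1, 3, 7, 4, 5], []), (6, [4, 2, 1, 3, 6,
    5, 7], [((1, 4), [0])]), (0, [0, 4, 3, 1, 2, 5, 6], [((0, 2), [7])]), (2, [0, 3, 1, 5, 2,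
    4, 7], []), (2, [0, 3, 2, 5, 1, 4, 7], []), (7, [1, 0, 4, 6, 2, 7, 3, 5], []), (6, [4, 1,
    2, 0, 7, 3, 5], []), (6, [4, 2, 1, 0, 7, 3, 5], []), (0, [0, 4, 2, 3, 1, 5, 6], [((1, 3),
    [7])]), (0, [0, 4, 5, 1, 2, 3, 6], [((0, 2), [7])]), (2, [0, 5, 1, 3, 2, 4, 7], []), (2,
    [0, 5, 2, 3, 1, 4, 7], []), (12, [0, 1, 2, 3, 4, 5, 6, 7], []), (0, [0, 4, 1, 5, 2, 3, 6],
    [((1, 3), [7])]), (7, [0, 1, 2, 3, 4, 5, 6, 7], []), (2, [0, 1, 2, 3, 6, 4, 5], [((1, 4),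
    [7])]), (2, [0, 1, 2, 3, 6, 7, 5], [((1, 4), [4])]), (7, [3, 1, 2, 0, 4, 5, 6, 7], []),
    (7, [0, 1, 2, 3, 4, 5, 7, 6], []), (7, [4, 1, 2, 0, 5, 3, 7, 6], [])]
  | _ =>
    [(2, [3, 0, 1, 4, 2, 5, 6], []), (2, [3, 0, 2, 4, 1, 5, 6], []), (13, [0, 1, 2, 3, 4, 5,
    6], []), (2, [0, 3, 1, 5, 2, 4, 6], []), (2, [0, 2, 1, 3, 4, 6, 5], []), (2, [0, 5, 1, 3,
    2, 4, 6], []), (2, [0, 3, 2, 5, 1, 4, 6], []), (2, [0, 1, 2, 3, 4, 6, 5], []), (2, [0, 5,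
    2, 3, 1, 4, 6], []), (13, [3, 1, 2, 0, 5, 4, 6], []), (2, [3, 0, 1, 4, 2, 5, 6], []), (2,
    [3, 0, 2, 4, 1, 5, 6], []), (6, [0, 1, 2, 3, 4, 5, 6], []), (1, [0, 2, 3, 5, 4, 1, 6],
    []), (2, [0, 3, 1, 5, 2, 4, 6], []), (2, [0, 3, 2, 5, 1, 4, 6], []), (13, [0, 1, 2, 3, 4,
    5, 6], []), (2, [0, 2, 1, 3, 4, 6, 5], []), (2, [0, 1, 2, 3, 4, 6, 5], []), (1, [3, 2, 4,
    0, 5, 1, 6], []), (1, [0, 2, 5, 3, 4, 1, 6], []), (2, [0, 5, 1, 3, 2, 4, 6], []), (2, [0,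
    5, 2, 3, 1, 4, 6], []), (13, [3, 1, 2, 0, 5, 4, 6], []), (1, [4, 0, 5, 1, 2, 3, 6], [])]

theorem isLabelGraph_smallGraph :
    ∀ k < 15, IsLabelGraph (smallGraph k).1 (smallGraph k).2 := by decide +kernel

theorem isPathTable_smallGraph :
    ∀ k < 8, IsPathTable (smallGraph k).1 (smallGraph k).2 (pathTable k) := by decide +kernel

theorem isInfeasible_smallGraph :
    ∀ k < 8, IsInfeasible (smallGraph k).1 (smallGraph k).2 (pathTable k) (shorterPaths k) := by
  decide +kernel

theorem not_contains_obstruction [Finite V] (hG : G.Connected) (hm : G.Metrizable) {k : ℕ}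
    (hk : k < 8) : ¬ ContainsSubdivision G (smallGraph k).1 (smallGraph k).2 := fun h =>
  h.not_metrizable hG (isLabelGraph_smallGraph k (by omega)) (by interval_cases k <;> decide)
    (nonmetrizableOn_of_table (isPathTable_smallGraph k hk) (isInfeasible_smallGraph k hk)) hm

/-- The extensions of a small graph contain subdivisions of small graphs with smaller numbers. -/
theorem forall₂_embeddings : ∀ k < 15, 8 ≤ k →
    List.Forall₂ (fun E c => c.1 < k ∧ IsSubdivisionIn (smallGraph c.1).1 (smallGraph c.1).2
      ((smallGraph k).1 + 1) E c.2.1 c.2.2)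
      (extensions (smallGraph k).1 (smallGraph k).2) (embeddings k) := by
  decide +kernel

/-- The small graphs all have at most 10 vertices, so in a graph with at least 11 vertices one of
them that is not known to be nonmetrizable can be extended, which leads to an earlier small graph. -/
theorem not_contains_smallGraph [Fintype V] (hcard : 11 ≤ Fintype.card V) (hG : G.TwoConnected)
    (hm : G.Metrizable) (k : ℕ) (hk : k < 15) :
    ¬ ContainsSubdivision G (smallGraph k).1 (smallGraph k).2 := by
  induction k using Nat.strong_induction_on with
  | _ k ih =>
    by_cases h8 : k < 8
    · exact not_contains_obstruction hG.2.1 hm h8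
    intro h
    obtain ⟨E, hE, hc⟩ := h.exists_extension hG (isLabelGraph_smallGraph k hk)
      (by interval_cases k <;> decide)
      (lt_of_lt_of_le (by interval_cases k <;> decide) hcard)
    obtain ⟨i, hi, rfl⟩ := List.mem_iff_getElem.1 hE
    have hF := forall₂_embeddings k hk (by omega)
    have hi' : i < (embeddings k).length := hF.length_eq ▸ hi
    obtain ⟨h1, h2⟩ := hF.get hi hi'
    exact ih _ h1 (h1.trans hk) (hc.trans h2)

/-! ### Linked pairs of cycles and ears -/

/-- A subdivision given by the list of its branch vertices and the list of the interiors of its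
paths, in the order of the edges. -/
theorem containsSubdivision_of_lists {n : ℕ} {E : List (ℕ × ℕ)} (hE : E.Nodup) {B : List V}
    (hB : B.length = n) (d : V) {Ls : List (List V)}
    (h : List.Forall₂ (fun e l => Link G (B.getD e.1 d) l (B.getD e.2 d)) E Ls)
    (hnd : (B ++ Ls.flatten).Nodup) : ContainsSubdivision G n E := by
  classical
  have key : ∀ {E : List (ℕ × ℕ)} {Ls : List (List V)}, E.Nodup → E.length = Ls.length →
      ∃ W : ℕ × ℕ → List V, E.map W = Ls := by
    intro E
    induction E with
    | nil =>
      intro Ls _ hl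
      exact ⟨fun _ => [], by simpa using (List.length_eq_zero_iff.1 hl.symm).symm⟩
    | cons e E ih =>
      intro Ls hnd hl
      cases Ls with
      | nil => simp at hl
      | cons l Ls =>
        obtain ⟨W, hW⟩ := ih (List.nodup_cons.1 hnd).2 (by simpa using hl)
        refine ⟨Function.update W e l, ?_⟩
        rw [List.map_cons, Function.update_self, ← hW]
        congr 1
        refine List.map_congr_left fun a ha => ?_
        rw [Function.update_of_ne]
        rintro rfl
        exact (List.nodup_cons.1 hnd).1 ha
  obtain ⟨W, rfl⟩ := key hE h.length_eq
  rw [List.forall₂_map_right_iff, List.forall₂_same] at h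
  refine ⟨fun i => B.getD i d, W, h, ?_⟩
  have : (List.range n).map (fun i => B.getD i d) = B := by
    subst hB
    refine List.ext_getElem (by simp) fun i h1 h2 => ?_
    simp [List.getD_eq_getElem?_getD, h2]
  rwa [this, List.flatMap_def]

open Classical in
/-- The number of occurrences of `v` in the one-element list `[x]`. -/
noncomputable def hit (v x : V) : ℕ := if x = v then 1 else 0

open Classical in
theorem count_cons_hit (v x : V) (l : List V) : (x :: l).count v = hit v x + l.count v := by
  rw [List.count_cons, hit, add_comm]
  simp

/-- The graph contains no subdivision of any of the small graphs. -/
def NoSmallGraph (G : SimpleGraph V) : Prop :=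
  ∀ k < 15, ¬ ContainsSubdivision G (smallGraph k).1 (smallGraph k).2

/-- A subdivision of the triangular prism, with the triangles `x₁x₂x₃` and `y₁y₂y₃`, does not occur. -/
theorem NoSmallGraph.no_prism (hG : NoSmallGraph G) {x₁ x₂ x₃ y₁ y₂ y₃ : V}
    {A₁₂ A₁₃ A₂₃ B₁₂ B₁₃ B₂₃ C₁ C₂ C₃ : List V}
    (a₁₂ : Link G x₁ A₁₂ x₂) (a₁₃ : Link G x₁ A₁₃ x₃) (a₂₃ : Link G x₂ A₂₃ x₃)
    (b₁₂ : Link G y₁ B₁₂ y₂) (b₁₃ : Link G y₁ B₁₃ y₃) (b₂₃ : Link G y₂ B₂₃ y₃)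
    (c₁ : Link G x₁ C₁ y₁) (c₂ : Link G x₂ C₂ y₂) (c₃ : Link G x₃ C₃ y₃)
    (hnd : ([x₁, x₂, x₃, y₁, y₂, y₃] ++ A₁₂ ++ A₁₃ ++ A₂₃ ++ B₁₂ ++ B₁₃ ++ B₂₃ ++ C₁ ++ C₂ ++
      C₃).Nodup) : False := by
  classical
  refine hG 8 (by norm_num) (containsSubdivision_of_lists
    (isLabelGraph_smallGraph 8 (by norm_num)).1 (B := [x₁, x₂, y₁, y₂, x₃, y₃]) rfl x₁
    (Ls := [A₁₂, C₁, A₁₃, C₂, A₂₃, B₁₂, B₁₃, B₂₃, C₃]) ?_ ?_)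
  · simp [smallGraph, *]
  · refine List.nodup_iff_count_le_one.2 fun v => ?_
    have := List.nodup_iff_count_le_one.1 hnd v
    simp only [List.count_append, count_cons_hit, List.count_nil, List.flatten_cons,
      List.flatten_nil] at this ⊢
    omega

/-- Two cycles with one common vertex `a`, joined by a path between vertices `b` and `c` that are
not adjacent to `a` on the cycles, do not occur. -/
theorem NoSmallGraph.no_sharedVertex (hG : NoSmallGraph G) {a b c : V}
    {A₁ A₂ B₁ B₂ L : List V} (hA₁ : A₁ ≠ []) (hA₂ : A₂ ≠ []) (hB₁ : B₁ ≠ []) (hB₂ : B₂ ≠ [])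
    (a₁ : Link G a A₁ b) (a₂ : Link G a A₂ b) (b₁ : Link G a B₁ c) (b₂ : Link G a B₂ c)
    (l : Link G b L c)
    (hnd : ([a, b, c] ++ A₁ ++ A₂ ++ B₁ ++ B₂ ++ L).Nodup) : False := by
  classical
  obtain ⟨p, A₁, rfl⟩ := List.exists_cons_of_ne_nil hA₁
  obtain ⟨q, A₂, rfl⟩ := List.exists_cons_of_ne_nil hA₂
  obtain ⟨r, B₁, rfl⟩ := List.exists_cons_of_ne_nil hB₁
  obtain ⟨s, B₂, rfl⟩ := List.exists_cons_of_ne_nil hB₂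
  rw [link_cons] at a₁ a₂ b₁ b₂
  refine hG 2 (by norm_num) (containsSubdivision_of_lists
    (isLabelGraph_smallGraph 2 (by norm_num)).1 (B := [p, c, a, r, b, q, s]) rfl a
    (Ls := [[], A₁, B₁.reverse, L.reverse, B₂.reverse, [], [], [], A₂.reverse]) ?_ ?_)
  · simp [smallGraph, link_reverse, a₁.1.symm, a₁.2, a₂, b₁, b₂, l]
  · refine List.nodup_iff_count_le_one.2 fun v => ?_
    have := List.nodup_iff_count_le_one.1 hnd v
    simp only [List.count_append, count_cons_hit, List.count_nil, List.flatten_cons,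
      List.flatten_nil, List.count_reverse] at this ⊢
    omega

/-- Two pairs of adjacent vertices, `x`, `y` and `x'`, `y'`, all of them adjacent to both `u` and
`v`, do not occur, not even after subdivision. -/
theorem NoSmallGraph.no_twoPairs (hG : NoSmallGraph G) {u v x y x' y' : V}
    {L L' U₁ U₂ U₃ U₄ V₁ V₂ V₃ V₄ : List V} (l : Link G x L y) (l' : Link G x' L' y')
    (u₁ : Link G x U₁ u) (u₂ : Link G y U₂ u) (u₃ : Link G x' U₃ u) (u₄ : Link G y' U₄ u)
    (v₁ : Link G x V₁ v) (v₂ : Link G y V₂ v) (v₃ : Link G x' V₃ v) (v₄ : Link G y' V₄ v)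
    (hnd : ([u, v, x, y, x', y'] ++ L ++ L' ++ U₁ ++ U₂ ++ U₃ ++ U₄ ++ V₁ ++ V₂ ++ V₃ ++
      V₄).Nodup) : False := by
  classical
  refine hG 14 (by norm_num) (containsSubdivision_of_lists
    (isLabelGraph_smallGraph 14 (by norm_num)).1 (B := [x, u, v, x', y, y']) rfl x
    (Ls := [U₁, V₁, L, U₃.reverse, U₂.reverse, U₄.reverse, V₃.reverse, V₂.reverse, V₄.reverse,
      L']) ?_ ?_)
  · simp [smallGraph, link_reverse, *]
  · refine List.nodup_iff_count_le_one.2 fun v => ?_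
    have := List.nodup_iff_count_le_one.1 hnd v
    simp only [List.count_append, count_cons_hit, List.count_nil, List.flatten_cons,
      List.flatten_nil, List.count_reverse] at this ⊢
    omega

/-- Two disjoint cycles joined by two disjoint paths: the first cycle consists of the paths `P₁`
and `Q₁` from `a₁` to `b₁`, the second one of the paths `P₂` and `Q₂` from `a₂` to `b₂`, and `L₁`
and `L₂` join `a₁` to `a₂` and `b₁` to `b₂`. The lists contain the interior vertices; those named
`P` may be empty. -/
structure IsLinkedPair (G : SimpleGraph V) (a₁ b₁ a₂ b₂ : V) (P₁ Q₁ P₂ Q₂ L₁ L₂ : List V) :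
    Prop where
  linkP₁ : Link G a₁ P₁ b₁
  linkQ₁ : Link G a₁ Q₁ b₁
  linkP₂ : Link G a₂ P₂ b₂
  linkQ₂ : Link G a₂ Q₂ b₂
  linkL₁ : Link G a₁ L₁ a₂
  linkL₂ : Link G b₁ L₂ b₂
  ne₁ : Q₁ ≠ []
  ne₂ : Q₂ ≠ []
  nodup : ([a₁, b₁, a₂, b₂] ++ P₁ ++ Q₁ ++ P₂ ++ Q₂ ++ L₁ ++ L₂).Nodup

/-- In a linked pair of cycles, one of the cycles has an edge between the ends of the joining
paths. -/
theorem NoSmallGraph.linkedPair_eq_nil (hG : NoSmallGraph G) {a₁ b₁ a₂ b₂ : V}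
    {P₁ Q₁ P₂ Q₂ L₁ L₂ : List V} (h : IsLinkedPair G a₁ b₁ a₂ b₂ P₁ Q₁ P₂ Q₂ L₁ L₂) :
    P₁ = [] ∨ P₂ = [] := by
  classical
  by_contra hcon
  push Not at hcon
  obtain ⟨h1, h2, h3, h4, h5, h6, h7, h8, hnd⟩ := h
  obtain ⟨p, P₁, rfl⟩ := List.exists_cons_of_ne_nil hcon.1
  obtain ⟨q, Q₁, rfl⟩ := List.exists_cons_of_ne_nil h7
  obtain ⟨r, P₂, rfl⟩ := List.exists_cons_of_ne_nil hcon.2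
  obtain ⟨s, Q₂, rfl⟩ := List.exists_cons_of_ne_nil h8
  rw [link_cons] at h1 h2 h3 h4
  refine hG 11 (by norm_num) (containsSubdivision_of_lists
    (isLabelGraph_smallGraph 11 (by norm_num)).1 (B := [a₁, b₁, a₂, b₂, p, s, q, r]) rfl a₁
    (Ls := [L₁, [], [], L₂, P₁.reverse, Q₁.reverse, [], [], Q₂.reverse, P₂.reverse]) ?_ ?_)
  · simp [smallGraph, link_reverse, *]
  · refine List.nodup_iff_count_le_one.2 fun v => ?_
    have := List.nodup_iff_count_le_one.1 hnd v
    simp only [List.count_append, count_cons_hit, List.count_nil, List.flatten_cons,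
      List.flatten_nil, List.count_reverse] at this ⊢
    omega

namespace IsLinkedPair

variable {a₁ b₁ a₂ b₂ : V} {P₁ Q₁ P₂ Q₂ L₁ L₂ : List V}

/-- Exchange the two joining paths. -/
theorem swapEnds (h : IsLinkedPair G a₁ b₁ a₂ b₂ P₁ Q₁ P₂ Q₂ L₁ L₂) :
    IsLinkedPair G b₁ a₁ b₂ a₂ P₁.reverse Q₁.reverse P₂.reverse Q₂.reverse L₂ L₁ := by
  classical
  refine ⟨h.linkP₁.symm, h.linkQ₁.symm, h.linkP₂.symm, h.linkQ₂.symm, h.linkL₂, h.linkL₁,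
    by simpa using h.ne₁, by simpa using h.ne₂, ?_⟩
  refine List.nodup_iff_count_le_one.2 fun v => ?_
  have := List.nodup_iff_count_le_one.1 h.nodup v
  simp only [List.count_append, count_cons_hit, List.count_nil, List.count_reverse] at this ⊢
  omega

/-- Exchange the two cycles. -/
theorem swapCycles (h : IsLinkedPair G a₁ b₁ a₂ b₂ P₁ Q₁ P₂ Q₂ L₁ L₂) :
    IsLinkedPair G a₂ b₂ a₁ b₁ P₂ Q₂ P₁ Q₁ L₁.reverse L₂.reverse := by
  classical
  refine ⟨h.linkP₂, h.linkQ₂, h.linkP₁, h.linkQ₁, h.linkL₁.symm, h.linkL₂.symm, h.ne₂, h.ne₁, ?_⟩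
  refine List.nodup_iff_count_le_one.2 fun v => ?_
  have := List.nodup_iff_count_le_one.1 h.nodup v
  simp only [List.count_append, count_cons_hit, List.count_nil, List.count_reverse] at this ⊢
  omega

end IsLinkedPair

/-- If `ab` is an edge and `a, Q, b` a path of length at least two inside a set `S`, then, as the
edge is not compliant, there is an ear that starts at an interior vertex `z` of the path, ends in
another vertex `t` of `S` and has its interior outside `S`; it is not an edge of the path. -/
theorem exists_ear [Fintype V] [DecidableRel G.Adj] (hG : G.TwoConnected)
    (hcompl : ∀ x y : V, ¬ G.IsCompliantEdge x y) {a b : V} {Q : List V} (hab : G.Adj a b)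
    (hQ : Link G a Q b) (hne : Q ≠ []) (hnd : (a :: (Q ++ [b])).Nodup) {S : Set V}
    (hS : ∀ v ∈ a :: (Q ++ [b]), v ∈ S) :
    ∃ Q' z Q'' t E, Q = Q' ++ z :: Q'' ∧ t ∈ S ∧ t ≠ z ∧ Link G z E t ∧ E.Nodup ∧
      (∀ v ∈ E, v ∉ S) ∧ (E = [] → (∀ X, a :: Q' ≠ X ++ [t]) ∧ ∀ X, Q'' ++ [b] ≠ t :: X) := by
  classical
  obtain ⟨p, hp⟩ : ∃ p : G.Walk a b, p.support = a :: (Q ++ [b]) := by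
    clear hne hnd hS hab
    induction Q generalizing a with
    | nil => exact ⟨.cons hQ .nil, rfl⟩
    | cons c Q ih =>
      obtain ⟨p, hp⟩ := ih hQ.2
      exact ⟨.cons hQ.1 p, by simp [hp]⟩
  have hflat : ¬ G.IsFlatPath p := fun h => hcompl a b ⟨hab, p, h⟩
  have hlen : 2 ≤ p.length := by
    have h1 := p.length_support
    have h2 := List.length_pos_iff.2 hne
    rw [hp] at h1
    simp at h1
    omega
  obtain ⟨z, hz, hza, hzb, hdeg⟩ : ∃ z ∈ p.support, z ≠ a ∧ z ≠ b ∧ G.degree z ≠ 2 := by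
    by_contra hcon
    push Not at hcon
    exact hflat ⟨by rw [SimpleGraph.Walk.isPath_def, hp]; exact hnd, hlen, hcon⟩
  have hzQ : z ∈ Q := by
    rw [hp] at hz
    simpa [hza, hzb] using hz
  obtain ⟨Q', Q'', rfl⟩ := List.append_of_mem hzQ
  obtain ⟨X, c, hX⟩ : ∃ X c, a :: Q' = X ++ [c] :=
    ⟨_, _, (List.dropLast_append_getLast (List.cons_ne_nil a Q')).symm⟩
  obtain ⟨d, Y, hY⟩ : ∃ d Y, Q'' ++ [b] = d :: Y :=
    List.exists_cons_of_ne_nil (by simp)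
  rw [link_append_cons] at hQ
  have hcz : G.Adj z c := by
    have h1 : Link G z Q'.reverse a := hQ.1.symm
    have h2 : Q'.reverse ++ [a] = c :: X.reverse := by
      have := congrArg List.reverse hX
      simpa using this
    cases hr : Q'.reverse with
    | nil => rw [hr] at h1 h2; rw [← (List.cons.inj h2).1]; exact h1
    | cons e R => rw [hr] at h1 h2; rw [← (List.cons.inj h2).1]; exact h1.1
  have hdz : G.Adj z d := by
    cases Q'' with
    | nil => rw [← (List.cons.inj hY).1]; exact hQ.2
    | cons e R => rw [← (List.cons.inj hY).1]; exact hQ.2.1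
  have hcd : c ≠ d := by
    rintro rfl
    have h1 : a :: ((Q' ++ z :: Q'') ++ [b]) = (X ++ [c]) ++ z :: (c :: Y) := by
      rw [← hX, ← hY]; simp
    rw [h1] at hnd
    exact List.disjoint_of_nodup_append hnd (a := c) (by simp) (by simp)
  obtain ⟨y, hzy, hyc, hyd⟩ : ∃ y, G.Adj z y ∧ y ≠ c ∧ y ≠ d := by
    by_contra hcon
    push Not at hcon
    apply hdeg
    have : G.neighborFinset z = {c, d} := by
      ext y
      simp only [SimpleGraph.mem_neighborFinset, Finset.mem_insert, Finset.mem_singleton]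
      constructor
      · intro h
        by_cases hyc : y = c
        · exact Or.inl hyc
        · exact Or.inr (hcon y h hyc)
      · rintro (rfl | rfl) <;> assumption
    rw [← SimpleGraph.card_neighborFinset_eq_degree, this, Finset.card_pair hcd]
  by_cases hyS : y ∈ S
  · refine ⟨Q', z, Q'', y, [], rfl, hyS, hzy.ne', hzy, by simp, by simp, fun _ => ⟨?_, ?_⟩⟩
    · intro X' hX'
      rw [hX] at hX'
      exact hyc (by simpa using (List.append_inj' hX' rfl).2.symm)
    · intro X' hX'
      rw [hY] at hX'
      exact hyd (List.cons.inj hX').1.symm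
  · obtain ⟨x, rfl, -, t, htS, htz, l, h1, h2, h3⟩ := exists_link_avoiding (hG.2.2 z)
      (A := {y}) (B := S) (Set.disjoint_singleton_left.2 hyS) (a := y) (b := a) rfl hzy.ne'
      (hS a (by simp)) (Ne.symm hza)
    refine ⟨Q', z, Q'', t, x :: l, rfl, htS, htz, ⟨hzy, h1⟩,
      List.nodup_cons.2 ⟨fun hx => (h3 x hx).1 rfl, h2⟩, ?_, by simp⟩
    intro v hv
    rcases List.mem_cons.1 hv with rfl | hv
    · exact hyS
    · exact (h3 v hv).2.1

/-! ### Linked pairs do not occur -/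

theorem nodup_length_le_card [Fintype V] {l l' : List V} (h : l'.Nodup) (hl : l.Sublist l') :
    l.length ≤ Fintype.card V :=
  (h.sublist hl).length_le_card

theorem exists_greatest {p : ℕ → Prop} (h : ∃ n, p n) {b : ℕ} (hb : ∀ n, p n → n ≤ b) :
    ∃ n, p n ∧ ∀ m, p m → m ≤ n := by
  classical
  obtain ⟨n, hn⟩ := h
  exact ⟨Nat.findGreatest p b, Nat.findGreatest_spec (hb n hn) hn,
    fun m hm => Nat.le_findGreatest (hb m hm) hm⟩

/-- `N` is the number of interior vertices of the joining paths of some linked pair of cycles, in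
which moreover both arcs of the second cycle have interior vertices if `need` holds. -/
def IsLinkLength (G : SimpleGraph V) (need : Prop) (N : ℕ) : Prop :=
  ∃ a₁ b₁ a₂ b₂ P₁ Q₁ P₂ Q₂ L₁ L₂, IsLinkedPair G a₁ b₁ a₂ b₂ P₁ Q₁ P₂ Q₂ L₁ L₂ ∧
    (need → P₂ ≠ []) ∧ L₁.length + L₂.length = N

/-- A linked pair may be given with the two arcs of the first cycle in any order. -/
theorem isLinkLength_of_links {need : Prop} {a₁ b₁ a₂ b₂ : V} {P₁ Q₁ P₂ Q₂ L₁ L₂ : List V}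
    (p₁ : Link G a₁ P₁ b₁) (q₁ : Link G a₁ Q₁ b₁) (p₂ : Link G a₂ P₂ b₂) (q₂ : Link G a₂ Q₂ b₂)
    (l₁ : Link G a₁ L₁ a₂) (l₂ : Link G b₁ L₂ b₂) (hne₁ : P₁ = [] → Q₁ ≠ []) (hne₂ : Q₂ ≠ [])
    (hneed : need → P₂ ≠ [])
    (hnd : ([a₁, b₁, a₂, b₂] ++ P₁ ++ Q₁ ++ P₂ ++ Q₂ ++ L₁ ++ L₂).Nodup) :
    IsLinkLength G need (L₁.length + L₂.length) := by
  classical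
  by_cases h : Q₁ = []
  · refine ⟨a₁, b₁, a₂, b₂, Q₁, P₁, P₂, Q₂, L₁, L₂,
      ⟨q₁, p₁, p₂, q₂, l₁, l₂, fun h' => hne₁ h' h, hne₂, ?_⟩, hneed, rfl⟩
    refine List.nodup_iff_count_le_one.2 fun v => ?_
    have := List.nodup_iff_count_le_one.1 hnd v
    simp only [List.count_append] at this ⊢
    omega
  · exact ⟨a₁, b₁, a₂, b₂, P₁, Q₁, P₂, Q₂, L₁, L₂,
      ⟨p₁, q₁, p₂, q₂, l₁, l₂, h, hne₂, hnd⟩, hneed, rfl⟩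

/-- A linked pair of cycles in which the first cycle is replaced by a triangle of paths: `A` joins
`x` to `b₁`, `B` joins `y` to `b₁` and `C` joins `x` to `y`. Both `x` and `y` are joined to `a₂`, by
`L` and `E`, and `b₁` is joined to `b₂` by `M`. -/
structure IsLinkedTriangle (G : SimpleGraph V) (x y b₁ a₂ b₂ : V) (A B C L E M P₂ Q₂ : List V) :
    Prop where
  linkA : Link G x A b₁
  linkB : Link G y B b₁
  linkC : Link G x C y
  linkL : Link G x L a₂
  linkE : Link G y E a₂
  linkM : Link G b₁ M b₂
  linkP₂ : Link G a₂ P₂ b₂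
  linkQ₂ : Link G a₂ Q₂ b₂
  ne₂ : Q₂ ≠ []
  nodup : ([x, y, b₁, a₂, b₂] ++ A ++ B ++ C ++ L ++ E ++ M ++ P₂ ++ Q₂).Nodup

/-- What an ear of the first cycle achieves: a linked pair of which both arcs of the first cycle
have interior vertices, or a linked triangle. -/
def HasImprovement (G : SimpleGraph V) (need : Prop) : Prop :=
  (∃ a₁ b₁ a₂ b₂ P₁ Q₁ P₂ Q₂ L₁ L₂, IsLinkedPair G a₁ b₁ a₂ b₂ P₁ Q₁ P₂ Q₂ L₁ L₂ ∧
    (need → P₂ ≠ []) ∧ P₁ ≠ []) ∨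
  ∃ x y b₁ a₂ b₂ A B C L E M P₂ Q₂, IsLinkedTriangle G x y b₁ a₂ b₂ A B C L E M P₂ Q₂ ∧
    (need → P₂ ≠ [])

/-- The effect of an ear `E` from `z` in the first cycle to `t`, for a linked pair whose joining
paths are as long as possible and in which `a₁b₁` is an edge. An ear that ends on the first cycle
would give longer joining paths, one that ends on the second cycle away from the joining paths
would give a prism. -/
theorem hasImprovement_of_ear (hG : NoSmallGraph G) {need : Prop} {a₁ b₁ a₂ b₂ z t : V}
    {Q' Q'' P₂ Q₂ L₁ L₂ E : List V}
    (h : IsLinkedPair G a₁ b₁ a₂ b₂ [] (Q' ++ z :: Q'') P₂ Q₂ L₁ L₂) (hneed : need → P₂ ≠ [])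
    (hmax : ∀ N, IsLinkLength G need N → N ≤ L₁.length + L₂.length)
    (hE : Link G z E t)
    (hnd : ([a₁, b₁, a₂, b₂] ++ (Q' ++ z :: Q'') ++ P₂ ++ Q₂ ++ L₁ ++ L₂ ++ E).Nodup)
    (hear : E = [] → ∀ X, a₁ :: Q' ≠ X ++ [t])
    (ht : t = a₁ ∨ t ∈ Q' ∨ t ∈ L₁ ∨ t = a₂ ∨ t ∈ P₂ ∨ t ∈ Q₂) : HasImprovement G need := by
  classical
  have hnd' := List.nodup_iff_count_le_one.1 hnd
  have hQ := h.linkQ₁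
  rw [link_append_cons] at hQ
  have hP := h.linkP₁
  have hL₂ : Link G z (Q'' ++ b₁ :: L₂) b₂ := link_append_cons.2 ⟨hQ.2, h.linkL₂⟩
  rcases ht with rfl | ht | ht | rfl | ht | ht
  · have := hmax _ (isLinkLength_of_links hE.symm hQ.1 h.linkP₂ h.linkQ₂ h.linkL₁ hL₂ (by
      rintro hE' rfl
      exact hear (by simpa using hE') [] rfl) h.ne₂ hneed (by
      refine List.nodup_iff_count_le_one.2 fun v => ?_
      have := hnd' v
      simp only [List.count_append, count_cons_hit, List.count_nil, List.count_reverse] at this ⊢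
      omega))
    simp at this
    omega
  · obtain ⟨R, R', rfl⟩ := List.append_of_mem ht
    rw [link_append_cons] at hQ
    have := hmax _ (isLinkLength_of_links (L₁ := R.reverse ++ a₁ :: L₁) hE.symm hQ.1.2 h.linkP₂
      h.linkQ₂ (link_append_cons.2 ⟨hQ.1.1.symm, h.linkL₁⟩) hL₂ (by
      rintro hE' rfl
      exact hear (by simpa using hE') (a₁ :: R) rfl) h.ne₂ hneed (by
      refine List.nodup_iff_count_le_one.2 fun v => ?_
      have := hnd' v
      simp only [List.count_append, count_cons_hit, List.count_nil, List.count_reverse] at this ⊢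
      omega))
    simp at this
    omega
  · obtain ⟨R, R', rfl⟩ := List.append_of_mem ht
    have hL := link_append_cons.1 h.linkL₁
    refine Or.inl ⟨t, b₁, a₂, b₂, R.reverse ++ a₁ :: [], E.reverse ++ z :: Q'', P₂, Q₂, R', L₂,
      ⟨link_append_cons.2 ⟨hL.1.symm, hP⟩, link_append_cons.2 ⟨hE.symm, hQ.2⟩, h.linkP₂, h.linkQ₂,
        hL.2, h.linkL₂, by simp, h.ne₂, ?_⟩, hneed, by simp⟩
    refine List.nodup_iff_count_le_one.2 fun v => ?_
    have := hnd' v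
    simp only [List.count_append, count_cons_hit, List.count_nil, List.count_reverse] at this ⊢
    omega
  · refine Or.inr ⟨a₁, z, b₁, t, b₂, [], Q'', Q', L₁, E, L₂, P₂, Q₂,
      ⟨hP, hQ.2, hQ.1, h.linkL₁, hE, h.linkL₂, h.linkP₂, h.linkQ₂, h.ne₂, ?_⟩, hneed⟩
    refine List.nodup_iff_count_le_one.2 fun v => ?_
    have := hnd' v
    simp only [List.count_append, count_cons_hit, List.count_nil] at this ⊢
    omega
  · obtain ⟨R, R', rfl⟩ := List.append_of_mem ht
    have hP₂ := link_append_cons.1 h.linkP₂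
    refine (hG.no_prism hP hQ.1 hQ.2.symm h.linkQ₂ hP₂.1 hP₂.2.symm h.linkL₁ h.linkL₂ hE ?_).elim
    refine List.nodup_iff_count_le_one.2 fun v => ?_
    have := hnd' v
    simp only [List.count_append, count_cons_hit, List.count_nil, List.count_reverse] at this ⊢
    omega
  · obtain ⟨R, R', rfl⟩ := List.append_of_mem ht
    have hQ₂ := link_append_cons.1 h.linkQ₂
    refine (hG.no_prism hP hQ.1 hQ.2.symm h.linkP₂ hQ₂.1 hQ₂.2.symm h.linkL₁ h.linkL₂ hE ?_).elim
    refine List.nodup_iff_count_le_one.2 fun v => ?_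
    have := hnd' v
    simp only [List.count_append, count_cons_hit, List.count_nil, List.count_reverse] at this ⊢
    omega

/-- If both arcs of the second cycle have interior vertices, then this cycle and the cycle through
`a₂`, `x`, `b₁`, `y` have `a₂` in common and are joined by `M`. -/
theorem NoSmallGraph.no_triangle_of_ne (hG : NoSmallGraph G) {x y b₁ a₂ b₂ : V}
    {A B C L E M P₂ Q₂ : List V} (h : IsLinkedTriangle G x y b₁ a₂ b₂ A B C L E M P₂ Q₂)
    (hP : P₂ ≠ []) : False := by
  classical
  refine hG.no_sharedVertex (A₁ := L.reverse ++ x :: A) (A₂ := E.reverse ++ y :: B) (by simp)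
    (by simp) hP h.ne₂ (link_append_cons.2 ⟨h.linkL.symm, h.linkA⟩)
    (link_append_cons.2 ⟨h.linkE.symm, h.linkB⟩) h.linkP₂ h.linkQ₂ h.linkM ?_
  refine List.nodup_iff_count_le_one.2 fun v => ?_
  have := List.nodup_iff_count_le_one.1 h.nodup v
  simp only [List.count_append, count_cons_hit, List.count_nil, List.count_reverse] at this ⊢
  omega

/-- Exchange `x` and `y`. -/
theorem IsLinkedTriangle.swap {x y b₁ a₂ b₂ : V} {A B C L E M P₂ Q₂ : List V}
    (h : IsLinkedTriangle G x y b₁ a₂ b₂ A B C L E M P₂ Q₂) :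
    IsLinkedTriangle G y x b₁ a₂ b₂ B A C.reverse E L M P₂ Q₂ := by
  classical
  refine ⟨h.linkB, h.linkA, h.linkC.symm, h.linkE, h.linkL, h.linkM, h.linkP₂, h.linkQ₂, h.ne₂, ?_⟩
  refine List.nodup_iff_count_le_one.2 fun v => ?_
  have := List.nodup_iff_count_le_one.1 h.nodup v
  simp only [List.count_append, count_cons_hit, List.count_nil, List.count_reverse] at this ⊢
  omega

/-- In a linked triangle with an edge `a₂b₂`, an ear from `z` on the second cycle to the part of
the triangle close to `x` gives a prism. -/
theorem IsLinkedTriangle.no_ear_to_triangle (hG : NoSmallGraph G) {x y b₁ a₂ b₂ z t : V}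
    {A B C L E M U W F : List V} (h : IsLinkedTriangle G x y b₁ a₂ b₂ A B C L E M [] (U ++ z :: W))
    (hF : Link G z F t)
    (hnd : ([x, y, b₁, a₂, b₂] ++ A ++ B ++ C ++ L ++ E ++ M ++ (U ++ z :: W) ++ F).Nodup)
    (ht : t = x ∨ t ∈ L ∨ t ∈ C ∨ t ∈ A) : False := by
  classical
  have hnd' := List.nodup_iff_count_le_one.1 hnd
  have hQ := link_append_cons.1 h.linkQ₂
  have hP : Link G b₂ [] a₂ := h.linkP₂.symm
  rcases ht with rfl | ht | ht | ht
  · refine hG.no_prism h.linkA h.linkC h.linkB.symm hQ.2 hQ.1.symm hP hF.symm h.linkM h.linkE ?_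
    refine List.nodup_iff_count_le_one.2 fun v => ?_
    have := hnd' v
    simp only [List.count_append, count_cons_hit, List.count_nil, List.count_reverse] at this ⊢
    omega
  · obtain ⟨R, R', rfl⟩ := List.append_of_mem ht
    have hL := link_append_cons.1 h.linkL
    refine hG.no_prism (C₁ := R ++ t :: F.reverse) h.linkA h.linkC h.linkB.symm hQ.2 hQ.1.symm hP
      (link_append_cons.2 ⟨hL.1, hF.symm⟩) h.linkM h.linkE ?_
    refine List.nodup_iff_count_le_one.2 fun v => ?_
    have := hnd' v
    simp only [List.count_append, count_cons_hit, List.count_nil, List.count_reverse] at this ⊢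
    omega
  · obtain ⟨R, R', rfl⟩ := List.append_of_mem ht
    have hC := link_append_cons.1 h.linkC
    refine hG.no_prism (A₁₂ := R' ++ y :: B) (link_append_cons.2 ⟨hC.2, h.linkB⟩) hC.1.symm
      h.linkA.symm hQ.2 hQ.1.symm hP hF.symm h.linkM h.linkL ?_
    refine List.nodup_iff_count_le_one.2 fun v => ?_
    have := hnd' v
    simp only [List.count_append, count_cons_hit, List.count_nil, List.count_reverse] at this ⊢
    omega
  · obtain ⟨R, R', rfl⟩ := List.append_of_mem ht
    have hA := link_append_cons.1 h.linkA
    refine hG.no_prism (A₂₃ := B.reverse ++ y :: C.reverse) hA.2 hA.1.symm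
      (link_append_cons.2 ⟨h.linkB.symm, h.linkC.symm⟩) hQ.2 hQ.1.symm hP hF.symm h.linkM
      h.linkL ?_
    refine List.nodup_iff_count_le_one.2 fun v => ?_
    have := hnd' v
    simp only [List.count_append, count_cons_hit, List.count_nil, List.count_reverse] at this ⊢
    omega

section Fintype

variable [Fintype V] [DecidableRel G.Adj]

/-- Applied to a linked pair with joining paths as long as possible, whose first cycle has an ear
if `a₁b₁` is an edge. -/
theorem hasImprovement_of_isLinkLength (hG : NoSmallGraph G) (h2 : G.TwoConnected)
    (hcompl : ∀ x y : V, ¬ G.IsCompliantEdge x y) {need : Prop}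
    (hex : ∃ N, IsLinkLength G need N) : HasImprovement G need := by
  classical
  obtain ⟨N, ⟨a₁, b₁, a₂, b₂, P₁, Q₁, P₂, Q₂, L₁, L₂, h, hneed, rfl⟩, hmax⟩ :=
    exists_greatest hex (b := Fintype.card V) (by
      rintro N ⟨a₁, b₁, a₂, b₂, P₁, Q₁, P₂, Q₂, L₁, L₂, h, -, rfl⟩
      rw [← List.length_append]
      refine nodup_length_le_card h.nodup ?_
      rw [List.append_assoc _ L₁ L₂]
      exact List.sublist_append_right _ _)
  by_cases hP : P₁ ≠ []
  · exact Or.inl ⟨a₁, b₁, a₂, b₂, P₁, Q₁, P₂, Q₂, L₁, L₂, h, hneed, hP⟩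
  push Not at hP
  subst hP
  have hnd := List.nodup_iff_count_le_one.1 h.nodup
  obtain ⟨Q', z, Q'', t, E, rfl, htS, htz, hE, hEnd, hES, hear⟩ := exists_ear h2 hcompl h.linkP₁
    h.linkQ₁ h.ne₁ (by
      refine List.nodup_iff_count_le_one.2 fun v => ?_
      have := hnd v
      simp only [List.count_append, count_cons_hit, List.count_nil] at this ⊢
      omega)
    (S := {v | v ∈ [a₁, b₁, a₂, b₂] ++ Q₁ ++ P₂ ++ Q₂ ++ L₁ ++ L₂}) (by
      intro v hv
      simp only [List.mem_append, List.mem_cons, List.not_mem_nil, or_false] at hv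
      show v ∈ _
      simp only [List.mem_append, List.mem_cons, List.not_mem_nil, or_false]
      tauto)
  have hndE : ([a₁, b₁, a₂, b₂] ++ (Q' ++ z :: Q'') ++ P₂ ++ Q₂ ++ L₁ ++ L₂ ++ E).Nodup := by
    refine List.Nodup.append ?_ hEnd fun v hv hv' => hES v hv' hv
    simpa using h.nodup
  have htS' : t ∈ [a₁, b₁, a₂, b₂] ++ (Q' ++ z :: Q'') ++ P₂ ++ Q₂ ++ L₁ ++ L₂ := htS
  simp only [List.mem_append, List.mem_cons, List.not_mem_nil, or_false] at htS'
  by_cases ht : t = a₁ ∨ t ∈ Q' ∨ t ∈ L₁ ∨ t = a₂ ∨ t ∈ P₂ ∨ t ∈ Q₂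
  · exact hasImprovement_of_ear hG h hneed hmax hE hndE (fun hE' => (hear hE').1) ht
  · have h' := h.swapEnds
    simp only [List.reverse_nil, List.reverse_append, List.reverse_cons, List.append_assoc,
      List.singleton_append] at h'
    refine hasImprovement_of_ear hG h' (by simpa using hneed)
      (fun N hN => (hmax N hN).trans (by omega)) hE ?_ ?_ ?_
    · refine List.nodup_iff_count_le_one.2 fun v => ?_
      have := List.nodup_iff_count_le_one.1 hndE v
      simp only [List.count_append, count_cons_hit, List.count_nil, List.count_reverse] at this ⊢
      omega
    · intro hE' X hX
      refine (hear hE').2 X.reverse ?_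
      have := congrArg List.reverse hX
      simpa using this
    · simp only [List.mem_reverse]
      rcases htS' with (((((h | h | h | h) | (h | h | h)) | h) | h) | h) | h <;>
        first
        | exact absurd h htz
        | (simp only [h, true_or, or_true]; done)
        | (refine absurd ?_ ht; simp only [h, true_or, or_true])

/-- In a linked pair of cycles, the second cycle has an edge between the ends of the joining
paths. -/
theorem linkedPair_snd_eq_nil (hG : NoSmallGraph G) (h2 : G.TwoConnected)
    (hcompl : ∀ x y : V, ¬ G.IsCompliantEdge x y) {a₁ b₁ a₂ b₂ : V} {P₁ Q₁ P₂ Q₂ L₁ L₂ : List V}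
    (h : IsLinkedPair G a₁ b₁ a₂ b₂ P₁ Q₁ P₂ Q₂ L₁ L₂) : P₂ = [] := by
  by_contra hne
  rcases hasImprovement_of_isLinkLength hG h2 hcompl (need := True)
    ⟨_, a₁, b₁, a₂, b₂, P₁, Q₁, P₂, Q₂, L₁, L₂, h, fun _ => hne, rfl⟩ with
    ⟨_, _, _, _, _, _, _, _, _, _, h', h1, h3⟩ | ⟨_, _, _, _, _, _, _, _, _, _, _, _, _, h', h1⟩
  · rcases hG.linkedPair_eq_nil h' with h4 | h4
    · exact h3 h4
    · exact h1 trivial h4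
  · exact hG.no_triangle_of_ne h' (h1 trivial)

/-- There is no linked pair in which both arcs of the second cycle have interior vertices. -/
theorem linkedPair_elim (hG : NoSmallGraph G) (h2 : G.TwoConnected)
    (hcompl : ∀ x y : V, ¬ G.IsCompliantEdge x y) {a₁ b₁ a₂ b₂ : V} {P₁ Q₁ P₂ Q₂ L₁ L₂ : List V}
    (p₁ : Link G a₁ P₁ b₁) (q₁ : Link G a₁ Q₁ b₁) (p₂ : Link G a₂ P₂ b₂) (q₂ : Link G a₂ Q₂ b₂)
    (l₁ : Link G a₁ L₁ a₂) (l₂ : Link G b₁ L₂ b₂) (hne₁ : P₁ = [] → Q₁ ≠ []) (hP₂ : P₂ ≠ [])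
    (hQ₂ : Q₂ ≠ [])
    (hnd : ([a₁, b₁, a₂, b₂] ++ P₁ ++ Q₁ ++ P₂ ++ Q₂ ++ L₁ ++ L₂).Nodup) : False := by
  obtain ⟨_, _, _, _, _, _, _, _, _, _, h, hne, -⟩ :=
    isLinkLength_of_links (need := True) p₁ q₁ p₂ q₂ l₁ l₂ hne₁ hQ₂ (fun _ => hP₂) hnd
  exact hne trivial (linkedPair_snd_eq_nil hG h2 hcompl h)

/-- For a linked triangle with `M` as long as possible, `a₂b₂` is an edge, and an ear from the
second cycle leads to one of the small graphs or to a linked pair of which one cycle is the cycle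
through `a₂`, `x`, `b₁`, `y`. -/
theorem not_isLinkedTriangle (hG : NoSmallGraph G) (h2 : G.TwoConnected)
    (hcompl : ∀ x y : V, ¬ G.IsCompliantEdge x y) {x y b₁ a₂ b₂ : V}
    {A B C L E M P₂ Q₂ : List V} : ¬ IsLinkedTriangle G x y b₁ a₂ b₂ A B C L E M P₂ Q₂ := by
  classical
  intro h₀
  -- a linked triangle for which `M` is as long as possible
  obtain ⟨N, ⟨x, y, b₁, a₂, b₂, A, B, C, L, E, M, P₂, Q₂, h, rfl⟩, hmax⟩ := exists_greatest
    (p := fun N => ∃ x y b₁ a₂ b₂ A B C L E M P₂ Q₂,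
      IsLinkedTriangle G x y b₁ a₂ b₂ A B C L E M P₂ Q₂ ∧ M.length = N)
    ⟨_, x, y, b₁, a₂, b₂, A, B, C, L, E, M, P₂, Q₂, h₀, rfl⟩ (b := Fintype.card V) (by
      rintro N ⟨x, y, b₁, a₂, b₂, A, B, C, L, E, M, P₂, Q₂, h, rfl⟩
      refine nodup_length_le_card h.nodup ?_
      rw [List.append_assoc _ P₂, List.append_assoc _ M]
      exact (List.sublist_append_left _ _).trans (List.sublist_append_right _ _))
  clear h₀
  by_cases hP : P₂ ≠ []
  · exact hG.no_triangle_of_ne h hP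
  push Not at hP
  subst hP
  have hnd := List.nodup_iff_count_le_one.1 h.nodup
  obtain ⟨U, z, W, t, F, rfl, htS, htz, hF, hFnd, hFS, hear⟩ := exists_ear h2 hcompl h.linkP₂
    h.linkQ₂ h.ne₂ (by
      refine List.nodup_iff_count_le_one.2 fun v => ?_
      have := hnd v
      simp only [List.count_append, count_cons_hit, List.count_nil] at this ⊢
      omega)
    (S := {v | v ∈ [x, y, b₁, a₂, b₂] ++ A ++ B ++ C ++ L ++ E ++ M ++ Q₂}) (by
      intro v hv
      simp only [List.mem_append, List.mem_cons, List.not_mem_nil, or_false] at hv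
      show v ∈ _
      simp only [List.mem_append, List.mem_cons, List.not_mem_nil, or_false]
      tauto)
  have hndF : ([x, y, b₁, a₂, b₂] ++ A ++ B ++ C ++ L ++ E ++ M ++ (U ++ z :: W) ++ F).Nodup := by
    refine List.Nodup.append ?_ hFnd fun v hv hv' => hFS v hv' hv
    simpa using h.nodup
  have hnd' := List.nodup_iff_count_le_one.1 hndF
  have htS' : t ∈ [x, y, b₁, a₂, b₂] ++ A ++ B ++ C ++ L ++ E ++ M ++ (U ++ z :: W) := htS
  simp only [List.mem_append, List.mem_cons, List.not_mem_nil, or_false] at htS'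
  have hQ := link_append_cons.1 h.linkQ₂
  by_cases ht1 : t = x ∨ t ∈ L ∨ t ∈ C ∨ t ∈ A
  · exact h.no_ear_to_triangle hG hF hndF ht1
  by_cases ht2 : t = y ∨ t ∈ E ∨ t ∈ B
  · refine h.swap.no_ear_to_triangle hG hF ?_ (by
      rcases ht2 with h | h | h <;> simp only [h, true_or, or_true])
    refine List.nodup_iff_count_le_one.2 fun v => ?_
    have := hnd' v
    simp only [List.count_append, count_cons_hit, List.count_nil, List.count_reverse] at this ⊢
    omega
  -- the cycle through `a₂`, `x`, `b₁`, `y`, whose arcs between `a₂` and `b₁` have interior vertices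
  have arc₁ : Link G a₂ (L.reverse ++ x :: A) b₁ := link_append_cons.2 ⟨h.linkL.symm, h.linkA⟩
  have arc₂ : Link G a₂ (E.reverse ++ y :: B) b₁ := link_append_cons.2 ⟨h.linkE.symm, h.linkB⟩
  have ht3 : t = a₂ ∨ t ∈ U ∨ t ∈ W ∨ t = b₂ ∨ t ∈ M ∨ t = b₁ := by
    rcases htS' with (((((((h | h | h | h | h) | h) | h) | h) | h) | h) | h) | (h | h | h) <;>
      first
      | exact absurd h htz
      | (simp only [h, true_or, or_true]; done)
      | (refine absurd ?_ ht1; simp only [h, true_or, or_true]; done)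
      | (refine absurd ?_ ht2; simp only [h, true_or, or_true])
  rcases ht3 with rfl | ht | ht | rfl | ht | rfl
  · -- shortening the second cycle makes `M` longer
    have hM : Link G b₁ (M ++ b₂ :: W.reverse) z := link_append_cons.2 ⟨h.linkM, hQ.2.symm⟩
    have key : ∀ P Q, Link G t P z → Link G t Q z → Q ≠ [] → (P ++ Q).Perm (F ++ U) → False := by
      intro P Q hP hQ' hne hperm
      have := hmax _ ⟨x, y, b₁, t, z, A, B, C, L, E, M ++ b₂ :: W.reverse, P, Q,
        ⟨h.linkA, h.linkB, h.linkC, h.linkL, h.linkE, hM, hP, hQ', hne, by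
          refine List.nodup_iff_count_le_one.2 fun v => ?_
          have h1 := hnd' v
          have h2 := hperm.count_eq v
          simp only [List.count_append, count_cons_hit, List.count_nil, List.count_reverse]
            at h1 h2 ⊢
          omega⟩, rfl⟩
      simp at this
    by_cases hU : U = []
    · refine key U F.reverse hQ.1 hF.symm ?_ ?_
      · intro hF'
        exact (hear (by simpa using hF')).1 [] (by simp [hU])
      · exact List.perm_append_comm.trans ((List.reverse_perm F).append_right U)
    · exact key F.reverse U hF.symm hQ.1 hU ((List.reverse_perm F).append_right U)
  · obtain ⟨R, R', rfl⟩ := List.append_of_mem ht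
    have hU := link_append_cons.1 hQ.1
    refine linkedPair_elim hG h2 hcompl (P₁ := F.reverse) hF.symm hU.2 arc₁ arc₂ hU.1.symm
      (L₂ := W ++ b₂ :: M.reverse) (link_append_cons.2 ⟨hQ.2, h.linkM.symm⟩) ?_ (by simp)
      (by simp) ?_
    · rintro hF' rfl
      exact (hear (by simpa using hF')).1 (a₂ :: R) (by simp)
    · refine List.nodup_iff_count_le_one.2 fun v => ?_
      have := hnd' v
      simp only [List.count_append, count_cons_hit, List.count_nil, List.count_reverse] at this ⊢
      omega
  · obtain ⟨R, R', rfl⟩ := List.append_of_mem ht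
    have hW := link_append_cons.1 hQ.2
    refine linkedPair_elim hG h2 hcompl hF hW.1 arc₁ arc₂ hQ.1.symm
      (L₂ := R' ++ b₂ :: M.reverse) (link_append_cons.2 ⟨hW.2, h.linkM.symm⟩) ?_ (by simp)
      (by simp) ?_
    · rintro hF' rfl
      exact (hear hF').2 (R' ++ [b₂]) (by simp)
    · refine List.nodup_iff_count_le_one.2 fun v => ?_
      have := hnd' v
      simp only [List.count_append, count_cons_hit, List.count_nil, List.count_reverse] at this ⊢
      omega
  · refine linkedPair_elim hG h2 hcompl hF hQ.2 arc₁ arc₂ hQ.1.symm h.linkM.symm ?_ (by simp)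
      (by simp) ?_
    · rintro hF' rfl
      exact (hear hF').2 [] (by simp)
    · refine List.nodup_iff_count_le_one.2 fun v => ?_
      have := hnd' v
      simp only [List.count_append, count_cons_hit, List.count_nil, List.count_reverse] at this ⊢
      omega
  · obtain ⟨R, R', rfl⟩ := List.append_of_mem ht
    have hM := link_append_cons.1 h.linkM
    refine hG.no_sharedVertex (B₁ := b₂ :: R'.reverse) (B₂ := U ++ z :: F) (by simp) (by simp)
      (by simp) (by simp) arc₁ arc₂ ⟨h.linkP₂, hM.2.symm⟩ (link_append_cons.2 ⟨hQ.1, hF⟩) hM.1 ?_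
    refine List.nodup_iff_count_le_one.2 fun v => ?_
    have := hnd' v
    simp only [List.count_append, count_cons_hit, List.count_nil, List.count_reverse] at this ⊢
    omega
  · refine hG.no_twoPairs h.linkC hQ.2.symm h.linkL h.linkE h.linkP₂.symm hQ.1.symm h.linkA h.linkB
      h.linkM.symm hF ?_
    refine List.nodup_iff_count_le_one.2 fun v => ?_
    have := hnd' v
    simp only [List.count_append, count_cons_hit, List.count_nil, List.count_reverse] at this ⊢
    omega

/-- If the first cycle has been made to have interior vertices on both arcs, the exchange of the
cycles gives a configuration that is already excluded. -/
theorem not_isLinkedPair (hG : NoSmallGraph G) (h2 : G.TwoConnected)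
    (hcompl : ∀ x y : V, ¬ G.IsCompliantEdge x y) {a₁ b₁ a₂ b₂ : V} {P₁ Q₁ P₂ Q₂ L₁ L₂ : List V} :
    ¬ IsLinkedPair G a₁ b₁ a₂ b₂ P₁ Q₁ P₂ Q₂ L₁ L₂ := by
  intro h
  rcases hasImprovement_of_isLinkLength hG h2 hcompl (need := False)
    ⟨_, a₁, b₁, a₂, b₂, P₁, Q₁, P₂, Q₂, L₁, L₂, h, fun h => h.elim, rfl⟩ with
    ⟨_, _, _, _, _, _, _, _, _, _, h', -, h3⟩ | ⟨_, _, _, _, _, _, _, _, _, _, _, _, _, h', -⟩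
  · exact h3 (linkedPair_snd_eq_nil hG h2 hcompl h'.swapCycles)
  · exact not_isLinkedTriangle hG h2 hcompl h'

end Fintype

/-! ### Two disjoint paths between two cycles -/

/-- If two vertices of `A` are joined to a vertex `t`, and `t` does not separate `A` from `C`, then
one vertex of `A` can be joined to `C` and another one to `t`. -/
theorem exists_link_and_link {t : V} (hG : (G.induce {t}ᶜ).Connected) {A C : Set V} {a a' c : V}
    {X X' : List V} (ha : a ∈ A) (ha' : a' ∈ A) (ht : t ∉ A) (h : Link G a X t)
    (h' : Link G a' X' t) (hnd : ([a, a', t] ++ X ++ X').Nodup) (hX : ∀ z ∈ X, z ∉ A ∧ z ∉ C)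
    (hX' : ∀ z ∈ X', z ∉ A ∧ z ∉ C) (hAC : Disjoint A C) (htC : t ∉ C) (hc : c ∈ C) :
    ∃ x ∈ A, ∃ x' ∈ A, ∃ y ∈ C, ∃ R R', Link G x R y ∧ Link G x' R' t ∧
      ([x, x', t] ++ R ++ R').Nodup ∧ (∀ z ∈ R, z ∉ A ∧ z ∉ C) ∧ ∀ z ∈ R', z ∉ A ∧ z ∉ C := by
  classical
  rw [Set.disjoint_left] at hAC
  have hnd₀ := List.nodup_iff_count_le_one.1 hnd
  obtain ⟨x, hx, hxt, y, hy, -, l, hl, hlnd, hlA⟩ := exists_link_avoiding hG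
    (A := A ∪ {v | v ∈ X ∨ v ∈ X'}) (B := C) (by
      rw [Set.disjoint_left]
      rintro v (hv | hv | hv) hvC
      · exact hAC hv hvC
      · exact (hX v hv).2 hvC
      · exact (hX' v hv).2 hvC)
    (Or.inl ha) (fun h => ht (h ▸ ha)) hc (fun h => htC (h ▸ hc))
  -- the new path starts on the path from `p` to `t`
  have key : ∀ (p p' : V) (Y Y' : List V), p ∈ A → p' ∈ A → Link G p Y t → Link G p' Y' t →
      ([p, p', t] ++ Y ++ Y').Nodup → (∀ z ∈ Y, z ∉ A ∧ z ∉ C ∧ z ∉ l) →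
      (∀ z ∈ Y', z ∉ A ∧ z ∉ C ∧ z ∉ l) → (x = p ∨ x ∈ Y) →
      ∃ x ∈ A, ∃ x' ∈ A, ∃ y ∈ C, ∃ R R', Link G x R y ∧ Link G x' R' t ∧
        ([x, x', t] ++ R ++ R').Nodup ∧ (∀ z ∈ R, z ∉ A ∧ z ∉ C) ∧ ∀ z ∈ R', z ∉ A ∧ z ∉ C := by
    intro p p' Y Y' hp hp' hY hY' hpnd hYA hYA' hxp
    have hnl : ∀ q ∈ A, q ∉ l := fun q hq hql => (hlA q hql).1 (Or.inl hq)
    have hd : ([p, p', t] ++ Y ++ Y' ++ l).Nodup := by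
      refine List.Nodup.append hpnd hlnd fun v hv hvl => ?_
      simp only [List.mem_append, List.mem_cons, List.not_mem_nil, or_false] at hv
      rcases hv with ((rfl | rfl | rfl) | hv) | hv
      · exact hnl _ hp hvl
      · exact hnl _ hp' hvl
      · exact (hlA _ hvl).2.2 rfl
      · exact (hYA v hv).2.2 hvl
      · exact (hYA' v hv).2.2 hvl
    have hd' := List.nodup_iff_count_le_one.1 hd
    rcases hxp with rfl | hxY
    · refine ⟨x, hp, p', hp', y, hy, l, Y', hl, hY', ?_, fun z hz =>
        ⟨fun h => hnl z h hz, (hlA z hz).2.1⟩, fun z hz => ⟨(hYA' z hz).1, (hYA' z hz).2.1⟩⟩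
      refine List.nodup_iff_count_le_one.2 fun v => ?_
      have := hd' v
      simp only [List.count_append, count_cons_hit, List.count_nil] at this ⊢
      omega
    · obtain ⟨Y₁, Y₂, rfl⟩ := List.append_of_mem hxY
      refine ⟨p, hp, p', hp', y, hy, Y₁ ++ x :: l, Y',
        link_append_cons.2 ⟨(link_append_cons.1 hY).1, hl⟩, hY', ?_, fun z hz => ?_, fun z hz =>
        ⟨(hYA' z hz).1, (hYA' z hz).2.1⟩⟩
      · refine List.nodup_iff_count_le_one.2 fun v => ?_
        have := hd' v
        simp only [List.count_append, count_cons_hit, List.count_nil] at this ⊢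
        omega
      · rw [List.mem_append, List.mem_cons] at hz
        rcases hz with hz | rfl | hz
        · exact ⟨(hYA z (by simp [hz])).1, (hYA z (by simp [hz])).2.1⟩
        · exact ⟨(hYA z (by simp)).1, (hYA z (by simp)).2.1⟩
        · exact ⟨fun h => hnl z h hz, (hlA z hz).2.1⟩
  have hXl : ∀ z ∈ X, z ∉ A ∧ z ∉ C ∧ z ∉ l := fun z hz =>
    ⟨(hX z hz).1, (hX z hz).2, fun hzl => (hlA z hzl).1 (Or.inr (Or.inl hz))⟩
  have hXl' : ∀ z ∈ X', z ∉ A ∧ z ∉ C ∧ z ∉ l := fun z hz =>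
    ⟨(hX' z hz).1, (hX' z hz).2, fun hzl => (hlA z hzl).1 (Or.inr (Or.inr hz))⟩
  by_cases hxa : x = a ∨ x ∈ X
  · exact key a a' X X' ha ha' h h' hnd hXl hXl' hxa
  by_cases hxa' : x = a' ∨ x ∈ X'
  · refine key a' a X' X ha' ha h' h ?_ hXl' hXl hxa'
    refine List.nodup_iff_count_le_one.2 fun v => ?_
    have := hnd₀ v
    simp only [List.count_append, count_cons_hit, List.count_nil] at this ⊢
    omega
  · push Not at hxa hxa'
    have hxA : x ∈ A := by
      rcases hx with hx | hx | hx
      · exact hx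
      · exact absurd hx hxa.2
      · exact absurd hx hxa'.2
    refine ⟨x, hxA, a, ha, y, hy, l, X, hl, h, ?_, fun z hz =>
      ⟨fun h => (hlA z hz).1 (Or.inl h), (hlA z hz).2.1⟩, hX⟩
    have h1 : ([x] ++ ([a, t] ++ X) ++ l).Nodup := by
      refine List.Nodup.append (List.Nodup.append (by simp) ?_ ?_) hlnd ?_
      · refine List.nodup_iff_count_le_one.2 fun v => ?_
        have := hnd₀ v
        simp only [List.count_append, count_cons_hit, List.count_nil] at this ⊢
        omega
      · simp [List.Disjoint, hxa.1, hxa.2, hxt]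
      · intro v hv hvl
        simp only [List.mem_append, List.mem_cons, List.not_mem_nil, or_false] at hv
        rcases hv with rfl | (rfl | rfl) | hv
        · exact (hlA _ hvl).1 hx
        · exact (hlA _ hvl).1 (Or.inl ha)
        · exact (hlA _ hvl).2.2 rfl
        · exact (hXl v hv).2.2 hvl
    refine List.nodup_iff_count_le_one.2 fun v => ?_
    have := List.nodup_iff_count_le_one.1 h1 v
    simp only [List.count_append, count_cons_hit, List.count_nil] at this ⊢
    omega

/-- There are two disjoint paths from `A` to `B` whose interiors avoid `A` and `B`. -/
def HasDisjointLinks (G : SimpleGraph V) (A B : Set V) : Prop :=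
  ∃ x ∈ A, ∃ x' ∈ A, ∃ y ∈ B, ∃ y' ∈ B, ∃ R R', Link G x R y ∧ Link G x' R' y' ∧
    ([x, x', y, y'] ++ R ++ R').Nodup ∧ (∀ z ∈ R, z ∉ A ∧ z ∉ B) ∧ ∀ z ∈ R', z ∉ A ∧ z ∉ B

theorem nodup_links {A B : Set V} (hAB : Disjoint A B) {x x' y y' : V} {R R' : List V}
    (hx : x ∈ A) (hx' : x' ∈ A) (hy : y ∈ B) (hyy : y ≠ y')
    (hnd : ([x, x', y'] ++ R ++ R').Nodup) (hR : ∀ z ∈ R, z ∉ A ∧ z ∉ B)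
    (hR' : ∀ z ∈ R', z ∉ A ∧ z ∉ B) : ([x, x', y, y'] ++ R ++ R').Nodup := by
  classical
  rw [Set.disjoint_left] at hAB
  have : (y :: ([x, x', y'] ++ R ++ R')).Nodup := by
    refine List.nodup_cons.2 ⟨?_, hnd⟩
    simp only [List.mem_append, List.mem_cons, List.not_mem_nil, or_false]
    rintro (((rfl | rfl | h) | h) | h)
    · exact hAB hx hy
    · exact hAB hx' hy
    · exact hyy h
    · exact (hR _ h).2 hy
    · exact (hR' _ h).2 hy
  refine List.nodup_iff_count_le_one.2 fun v => ?_
  have := List.nodup_iff_count_le_one.1 this v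
  simp only [List.count_append, count_cons_hit, List.count_nil] at this ⊢
  omega

/-- Two paths from `A` that meet only in a vertex `b` of `B` can be replaced by disjoint paths
from `A` to `B`. -/
theorem hasDisjointLinks_of_common_end {A B : Set V} (hAB : Disjoint A B) (hB : B.Nontrivial)
    {b : V} (hG : (G.induce {b}ᶜ).Connected) {a a' : V} {X X' : List V} (ha : a ∈ A)
    (ha' : a' ∈ A) (hb : b ∈ B) (h : Link G a X b) (h' : Link G a' X' b)
    (hnd : ([a, a', b] ++ X ++ X').Nodup) (hX : ∀ z ∈ X, z ∉ A ∧ z ∉ B)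
    (hX' : ∀ z ∈ X', z ∉ A ∧ z ∉ B) : HasDisjointLinks G A B := by
  obtain ⟨c, hc, hcb⟩ := hB.exists_ne b
  have hbA : b ∉ A := fun h => Set.disjoint_left.1 hAB h hb
  obtain ⟨x, hx, x', hx', y, hy, R, R', h1, h2, h3, h4, h5⟩ := exists_link_and_link hG
    (C := B \ {b}) (c := c) ha ha' hbA h h' hnd
    (fun z hz => ⟨(hX z hz).1, fun h => (hX z hz).2 h.1⟩)
    (fun z hz => ⟨(hX' z hz).1, fun h => (hX' z hz).2 h.1⟩)
    (hAB.mono_right Set.sdiff_subset) (fun h => h.2 rfl) ⟨hc, hcb⟩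
  have hbR : b ∉ R ++ R' := fun hb' => by
    have := (List.nodup_append.1 (by simpa only [List.append_assoc] using h3)).2.2 b (by simp) b hb'
    exact this rfl
  rw [List.mem_append, not_or] at hbR
  have h4' : ∀ z ∈ R, z ∉ A ∧ z ∉ B := fun z hz => ⟨(h4 z hz).1, fun hzB => (h4 z hz).2
    ⟨hzB, fun hzb => hbR.1 (hzb ▸ hz)⟩⟩
  have h5' : ∀ z ∈ R', z ∉ A ∧ z ∉ B := fun z hz => ⟨(h5 z hz).1, fun hzB => (h5 z hz).2
    ⟨hzB, fun hzb => hbR.2 (hzb ▸ hz)⟩⟩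
  exact ⟨x, hx, x', hx', y, hy.1, b, hb, R, R', h1, h2,
    nodup_links hAB hx hx' hy.1 hy.2 h3 h4' h5', h4', h5'⟩

/-- Two paths from `A` that meet in `t` and continue together by `S` to a vertex `b` of `B` can be
replaced by disjoint paths from `A` to `B`, by induction on the length of `S`: the removal of `t`
leaves a path from `A` or one of the two paths to `B` or to a vertex further on in `S`. -/
theorem hasDisjointLinks_of_fork {A B : Set V} (hAB : Disjoint A B) (hB : B.Nontrivial)
    (hG : ∀ v, (G.induce {v}ᶜ).Connected) {b : V} (hb : b ∈ B) (N : ℕ) : ∀ {a a' t : V}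
    {X X' S : List V}, S.length ≤ N → a ∈ A → a' ∈ A → t ∉ A → t ∉ B → Link G a X t →
      Link G a' X' t → Link G t S b → ([a, a', t, b] ++ X ++ X' ++ S).Nodup → (∀ z ∈ X, z ∉ A ∧ z ∉ B) →
      (∀ z ∈ X', z ∉ A ∧ z ∉ B) → (∀ z ∈ S, z ∉ A ∧ z ∉ B) → HasDisjointLinks G A B := by
  classical
  induction N with
  | zero => ?_
  | succ N ih => ?_
  all_goals
    intro a a' t X X' S hN ha ha' htA htB h h' hS hnd hX hX' hSA
    have hnd₀ := List.nodup_iff_count_le_one.1 hnd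
    obtain ⟨x, hx, x', hx', y, hy, R, R', h1, h2, h3, h4, h5⟩ := exists_link_and_link (hG t)
      (C := {v | v ∈ S ∨ v ∈ B}) (c := b) ha ha' htA h h' (by
        refine List.nodup_iff_count_le_one.2 fun v => ?_
        have := hnd₀ v
        simp only [List.count_append, count_cons_hit, List.count_nil] at this ⊢
        omega)
      (fun z hz => ⟨(hX z hz).1, by
        rintro (hzS | hzB)
        · have := hnd₀ z
          have h1 := List.count_pos_iff.2 hz
          have h2 := List.count_pos_iff.2 hzS
          simp only [List.count_append] at this
          omega
        · exact (hX z hz).2 hzB⟩)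
      (fun z hz => ⟨(hX' z hz).1, by
        rintro (hzS | hzB)
        · have := hnd₀ z
          have h1 := List.count_pos_iff.2 hz
          have h2 := List.count_pos_iff.2 hzS
          simp only [List.count_append] at this
          omega
        · exact (hX' z hz).2 hzB⟩)
      (Set.disjoint_left.2 fun v hvA hv => by
        rcases hv with hv | hv
        · exact (hSA v hv).1 hvA
        · exact Set.disjoint_left.1 hAB hvA hv)
      (by
        rintro (htS | htB')
        · have := hnd₀ t
          have h2 := List.count_pos_iff.2 htS
          simp only [List.count_append, count_cons_hit, hit, if_true] at this
          omega
        · exact htB htB') (Or.inr hb)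
    have h4' : ∀ z ∈ R, z ∉ A ∧ z ∉ B := fun z hz => ⟨(h4 z hz).1, fun h => (h4 z hz).2 (Or.inr h)⟩
    have h5' : ∀ z ∈ R', z ∉ A ∧ z ∉ B := fun z hz => ⟨(h5 z hz).1, fun h => (h5 z hz).2 (Or.inr h)⟩
    have hbS : (b :: S).Nodup := by
      refine List.nodup_iff_count_le_one.2 fun v => ?_
      have := hnd₀ v
      simp only [List.count_append, count_cons_hit, List.count_nil] at this ⊢
      omega
    -- all the vertices involved other than `y` are distinct
    have hall : ([x, x', t] ++ R ++ R' ++ (b :: S)).Nodup := by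
      refine List.Nodup.append h3 hbS fun v hv hvS => ?_
      have hvC : v ∈ S ∨ v ∈ B := by
        rcases List.mem_cons.1 hvS with rfl | hvS
        · exact Or.inr hb
        · exact Or.inl hvS
      have hvA : v ∉ A := by
        rcases List.mem_cons.1 hvS with rfl | hvS
        · exact fun h => Set.disjoint_left.1 hAB h hb
        · exact (hSA v hvS).1
      simp only [List.mem_append, List.mem_cons, List.not_mem_nil, or_false] at hv
      rcases hv with ((rfl | rfl | rfl) | hv) | hv
      · exact hvA hx
      · exact hvA hx'
      · rcases List.mem_cons.1 hvS with rfl | hvS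
        · exact htB hb
        · have := hnd₀ v
          have h2 := List.count_pos_iff.2 hvS
          simp only [List.count_append, count_cons_hit, hit, if_true] at this
          omega
      · exact (h4 v hv).2 hvC
      · exact (h5 v hv).2 hvC
    have hall' := List.nodup_iff_count_le_one.1 hall
    have hRtS : ∀ z ∈ R' ++ t :: S, z ∉ A ∧ z ∉ B := by
      intro z hz
      rw [List.mem_append, List.mem_cons] at hz
      rcases hz with hz | rfl | hz
      · exact h5' z hz
      · exact ⟨htA, htB⟩
      · exact hSA z hz
    have hnd' : ([x, x', b] ++ R ++ (R' ++ t :: S)).Nodup := by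
      refine List.nodup_iff_count_le_one.2 fun v => ?_
      have := hall' v
      simp only [List.count_append, count_cons_hit, List.count_nil] at this ⊢
      omega
    by_cases hyb : y = b
    · subst hyb
      exact hasDisjointLinks_of_common_end hAB hB (hG y) hx hx' hb h1 (link_append_cons.2 ⟨h2, hS⟩)
        hnd' h4' hRtS
    rcases hy with hyS | hyB
    swap
    · exact ⟨x, hx, x', hx', y, hyB, b, hb, R, R' ++ t :: S, h1, link_append_cons.2 ⟨h2, hS⟩,
        nodup_links hAB hx hx' hyB hyb hnd' h4' hRtS, h4', hRtS⟩
    obtain ⟨S₁, S₂, rfl⟩ := List.append_of_mem hyS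
  · simp at hN
  · rw [link_append_cons] at hS
    refine ih (a := x) (a' := x') (t := y) (X := R) (X' := R' ++ t :: S₁) (S := S₂) ?_ hx hx'
      (hSA y hyS).1 (hSA y hyS).2 h1 (link_append_cons.2 ⟨h2, hS.1⟩) hS.2 ?_ h4' ?_ ?_
    · simp only [List.length_append, List.length_cons] at hN
      omega
    · refine List.nodup_iff_count_le_one.2 fun v => ?_
      have := hall' v
      simp only [List.count_append, count_cons_hit, List.count_nil] at this ⊢
      omega
    · intro z hz
      refine hRtS z ?_
      simp only [List.mem_append, List.mem_cons] at hz ⊢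
      tauto
    · intro z hz
      exact hSA z (by simp [hz])

/-- The case of two paths of Menger's theorem. -/
theorem hasDisjointLinks [Fintype V] (hG : G.TwoConnected) {A B : Set V} (hAB : Disjoint A B)
    (hA : A.Nontrivial) (hB : B.Nontrivial) : HasDisjointLinks G A B := by
  classical
  obtain ⟨a, ha, b, hb, P, hP, hPnd, hPA⟩ := exists_link hG.2.1 hAB hA.nonempty hB.nonempty
  obtain ⟨a₀, ha₀, hne⟩ := hA.exists_ne a
  have hba : b ≠ a := fun h => Set.disjoint_left.1 hAB ha (h ▸ hb)
  obtain ⟨x, hx, hxa, y, hy, hya, l, hl, hlnd, hlA⟩ := exists_link_avoiding (hG.2.2 a) (A := A)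
    (B := {v | v ∈ P ∨ v ∈ B}) (Set.disjoint_left.2 fun v hvA hv => by
      rcases hv with hv | hv
      · exact (hPA v hv).1 hvA
      · exact Set.disjoint_left.1 hAB hvA hv) ha₀ hne (Or.inr hb) hba
  have hlA' : ∀ z ∈ l, z ∉ A ∧ z ∉ B := fun z hz => ⟨(hlA z hz).1, fun h =>
    (hlA z hz).2.1 (Or.inr h)⟩
  have hall : ([x, a, b] ++ l ++ P).Nodup := by
    have h1 : ([x, a, b] ++ l).Nodup := by
      refine List.Nodup.append ?_ hlnd fun v hv hvl => ?_
      · have hxb : x ≠ b := fun h => Set.disjoint_left.1 hAB hx (h ▸ hb)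
        simp [hxa, hxb, hba.symm]
      · simp only [List.mem_cons, List.not_mem_nil, or_false] at hv
        rcases hv with rfl | rfl | rfl
        · exact (hlA' _ hvl).1 hx
        · exact (hlA' _ hvl).1 ha
        · exact (hlA' _ hvl).2 hb
    refine List.Nodup.append h1 hPnd fun v hv hvP => ?_
    simp only [List.mem_append, List.mem_cons, List.not_mem_nil, or_false] at hv
    rcases hv with (rfl | rfl | rfl) | hv
    · exact (hPA _ hvP).1 hx
    · exact (hPA _ hvP).1 ha
    · exact (hPA _ hvP).2 hb
    · exact (hlA v hv).2.1 (Or.inl hvP)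
  by_cases hyb : y = b
  · subst hyb
    exact hasDisjointLinks_of_common_end hAB hB (hG.2.2 y) hx ha hb hl hP hall hlA' hPA
  rcases hy with hyP | hyB
  swap
  · exact ⟨x, hx, a, ha, y, hyB, b, hb, l, P, hl, hP, nodup_links hAB hx ha hyB hyb hall hlA' hPA,
      hlA', hPA⟩
  obtain ⟨P₁, P₂, rfl⟩ := List.append_of_mem hyP
  rw [link_append_cons] at hP
  refine hasDisjointLinks_of_fork hAB hB hG.2.2 hb _ le_rfl hx ha (hPA y hyP).1 (hPA y hyP).2 hl
    hP.1 hP.2 ?_ hlA' (fun z hz => hPA z (by simp [hz])) (fun z hz => hPA z (by simp [hz]))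
  refine List.nodup_iff_count_le_one.2 fun v => ?_
  have := List.nodup_iff_count_le_one.1 hall v
  simp only [List.count_append, count_cons_hit, List.count_nil] at this ⊢
  omega

theorem link_dropLast_support {u t v : V} (h : G.Adj u t) (p : G.Walk t v) :
    Link G u p.support.dropLast v := by
  induction p generalizing u with
  | nil => simpa using h
  | @cons t s v hts p ih =>
    rw [SimpleGraph.Walk.support_cons, List.dropLast_cons_of_ne_nil p.support_ne_nil]
    exact ⟨h, ih hts⟩

/-- Two vertices of a cycle split it into two paths, one of which has an interior vertex. -/
theorem exists_links_of_isCycle {u : V} {c : G.Walk u u} (hc : c.IsCycle) {a b : V}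
    (ha : a ∈ c.support) (hb : b ∈ c.support) (hab : a ≠ b) :
    ∃ P Q, Link G a P b ∧ Link G a Q b ∧ Q ≠ [] ∧ ([a, b] ++ P ++ Q).Nodup ∧
      ∀ z ∈ P ++ Q, z ∈ c.support := by
  classical
  have hmem : ∀ z, z ∈ (c.rotate a ha).support → z ∈ c.support := fun z hz =>
    (SimpleGraph.Walk.mem_support_rotate_iff ..).1 hz
  have hb' : b ∈ (c.rotate a ha).support := (SimpleGraph.Walk.mem_support_rotate_iff ..).2 hb
  have hc' := hc.rotate ha
  revert hmem hb' hc'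
  generalize c.rotate a ha = d
  intro hmem hb hd
  cases d with
  | nil => exact absurd rfl hd.ne_nil
  | @cons _ t _ h p =>
    have hlen := hd.three_le_length
    have hnd : p.support.Nodup := by simpa using hd.support_nodup
    have hsup : p.support = p.support.dropLast ++ [a] :=
      (List.dropLast_append_getLast p.support_ne_nil).symm.trans (by rw [p.getLast_support])
    have hl := link_dropLast_support h p
    have hlen' : p.support.length = p.length + 1 := p.length_support
    rw [SimpleGraph.Walk.length_cons] at hlen
    have hbl : b ∈ p.support.dropLast := by
      rw [SimpleGraph.Walk.support_cons, hsup, List.mem_cons, List.mem_append,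
        List.mem_singleton] at hb
      rcases hb with hb | hb | hb
      exacts [absurd hb.symm hab, hb, absurd hb.symm hab]
    have hsub : ∀ z ∈ p.support.dropLast, z ∈ c.support := fun z hz =>
      hmem z (by rw [SimpleGraph.Walk.support_cons]; exact List.mem_cons_of_mem _
                  (List.mem_of_mem_dropLast hz))
    rw [hsup] at hnd hlen'
    revert hnd hl hlen' hbl hsub
    generalize p.support.dropLast = l
    intro hnd hl hlen' hbl hsub
    obtain ⟨P, Q, rfl⟩ := List.append_of_mem hbl
    rw [link_append_cons] at hl
    have hnd' := List.nodup_iff_count_le_one.1 hnd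
    by_cases hQ : Q = []
    · subst hQ
      refine ⟨[], P, hl.2.symm, hl.1, ?_, ?_, fun z hz => hsub z (by simpa using Or.inl hz)⟩
      · rintro rfl
        simp at hlen'
        omega
      · refine List.nodup_iff_count_le_one.2 fun v => ?_
        have := hnd' v
        simp only [List.count_append, count_cons_hit, List.count_nil] at this ⊢
        omega
    · refine ⟨P, Q.reverse, hl.1, hl.2.symm, by simpa using hQ, ?_, fun z hz => hsub z (by
        simp only [List.mem_append, List.mem_reverse] at hz
        rcases hz with hz | hz <;> simp [hz])⟩
      refine List.nodup_iff_count_le_one.2 fun v => ?_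
      have := hnd' v
      simp only [List.count_append, count_cons_hit, List.count_nil, List.count_reverse] at this ⊢
      omega

theorem nontrivial_support_of_isCycle {u : V} {c : G.Walk u u} (hc : c.IsCycle) :
    {v | v ∈ c.support}.Nontrivial := by
  cases c with
  | nil => exact absurd rfl hc.ne_nil
  | @cons _ t _ h p => exact ⟨u, by simp, t, by simp, h.ne⟩

/-- Two disjoint cycles of a 2-connected graph are joined by two disjoint paths. -/
theorem exists_isLinkedPair [Fintype V] (hG : G.TwoConnected) (h : G.HasTwoDisjointCycles) :
    ∃ a₁ b₁ a₂ b₂ P₁ Q₁ P₂ Q₂ L₁ L₂, IsLinkedPair G a₁ b₁ a₂ b₂ P₁ Q₁ P₂ Q₂ L₁ L₂ := by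
  classical
  obtain ⟨u, v, c, d, hc, hd, hcd⟩ := h
  obtain ⟨a₁, ha₁, b₁, hb₁, a₂, ha₂, b₂, hb₂, L₁, L₂, hL₁, hL₂, hnd, hLA₁, hLA₂⟩ :=
    hasDisjointLinks hG (A := {v | v ∈ c.support}) (B := {v | v ∈ d.support})
      (Set.disjoint_left.2 hcd) (nontrivial_support_of_isCycle hc) (nontrivial_support_of_isCycle hd)
  have hnd' := hnd
  simp only [List.append_assoc, List.cons_append, List.nodup_cons, List.mem_cons, not_or] at hnd'
  obtain ⟨P₁, Q₁, hP₁, hQ₁, hne₁, hnd₁, hs₁⟩ := exists_links_of_isCycle hc ha₁ hb₁ hnd'.1.1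
  obtain ⟨P₂, Q₂, hP₂, hQ₂, hne₂, hnd₂, hs₂⟩ := exists_links_of_isCycle hd ha₂ hb₂ hnd'.2.2.1.1
  refine ⟨a₁, b₁, a₂, b₂, P₁, Q₁, P₂, Q₂, L₁, L₂, hP₁, hQ₁, hP₂, hQ₂, hL₁, hL₂, hne₁, hne₂, ?_⟩
  have hs₁' : ∀ z ∈ [a₁, b₁] ++ P₁ ++ Q₁, z ∈ c.support := by
    intro z hz
    rw [List.append_assoc, List.mem_append] at hz
    rcases hz with hz | hz
    · simp only [List.mem_cons, List.not_mem_nil, or_false] at hz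
      rcases hz with rfl | rfl
      exacts [ha₁, hb₁]
    · exact hs₁ z hz
  have hs₂' : ∀ z ∈ [a₂, b₂] ++ P₂ ++ Q₂, z ∈ d.support := by
    intro z hz
    rw [List.append_assoc, List.mem_append] at hz
    rcases hz with hz | hz
    · simp only [List.mem_cons, List.not_mem_nil, or_false] at hz
      rcases hz with rfl | rfl
      exacts [ha₂, hb₂]
    · exact hs₂ z hz
  have key : (([a₁, b₁] ++ P₁ ++ Q₁) ++ ([a₂, b₂] ++ P₂ ++ Q₂) ++ (L₁ ++ L₂)).Nodup := by
    refine List.Nodup.append (List.Nodup.append hnd₁ hnd₂ fun z hz hz' =>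
      hcd z (hs₁' z hz) (hs₂' z hz')) ?_ fun z hz hz' => ?_
    · rw [List.append_assoc] at hnd
      exact (List.nodup_append.1 hnd).2.1
    · have hL : z ∉ c.support ∧ z ∉ d.support := by
        rcases List.mem_append.1 hz' with h | h
        exacts [hLA₁ z h, hLA₂ z h]
      rcases List.mem_append.1 hz with h | h
      exacts [hL.1 (hs₁' z h), hL.2 (hs₂' z h)]
  refine List.nodup_iff_count_le_one.2 fun v => ?_
  have := List.nodup_iff_count_le_one.1 key v
  simp only [List.count_append, count_cons_hit, List.count_nil] at this ⊢
  omega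

end DisjointCycles

theorem theorem2p4 {V : Type*} [Fintype V] (G : SimpleGraph V) [DecidableRel G.Adj]
    (hcard : 11 ≤ Fintype.card V)
    (hconn : G.TwoConnected)
    (hcompl : ∀ x y : V, ¬ G.IsCompliantEdge x y)
    (hcyc : G.HasTwoDisjointCycles) :
    ¬ G.Metrizable := by
  intro hm
  obtain ⟨_, _, _, _, _, _, _, _, _, _, h⟩ := DisjointCycles.exists_isLinkedPair hconn hcyc
  exact DisjointCycles.not_isLinkedPair
    (fun k hk => DisjointCycles.not_contains_smallGraph hcard hconn hm k hk) hconn hcompl h
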